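/- Let $(W,S)$ be a Coxeter system of type $A_2$, let $T=\bigcup_{w\in W}wSw^{-1}$ be its set of reflections, and let $V$ be a reflection faithful real representation of $W$, that is, a finite-dimensional faithful representation such that $w\in W$ fixes pointwise a subspace of codimension exactly one (i.e. $\operatorname{codim}V^w=1$) if and only if $w\in T$. Let $R=S(V^*)$ be the ring of polynomial functions on $V$, graded with $V^*$ in degree $2$, with its induced $W$-action. For a $\mathbb{Z}$-graded $R$-bimodule $M$ (on which $\mathbb{R}$ acts in the same way from both sides) let $M(n)$ denote the shift $M(n)_d=M_{d+n}$. For $t\in T$ put $B_t=R\otimes_{R^t}R(1)$, where $R^t$ is the subring of $t$-invariants, and for $w\in W$ let $R_w$ be the graded left module $R$ with right operation $a\cdot r=a\,w(r)$. Let $\mathcal{C}$ (respectively $\mathcal{C}^{\mathrm{ext}}$) be the full subcategory of the category of graded $R$-bimodules (with morphisms of degree $0$) whose objects are the direct summands of finite direct sums of shifts of tensor products over $R$ (the empty product being $R$) of the bimodules $B_t$, $t\in T$ (respectively, of the bimodules $B_t$, $t\in T$, and $R_w$, $w\in W$). Its split Grothendieck ring is the abelian group generated by the isomorphism classes $\langle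 M\rangle$ of objects, with relations $\langle M\oplus N\rangle=\langle M\rangle+\langle N\rangle$ and product $\langle M\rangle\langle N\rangle=\langle M\otimes_RN\rangle$; it is a $\mathbb{Z}[v^{\pm1}]$-algebra in which $v$ acts by the shift $(1)$. Then, up to isomorphism and grading shift, the indecomposable objects of $\mathcal{C}^{\mathrm{ext}}$ are those of $\mathcal{C}$ together with the $R_w$ for $w\in W\setminus\{e\}$. That is, a graded $R$-bimodule is an indecomposable object of $\mathcal{C}^{\mathrm{ext}}$ if and only if it is an indecomposable object of $\mathcal{C}$ or is isomorphic to $R_w(n)$ for some $w\neq e$ and $n\in\mathbb{Z}$; moreover no $R_w(n)$ with $w\ne e$ lies in $\mathcal{C}$, and $R_w\cong R_{w'}(n)$ implies $w=w'$. Hence the split Grothendieck ring $\langle\mathcal{C}^{\mathrm{ext}}\rangle$ is free of rank $25$ as a $\mathbb{Z}[v^{\pm1}]$-module. -/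

import Mathlib

open scoped TensorProduct LaurentPolynomial

noncomputable section

namespace SoergelExt

universe u

/-! ### Internal gradings -/

section Gradings

variable {M : Type*} [AddCommGroup M] [Module ℝ M]

/-- The map `m ↦ ∑_d m_d v^d` recording the homogeneous components of an internal grading. -/
def components (gr : ℤ → Submodule ℝ M) (h : DirectSum.IsInternal gr) : M →ₗ[ℝ] ℤ →₀ M :=
  (DirectSum.toModule ℝ ℤ (ℤ →₀ M) fun d => Finsupp.lsingle d ∘ₗ (gr d).subtype) ∘ₗ
    (LinearEquiv.ofBijective (DirectSum.coeLinearMap gr) h).symm.toLinearMap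

theorem components_of_mem (gr : ℤ → Submodule ℝ M) (h : DirectSum.IsInternal gr) {d : ℤ} {m : M}
    (hm : m ∈ gr d) : components gr h m = Finsupp.single d m := by
  have : (LinearEquiv.ofBijective (DirectSum.coeLinearMap gr) h).symm m =
      DirectSum.lof ℝ ℤ (fun i => gr i) d ⟨m, hm⟩ := by
    rw [LinearEquiv.symm_apply_eq]
    exact (DirectSum.coeLinearMap_lof gr d ⟨m, hm⟩).symm
  simp only [components, LinearMap.comp_apply, LinearEquiv.coe_coe, this, DirectSum.toModule_lof]
  simp

theorem components_mem (gr : ℤ → Submodule ℝ M) (h : DirectSum.IsInternal gr) (m : M) (d : ℤ) :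
    components gr h m d ∈ gr d := by
  have hm : m ∈ ⨆ d, gr d := h.submodule_iSup_eq_top ▸ Submodule.mem_top
  have : ⨆ e, gr e ≤ (gr d).comap (Finsupp.lapply d ∘ₗ components gr h) := by
    refine iSup_le fun e x hx => ?_
    by_cases hed : e = d
    · subst hed
      simpa [components_of_mem gr h hx] using hx
    · simp [components_of_mem gr h hx, Finsupp.single_eq_of_ne (Ne.symm hed)]
  exact this hm

theorem components_sum (gr : ℤ → Submodule ℝ M) (h : DirectSum.IsInternal gr) (m : M) :
    ((components gr h m).sum fun _ x => x) = m := by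
  have hm : m ∈ ⨆ d, gr d := h.submodule_iSup_eq_top ▸ Submodule.mem_top
  have : ⨆ e, gr e ≤ LinearMap.eqLocus
      ((Finsupp.lsum ℝ fun _ : ℤ => LinearMap.id) ∘ₗ components gr h) LinearMap.id := by
    refine iSup_le fun e x hx => ?_
    simp [components_of_mem gr h hx]
  have h2 := this hm
  simp only [LinearMap.mem_eqLocus, LinearMap.comp_apply, Finsupp.lsum_apply] at h2
  exact h2

theorem isInternal_iSup_eq_top {gr : ℤ → Submodule ℝ M} (h : DirectSum.IsInternal gr) :
    ⨆ d, gr d = ⊤ :=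
  h.submodule_iSup_eq_top

/-- To check that a family of submodules is an internal grading it is enough that it spans and
that there is a linear map extracting homogeneous components. -/
theorem isInternal_of_components (gr : ℤ → Submodule ℝ M) (htop : ⨆ d, gr d = ⊤)
    (D : M →ₗ[ℝ] ℤ →₀ M) (hD : ∀ d, ∀ m ∈ gr d, D m = Finsupp.single d m) :
    DirectSum.IsInternal gr := by
  classical
  refine ⟨?_, ?_⟩
  · rw [injective_iff_map_eq_zero]
    intro x hx
    have key : ∀ x : DirectSum ℤ fun i => gr i, ∀ d,
        D (DirectSum.coeAddMonoidHom gr x) d = x d := by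
      intro x d
      induction x using DirectSum.induction_on with
      | zero => simp
      | of i y =>
        rw [DirectSum.coeAddMonoidHom_of, hD i _ y.2]
        by_cases hid : i = d
        · subst hid; simp
        · rw [Finsupp.single_eq_of_ne (Ne.symm hid), DirectSum.of_eq_of_ne _ _ _ (Ne.symm hid)]
          simp
      | add x y hx hy => simp [map_add, hx, hy]
    ext d
    have := key x d
    rw [hx] at this
    simpa using this.symm
  · intro m
    have hm : m ∈ ⨆ d, gr d := htop ▸ Submodule.mem_top
    induction hm using Submodule.iSup_induction' with
    | mem d m hm => exact ⟨DirectSum.of (fun i => gr i) d ⟨m, hm⟩, by simp⟩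
    | zero => exact ⟨0, by simp⟩
    | add x y _ _ hx hy =>
      obtain ⟨a, rfl⟩ := hx
      obtain ⟨b, rfl⟩ := hy
      exact ⟨a + b, by simp⟩

end Gradings

/-! ### The graded polynomial ring of `V` -/

/-- The ring `R = S(V*)` of polynomial functions on `V`. -/
abbrev Pol (V : Type u) [AddCommGroup V] [Module ℝ V] : Type u :=
  SymmetricAlgebra ℝ (Module.Dual ℝ V)

section Polynomials

variable (V : Type u) [AddCommGroup V] [Module ℝ V]

instance : CommRing (Pol V) := inferInstance

instance : Semiring (Pol V) := inferInstance

instance : Algebra ℝ (Pol V) := inferInstance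

/-- The degree `d` component of `R`, where the linear forms are in degree `2`: it is the span of
the products of `n` linear forms if `d = 2n` with `n` a natural number, and zero otherwise. -/
def polGr (d : ℤ) : Submodule ℝ (Pol V) :=
  ⨆ (n : ℕ) (_ : 2 * (n : ℤ) = d), LinearMap.range (SymmetricAlgebra.ι ℝ (Module.Dual ℝ V)) ^ n

variable {V}

theorem mem_polGr {d : ℤ} (n : ℕ) (hn : 2 * (n : ℤ) = d) {r : Pol V}
    (hr : r ∈ LinearMap.range (SymmetricAlgebra.ι ℝ (Module.Dual ℝ V)) ^ n) : r ∈ polGr V d :=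
  Submodule.mem_iSup_of_mem n (Submodule.mem_iSup_of_mem hn hr)

theorem one_mem_polGr : (1 : Pol V) ∈ polGr V 0 :=
  mem_polGr 0 (by simp) (by simp)

theorem ι_mem_polGr (f : Module.Dual ℝ V) :
    SymmetricAlgebra.ι ℝ (Module.Dual ℝ V) f ∈ polGr V 2 :=
  mem_polGr 1 (by simp) (by simp)

theorem mul_mem_polGr {d e : ℤ} {r s : Pol V} (hr : r ∈ polGr V d) (hs : s ∈ polGr V e) :
    r * s ∈ polGr V (d + e) := by
  suffices polGr V d * polGr V e ≤ polGr V (d + e) from this (Submodule.mul_mem_mul hr hs)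
  simp only [polGr, Submodule.iSup_mul, Submodule.mul_iSup]
  refine iSup₂_le fun k hk => iSup₂_le fun n hn => ?_
  rw [← pow_add]
  exact le_iSup₂_of_le (n + k) (by push_cast; linarith) le_rfl

theorem iSup_polGr : ⨆ d, polGr V d = ⊤ := by
  rw [eq_top_iff]
  intro r _
  induction r using SymmetricAlgebra.induction with
  | algebraMap c =>
    rw [Algebra.algebraMap_eq_smul_one]
    exact Submodule.smul_mem _ _ (Submodule.mem_iSup_of_mem 0 one_mem_polGr)
  | ι f => exact Submodule.mem_iSup_of_mem 2 (ι_mem_polGr f)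
  | add a b ha hb => exact Submodule.add_mem _ (ha trivial) (hb trivial)
  | mul a b ha hb =>
    have : (⨆ d, polGr V d) * (⨆ d, polGr V d) ≤ ⨆ d, polGr V d := by
      simp only [Submodule.iSup_mul, Submodule.mul_iSup]
      refine iSup_le fun d => iSup_le fun e => ?_
      rw [Submodule.mul_le]
      intro x hx y hy
      exact Submodule.mem_iSup_of_mem _ (mul_mem_polGr hx hy)
    exact this (Submodule.mul_mem_mul (ha trivial) (hb trivial))

/-- The algebra map `R → R[v^{±1}]` sending a linear form `f` to `f v^2`. -/
def polComponents (V : Type u) [AddCommGroup V] [Module ℝ V] :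
    Pol V →ₐ[ℝ] AddMonoidAlgebra (Pol V) ℤ :=
  SymmetricAlgebra.lift
    { toFun := fun f => AddMonoidAlgebra.single 2 (SymmetricAlgebra.ι ℝ (Module.Dual ℝ V) f)
      map_add' := fun f g => by simp [AddMonoidAlgebra.single_add]
      map_smul' := fun c f => by
        rw [map_smul]
        exact (AddMonoidAlgebra.smul_single _ _ _).symm }

theorem polComponents_of_mem {d : ℤ} {r : Pol V} (hr : r ∈ polGr V d) :
    polComponents V r = AddMonoidAlgebra.single d r := by
  suffices h : ∀ n : ℕ, ∀ r ∈ LinearMap.range (SymmetricAlgebra.ι ℝ (Module.Dual ℝ V)) ^ n,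
      polComponents V r = AddMonoidAlgebra.single (2 * (n : ℤ)) r by
    have key : polGr V d ≤ LinearMap.eqLocus (polComponents V).toLinearMap
        (AddMonoidAlgebra.lsingle d) := by
      refine iSup₂_le ?_
      rintro n rfl x hx
      exact h n x hx
    exact key hr
  intro n r hr
  induction hr using Submodule.pow_induction_on_left' with
  | algebraMap c =>
    rw [AlgHom.commutes]
    rfl
  | add x y i _ _ ihx ihy => rw [map_add, ihx, ihy, AddMonoidAlgebra.single_add]
  | mem_mul m hm i x _ ih =>
    obtain ⟨f, rfl⟩ := hm
    rw [map_mul, ih, polComponents, SymmetricAlgebra.lift_ι_apply]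
    simp only [LinearMap.coe_mk, AddHom.coe_mk, AddMonoidAlgebra.single_mul_single]
    congr 1
    push_cast
    ring

theorem polGr_isInternal : DirectSum.IsInternal (polGr V) :=
  isInternal_of_components (polGr V) iSup_polGr
    ((AddMonoidAlgebra.coeffLinearEquiv ℝ).toLinearMap ∘ₗ (polComponents V).toLinearMap)
    fun d r hr => by
      change (polComponents V r).coeff = _
      rw [polComponents_of_mem hr]
      rfl

end Polynomials

/-! ### Graded bimodules -/

section Bimodules

/-- A `ℤ`-graded `R`-bimodule, `R = S(V*)`: a real vector space with commuting left and right
actions of the commutative `ℝ`-algebra `R` (both extending the real scalars), and an internal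
grading `⨁_d gr d` compatible with both actions. -/
structure GrBimod (V : Type u) [AddCommGroup V] [Module ℝ V] where
  /-- The underlying real vector space. -/
  carrier : Type u
  [addCommGroup : AddCommGroup carrier]
  [module : Module ℝ carrier]
  /-- `left r m = r · m` -/
  left : Pol V →ₐ[ℝ] Module.End ℝ carrier
  /-- `right r m = m · r` -/
  right : Pol V →ₐ[ℝ] Module.End ℝ carrier
  left_right : ∀ r s m, left r (right s m) = right s (left r m)
  /-- The homogeneous component of degree `d`. -/
  gr : ℤ → Submodule ℝ carrier
  isInternal : DirectSum.IsInternal gr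
  left_mem : ∀ {i d : ℤ} {r : Pol V} {m : carrier}, r ∈ polGr V i → m ∈ gr d →
    left r m ∈ gr (i + d)
  right_mem : ∀ {i d : ℤ} {r : Pol V} {m : carrier}, r ∈ polGr V i → m ∈ gr d →
    right r m ∈ gr (i + d)

attribute [instance] GrBimod.addCommGroup GrBimod.module

namespace GrBimod

variable {V : Type u} [AddCommGroup V] [Module ℝ V]

/-- An isomorphism of graded bimodules (of degree `0`). -/
structure Iso (M N : GrBimod V) where
  /-- The underlying linear isomorphism. -/
  equiv : M.carrier ≃ₗ[ℝ] N.carrier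
  map_left : ∀ r m, equiv (M.left r m) = N.left r (equiv m)
  map_right : ∀ r m, equiv (M.right r m) = N.right r (equiv m)
  mem_gr_iff : ∀ d m, equiv m ∈ N.gr d ↔ m ∈ M.gr d

namespace Iso

variable {M N P : GrBimod V}

/-- The identity isomorphism. -/
def refl (M : GrBimod V) : Iso M M :=
  ⟨LinearEquiv.refl ℝ _, fun _ _ => rfl, fun _ _ => rfl, fun _ _ => Iff.rfl⟩

/-- The inverse isomorphism. -/
def symm (e : Iso M N) : Iso N M where
  equiv := e.equiv.symm
  map_left r m := e.equiv.injective (by simp [e.map_left])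
  map_right r m := e.equiv.injective (by simp [e.map_right])
  mem_gr_iff d m := by simp [← e.mem_gr_iff]

/-- Composition of isomorphisms. -/
def trans (e : Iso M N) (f : Iso N P) : Iso M P where
  equiv := e.equiv.trans f.equiv
  map_left r m := by simp [e.map_left, f.map_left]
  map_right r m := by simp [e.map_right, f.map_right]
  mem_gr_iff d m := by simp [e.mem_gr_iff, f.mem_gr_iff]

/-- An isomorphism from two mutually inverse maps that respect degrees. -/
def ofMaps (f : M.carrier →ₗ[ℝ] N.carrier) (g : N.carrier →ₗ[ℝ] M.carrier)
    (hfg : ∀ n, f (g n) = n) (hgf : ∀ m, g (f m) = m)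
    (hl : ∀ r m, f (M.left r m) = N.left r (f m))
    (hr : ∀ r m, f (M.right r m) = N.right r (f m))
    (hf : ∀ d, M.gr d ≤ (N.gr d).comap f) (hg : ∀ d, N.gr d ≤ (M.gr d).comap g) : Iso M N where
  equiv := LinearEquiv.ofLinearMap f g (LinearMap.ext hfg) (LinearMap.ext hgf)
  map_left := hl
  map_right := hr
  mem_gr_iff d m := ⟨fun h => by
    have := hg d h
    simpa [hgf] using this, fun h => hf d h⟩

end Iso

/-- `M` and `N` are isomorphic as graded bimodules. -/
def IsIso (M N : GrBimod V) : Prop := Nonempty (Iso M N)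

/-- The grading shift `M(n)`, with `M(n)_d = M_{d+n}`. -/
abbrev shift (M : GrBimod V) (n : ℤ) : GrBimod V where
  carrier := M.carrier
  left := M.left
  right := M.right
  left_right := M.left_right
  gr d := M.gr (d + n)
  isInternal := by
    refine isInternal_of_components _ ?_
      (Finsupp.lmapDomain M.carrier ℝ (fun d => d - n) ∘ₗ components M.gr M.isInternal) ?_
    · rw [eq_top_iff, ← isInternal_iSup_eq_top M.isInternal]
      refine iSup_le fun d => ?_
      have : M.gr d = M.gr (d - n + n) := by rw [sub_add_cancel]
      rw [this]
      exact le_iSup (fun d => M.gr (d + n)) (d - n)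
    · intro d m hm
      simp [components_of_mem _ _ hm]
  left_mem hr hm := by
    rw [add_assoc]
    exact M.left_mem hr hm
  right_mem hr hm := by
    rw [add_assoc]
    exact M.right_mem hr hm

/-- The direct sum of two graded bimodules. -/
abbrev sum (M N : GrBimod V) : GrBimod V where
  carrier := M.carrier × N.carrier
  left :=
    { toFun := fun r => (M.left r).prodMap (N.left r)
      map_one' := by ext <;> simp
      map_mul' := fun r s => by ext <;> simp
      map_zero' := by ext <;> simp
      map_add' := fun r s => by ext <;> simp
      commutes' := fun c => by ext <;> simp }
  right :=
    { toFun := fun r => (M.right r).prodMap (N.right r)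
      map_one' := by ext <;> simp
      map_mul' := fun r s => by ext <;> simp
      map_zero' := by ext <;> simp
      map_add' := fun r s => by ext <;> simp
      commutes' := fun c => by ext <;> simp }
  left_right r s m := Prod.ext (M.left_right r s m.1) (N.left_right r s m.2)
  gr d := (M.gr d).prod (N.gr d)
  isInternal := by
    refine isInternal_of_components _ ?_
      (Finsupp.mapRange.linearMap (LinearMap.inl ℝ M.carrier N.carrier) ∘ₗ
          components M.gr M.isInternal ∘ₗ LinearMap.fst ℝ _ _ +
        Finsupp.mapRange.linearMap (LinearMap.inr ℝ M.carrier N.carrier) ∘ₗ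
          components N.gr N.isInternal ∘ₗ LinearMap.snd ℝ _ _) ?_
    · have h1 : ∀ m : M.carrier, (m, (0 : N.carrier)) ∈ ⨆ d, (M.gr d).prod (N.gr d) := by
        intro m
        have hm : m ∈ ⨆ d, M.gr d := isInternal_iSup_eq_top M.isInternal ▸ Submodule.mem_top
        have : ⨆ d, M.gr d ≤ (⨆ d, (M.gr d).prod (N.gr d)).comap
            (LinearMap.inl ℝ M.carrier N.carrier) :=
          iSup_le fun d x hx => Submodule.mem_iSup_of_mem d ⟨hx, Submodule.zero_mem _⟩
        exact this hm
      have h2 : ∀ n : N.carrier, ((0 : M.carrier), n) ∈ ⨆ d, (M.gr d).prod (N.gr d) := by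
        intro n
        have hn : n ∈ ⨆ d, N.gr d := isInternal_iSup_eq_top N.isInternal ▸ Submodule.mem_top
        have : ⨆ d, N.gr d ≤ (⨆ d, (M.gr d).prod (N.gr d)).comap
            (LinearMap.inr ℝ M.carrier N.carrier) :=
          iSup_le fun d x hx => Submodule.mem_iSup_of_mem d ⟨Submodule.zero_mem _, hx⟩
        exact this hn
      rw [eq_top_iff]
      rintro ⟨m, n⟩ -
      have := Submodule.add_mem _ (h1 m) (h2 n)
      simpa using this
    · rintro d ⟨m, n⟩ ⟨hm, hn⟩
      simp [components_of_mem _ _ hm, components_of_mem _ _ hn, ← Finsupp.single_add]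
  left_mem hr hm := ⟨M.left_mem hr hm.1, N.left_mem hr hm.2⟩
  right_mem hr hm := ⟨M.right_mem hr hm.1, N.right_mem hr hm.2⟩

/-- A graded bimodule is indecomposable if it is nonzero and is not isomorphic to a direct sum of
two nonzero graded bimodules. -/
def Indecomposable (M : GrBimod V) : Prop :=
  Nontrivial M.carrier ∧ ∀ N P : GrBimod V, IsIso M (N.sum P) →
    Subsingleton N.carrier ∨ Subsingleton P.carrier

/-- The bimodule `R_σ` for a graded algebra endomorphism `σ` of `R`: the graded left module `R`
with right operation `a · r = a σ(r)`. -/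
abbrev twist (σ : Pol V →ₐ[ℝ] Pol V) (hσ : ∀ d, ∀ r ∈ polGr V d, σ r ∈ polGr V d) : GrBimod V where
  carrier := Pol V
  left := Algebra.lmul ℝ (Pol V)
  right := (Algebra.lmul ℝ (Pol V)).comp σ
  left_right r s m := by
    simp only [AlgHom.comp_apply, Algebra.coe_lmul_eq_mul, LinearMap.mul_apply']
    ring
  gr := polGr V
  isInternal := polGr_isInternal
  left_mem hr hm := mul_mem_polGr hr hm
  right_mem hr hm := mul_mem_polGr (hσ _ _ hr) hm

/-- The regular bimodule `R`. -/
abbrev unit (V : Type u) [AddCommGroup V] [Module ℝ V] : GrBimod V :=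
  twist (AlgHom.id ℝ (Pol V)) fun _ _ h => h

/-! ### Tensor products -/

/-- A subalgebra of `R` is homogeneous if it contains the components of its elements. -/
def IsHomog (S : Subalgebra ℝ (Pol V)) : Prop :=
  ∀ s ∈ S, ∀ d, components (polGr V) polGr_isInternal s d ∈ S

/-- The relations `m s ⊗ n - m ⊗ s n`, `s ∈ S`, in `M ⊗_ℝ N`. -/
def tensorRel (S : Subalgebra ℝ (Pol V)) (M N : GrBimod V) :
    Submodule ℝ (M.carrier ⊗[ℝ] N.carrier) :=
  Submodule.span ℝ {x | ∃ s ∈ S, ∃ m n, x = M.right s m ⊗ₜ[ℝ] n - m ⊗ₜ[ℝ] N.left s n}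

/-- The vector space `M ⊗_S N`, as the quotient of `M ⊗_ℝ N` by the relations
`m s ⊗ n = m ⊗ s n`, `s ∈ S`. -/
abbrev TensorCarrier (S : Subalgebra ℝ (Pol V)) (M N : GrBimod V) : Type u :=
  (M.carrier ⊗[ℝ] N.carrier) ⧸ tensorRel S M N

instance (S : Subalgebra ℝ (Pol V)) (M N : GrBimod V) : AddCommGroup (TensorCarrier S M N) :=
  inferInstance

instance (S : Subalgebra ℝ (Pol V)) (M N : GrBimod V) : Module ℝ (TensorCarrier S M N) :=
  inferInstance

/-- The class of `m ⊗ n` in `M ⊗_S N`. -/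
def tmk (S : Subalgebra ℝ (Pol V)) (M N : GrBimod V) (m : M.carrier) (n : N.carrier) :
    TensorCarrier S M N :=
  Submodule.Quotient.mk (m ⊗ₜ[ℝ] n)

section Tensor

variable (S : Subalgebra ℝ (Pol V)) (M N : GrBimod V)

/-- `tmk` as a bilinear map. -/
def tmkₗ : M.carrier →ₗ[ℝ] N.carrier →ₗ[ℝ] TensorCarrier S M N :=
  (TensorProduct.mk ℝ M.carrier N.carrier).compr₂ (tensorRel S M N).mkQ

@[simp]
theorem tmkₗ_apply (m : M.carrier) (n : N.carrier) : tmkₗ S M N m n = tmk S M N m n := rfl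

variable {S M N}

theorem tmk_right {s : Pol V} (hs : s ∈ S) (m : M.carrier) (n : N.carrier) :
    tmk S M N (M.right s m) n = tmk S M N m (N.left s n) :=
  (Submodule.Quotient.eq _).2 (Submodule.subset_span ⟨s, hs, m, n, rfl⟩)

/-- Bilinear maps balanced over `S` factor through `M ⊗_S N`. -/
def tlift {X : Type*} [AddCommGroup X] [Module ℝ X] (b : M.carrier →ₗ[ℝ] N.carrier →ₗ[ℝ] X)
    (hb : ∀ s ∈ S, ∀ m n, b (M.right s m) n = b m (N.left s n)) : TensorCarrier S M N →ₗ[ℝ] X :=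
  (tensorRel S M N).liftQ (TensorProduct.lift b) (by
    rw [tensorRel, Submodule.span_le]
    rintro _ ⟨s, hs, m, n, rfl⟩
    simp [hb s hs m n])

@[simp]
theorem tlift_tmk {X : Type*} [AddCommGroup X] [Module ℝ X]
    (b : M.carrier →ₗ[ℝ] N.carrier →ₗ[ℝ] X)
    (hb : ∀ s ∈ S, ∀ m n, b (M.right s m) n = b m (N.left s n)) (m : M.carrier) (n : N.carrier) :
    tlift b hb (tmk S M N m n) = b m n := by
  simp [tlift, tmk]

theorem tensor_hom_ext {X : Type*} [AddCommGroup X] [Module ℝ X]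
    {f g : TensorCarrier S M N →ₗ[ℝ] X}
    (h : ∀ m n, f (tmk S M N m n) = g (tmk S M N m n)) : f = g := by
  refine Submodule.linearMap_qext _ (TensorProduct.ext' fun m n => ?_)
  exact h m n

/-- The map `f ⊗ g` on tensor products. -/
def tmap {M' N' : GrBimod V} (f : M.carrier →ₗ[ℝ] M'.carrier) (g : N.carrier →ₗ[ℝ] N'.carrier)
    (hf : ∀ s ∈ S, ∀ m, f (M.right s m) = M'.right s (f m))
    (hg : ∀ s ∈ S, ∀ n, g (N.left s n) = N'.left s (g n)) :
    TensorCarrier S M N →ₗ[ℝ] TensorCarrier S M' N' :=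
  tlift ((tmkₗ S M' N').compl₁₂ f g) (by
    intro s hs m n
    simp [hf s hs, hg s hs, tmk_right hs])

@[simp]
theorem tmap_tmk {M' N' : GrBimod V} (f : M.carrier →ₗ[ℝ] M'.carrier)
    (g : N.carrier →ₗ[ℝ] N'.carrier) (hf : ∀ s ∈ S, ∀ m, f (M.right s m) = M'.right s (f m))
    (hg : ∀ s ∈ S, ∀ n, g (N.left s n) = N'.left s (g n)) (m : M.carrier) (n : N.carrier) :
    tmap f g hf hg (tmk S M N m n) = tmk S M' N' (f m) (g n) := by
  simp [tmap]

theorem tmk_add_left (m m' : M.carrier) (n : N.carrier) :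
    tmk S M N (m + m') n = tmk S M N m n + tmk S M N m' n := by
  simp [← tmkₗ_apply]

theorem tmk_add_right (m : M.carrier) (n n' : N.carrier) :
    tmk S M N m (n + n') = tmk S M N m n + tmk S M N m n' := by
  simp [← tmkₗ_apply]

theorem tmk_smul_left (c : ℝ) (m : M.carrier) (n : N.carrier) :
    tmk S M N (c • m) n = c • tmk S M N m n := by
  simp [← tmkₗ_apply]

theorem tmk_smul_right (c : ℝ) (m : M.carrier) (n : N.carrier) :
    tmk S M N m (c • n) = c • tmk S M N m n := by
  simp [← tmkₗ_apply]

theorem tmk_zero_left (n : N.carrier) : tmk S M N 0 n = 0 := by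
  simp [← tmkₗ_apply]

theorem tmk_zero_right (m : M.carrier) : tmk S M N m 0 = 0 := by
  simp [← tmkₗ_apply]

variable (S M N)

/-- The left action `r · (m ⊗ n) = r m ⊗ n`. -/
def tensorLeft : Pol V →ₐ[ℝ] Module.End ℝ (TensorCarrier S M N) where
  toFun r := tmap (M.left r) LinearMap.id (fun s _ m => M.left_right r s m) fun _ _ _ => rfl
  map_one' := tensor_hom_ext (by simp)
  map_mul' r s := tensor_hom_ext (by simp)
  map_zero' := tensor_hom_ext (by simp [tmk_zero_left])
  map_add' r s := tensor_hom_ext (by simp [tmk_add_left])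
  commutes' c := tensor_hom_ext (by simp [tmk_smul_left])

/-- The right action `(m ⊗ n) · r = m ⊗ n r`. -/
def tensorRight : Pol V →ₐ[ℝ] Module.End ℝ (TensorCarrier S M N) where
  toFun r := tmap LinearMap.id (N.right r) (fun _ _ _ => rfl) fun s _ n => (N.left_right s r n).symm
  map_one' := tensor_hom_ext (by simp)
  map_mul' r s := tensor_hom_ext (by simp)
  map_zero' := tensor_hom_ext (by simp [tmk_zero_right])
  map_add' r s := tensor_hom_ext (by simp [tmk_add_right])
  commutes' c := tensor_hom_ext (by simp [tmk_smul_right])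

@[simp]
theorem tensorLeft_tmk (r : Pol V) (m : M.carrier) (n : N.carrier) :
    tensorLeft S M N r (tmk S M N m n) = tmk S M N (M.left r m) n :=
  rfl

@[simp]
theorem tensorRight_tmk (r : Pol V) (m : M.carrier) (n : N.carrier) :
    tensorRight S M N r (tmk S M N m n) = tmk S M N m (N.right r n) :=
  rfl

/-- The degree `d` component of `M ⊗_S N`, spanned by the `m ⊗ n` with `m` and `n` homogeneous of
degrees adding up to `d`. -/
def tensorGr (d : ℤ) : Submodule ℝ (TensorCarrier S M N) :=
  Submodule.span ℝ {x | ∃ i j m n, i + j = d ∧ m ∈ M.gr i ∧ n ∈ N.gr j ∧ x = tmk S M N m n}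

variable {S M N}

theorem tmk_mem_tensorGr {i j d : ℤ} (h : i + j = d) {m : M.carrier} {n : N.carrier}
    (hm : m ∈ M.gr i) (hn : n ∈ N.gr j) : tmk S M N m n ∈ tensorGr S M N d :=
  Submodule.subset_span ⟨i, j, m, n, h, hm, hn, rfl⟩

/-- To bound `tensorGr` it is enough to look at pure tensors. -/
theorem tensorGr_le {d : ℤ} {K : Submodule ℝ (TensorCarrier S M N)}
    (h : ∀ i j m n, i + j = d → m ∈ M.gr i → n ∈ N.gr j → tmk S M N m n ∈ K) :
    tensorGr S M N d ≤ K := by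
  rw [tensorGr, Submodule.span_le]
  rintro _ ⟨i, j, m, n, hij, hm, hn, rfl⟩
  exact h i j m n hij hm hn

/-- Two linear maps out of `M` agreeing on homogeneous elements are equal. -/
theorem hom_ext_gr {X : Type*} [AddCommGroup X] [Module ℝ X] {f g : M.carrier →ₗ[ℝ] X}
    (h : ∀ d, ∀ m ∈ M.gr d, f m = g m) : f = g := by
  refine LinearMap.ext fun m => ?_
  have hm : m ∈ ⨆ d, M.gr d := isInternal_iSup_eq_top M.isInternal ▸ Submodule.mem_top
  have : ⨆ d, M.gr d ≤ LinearMap.eqLocus f g := iSup_le fun d x hx => h d x hx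
  exact this hm

variable (S M N)

/-- The bilinear map `(m, n) ↦ ∑ (m_i ⊗ n_j) v^{i+j}`. -/
def tensorComponentsAux : M.carrier →ₗ[ℝ] N.carrier →ₗ[ℝ] ℤ →₀ TensorCarrier S M N :=
  (Finsupp.lsum ℝ fun i : ℤ => (Finsupp.lsum ℝ fun j : ℤ =>
      ((tmkₗ S M N).compr₂ (Finsupp.lsingle (i + j))).flip).flip).compl₁₂
    (components M.gr M.isInternal) (components N.gr N.isInternal)

variable {S M N}

theorem tensorComponentsAux_of_mem {i j : ℤ} {m : M.carrier} {n : N.carrier} (hm : m ∈ M.gr i)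
    (hn : n ∈ N.gr j) :
    tensorComponentsAux S M N m n = Finsupp.single (i + j) (tmk S M N m n) := by
  simp [tensorComponentsAux, components_of_mem _ _ hm, components_of_mem _ _ hn]

theorem tensorComponentsAux_balanced_of_mem {k : ℤ} {s : Pol V} (hs : s ∈ S)
    (hk : s ∈ polGr V k) (m : M.carrier) (n : N.carrier) :
    tensorComponentsAux S M N (M.right s m) n = tensorComponentsAux S M N m (N.left s n) := by
  suffices h : (tensorComponentsAux S M N).compl₁₂ (M.right s) LinearMap.id =
      (tensorComponentsAux S M N).compl₁₂ LinearMap.id (N.left s) from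
    LinearMap.congr_fun (LinearMap.congr_fun h m) n
  refine hom_ext_gr fun i m hm => hom_ext_gr fun j n hn => ?_
  simp only [LinearMap.compl₁₂_apply, LinearMap.id_apply]
  rw [tensorComponentsAux_of_mem (M.right_mem hk hm) hn,
    tensorComponentsAux_of_mem hm (N.left_mem hk hn), tmk_right hs]
  congr 1
  ring

theorem tensorComponentsAux_balanced (hS : IsHomog S) (s : Pol V) (hs : s ∈ S) (m : M.carrier)
    (n : N.carrier) :
    tensorComponentsAux S M N (M.right s m) n = tensorComponentsAux S M N m (N.left s n) := by
  rw [← components_sum (polGr V) polGr_isInternal s, Finsupp.sum]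
  simp only [map_sum, LinearMap.sum_apply]
  refine Finset.sum_congr rfl fun d _ => ?_
  exact tensorComponentsAux_balanced_of_mem (hS s hs d) (components_mem _ _ s d) m n

theorem tmk_mem_iSup (m : M.carrier) (n : N.carrier) :
    tmk S M N m n ∈ ⨆ d, tensorGr S M N d := by
  rw [← components_sum M.gr M.isInternal m, ← components_sum N.gr N.isInternal n, ← tmkₗ_apply,
    Finsupp.sum, Finsupp.sum]
  simp only [map_sum, LinearMap.sum_apply]
  refine Submodule.sum_mem _ fun i _ => Submodule.sum_mem _ fun j _ => ?_
  exact Submodule.mem_iSup_of_mem _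
    (tmk_mem_tensorGr rfl (components_mem _ _ m _) (components_mem _ _ n _))

theorem tensor_span (x : TensorCarrier S M N) {K : Submodule ℝ (TensorCarrier S M N)}
    (h : ∀ m n, tmk S M N m n ∈ K) : x ∈ K := by
  have : K.mkQ = 0 := tensor_hom_ext fun m n => by simpa using h m n
  simpa using LinearMap.congr_fun this x

theorem tensorGr_isInternal (hS : IsHomog S) : DirectSum.IsInternal (tensorGr S M N) := by
  refine isInternal_of_components _ ?_
    (tlift (tensorComponentsAux S M N) (tensorComponentsAux_balanced hS)) ?_
  · exact eq_top_iff.2 fun x _ => tensor_span x tmk_mem_iSup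
  · intro d x hx
    have : tensorGr S M N d ≤ LinearMap.eqLocus
        (tlift (tensorComponentsAux S M N) (tensorComponentsAux_balanced hS))
        (Finsupp.lsingle d) := by
      refine tensorGr_le ?_
      rintro i j m n rfl hm hn
      simp [tensorComponentsAux_of_mem hm hn]
    exact this hx

end Tensor

/-- The graded bimodule `M ⊗_S N`, for a homogeneous subalgebra `S` of `R`. -/
abbrev tensorOver (S : Subalgebra ℝ (Pol V)) (hS : IsHomog S) (M N : GrBimod V) : GrBimod V where
  carrier := TensorCarrier S M N
  left := tensorLeft S M N
  right := tensorRight S M N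
  left_right r s x := by
    suffices h : tensorLeft S M N r ∘ₗ tensorRight S M N s =
        tensorRight S M N s ∘ₗ tensorLeft S M N r from LinearMap.congr_fun h x
    exact tensor_hom_ext (by simp)
  gr := tensorGr S M N
  isInternal := tensorGr_isInternal hS
  left_mem {k d r x} hr hx := by
    have : tensorGr S M N d ≤ (tensorGr S M N (k + d)).comap (tensorLeft S M N r) := by
      refine tensorGr_le fun i j m n hij hm hn => ?_
      rw [Submodule.mem_comap, tensorLeft_tmk]
      exact tmk_mem_tensorGr (by rw [add_assoc, hij]) (M.left_mem hr hm) hn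
    exact this hx
  right_mem {k d r x} hr hx := by
    have : tensorGr S M N d ≤ (tensorGr S M N (k + d)).comap (tensorRight S M N r) := by
      refine tensorGr_le fun i j m n hij hm hn => ?_
      rw [Submodule.mem_comap, tensorRight_tmk]
      exact tmk_mem_tensorGr (by rw [add_left_comm, hij]) hm (N.right_mem hr hn)
    exact this hx

/-- The tensor product `M ⊗_R N` of graded bimodules. -/
abbrev tensor (M N : GrBimod V) : GrBimod V :=
  tensorOver ⊤ (fun _ _ _ => trivial) M N

theorem tensor_ext_apply {S : Subalgebra ℝ (Pol V)} {M N : GrBimod V} {X : Type*} [AddCommGroup X]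
    [Module ℝ X] (f g : TensorCarrier S M N →ₗ[ℝ] X)
    (h : ∀ m n, f (tmk S M N m n) = g (tmk S M N m n)) (x : TensorCarrier S M N) : f x = g x :=
  LinearMap.congr_fun (tensor_hom_ext h) x

/-- An isomorphism out of a tensor product, checked on pure tensors. -/
def Iso.ofTensor {M N X : GrBimod V}
    (f : TensorCarrier ⊤ M N →ₗ[ℝ] X.carrier) (g : X.carrier →ₗ[ℝ] TensorCarrier ⊤ M N)
    (hfg : ∀ x, f (g x) = x) (hgf : ∀ m n, g (f (tmk ⊤ M N m n)) = tmk ⊤ M N m n)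
    (hl : ∀ r m n, f (tmk ⊤ M N (M.left r m) n) = X.left r (f (tmk ⊤ M N m n)))
    (hr : ∀ r m n, f (tmk ⊤ M N m (N.right r n)) = X.right r (f (tmk ⊤ M N m n)))
    (hf : ∀ i j m n, m ∈ M.gr i → n ∈ N.gr j → f (tmk ⊤ M N m n) ∈ X.gr (i + j))
    (hg : ∀ d, X.gr d ≤ (tensorGr ⊤ M N d).comap g) : Iso (M.tensor N) X :=
  Iso.ofMaps (M := M.tensor N) f g hfg
    (tensor_ext_apply (g ∘ₗ f) LinearMap.id hgf)
    (fun r => tensor_ext_apply (f ∘ₗ tensorLeft ⊤ M N r) (X.left r ∘ₗ f) (fun m n => by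
      simpa using hl r m n))
    (fun r => tensor_ext_apply (f ∘ₗ tensorRight ⊤ M N r) (X.right r ∘ₗ f) (fun m n => by
      simpa using hr r m n))
    (fun d => tensorGr_le (by
      rintro i j m n rfl hm hn
      exact hf i j m n hm hn))
    hg

namespace IsIso

variable {M N P Q : GrBimod V}

theorem refl (M : GrBimod V) : IsIso M M := ⟨Iso.refl M⟩

theorem symm (h : IsIso M N) : IsIso N M := h.map Iso.symm

theorem trans (h : IsIso M N) (h' : IsIso N P) : IsIso M P :=
  h.elim fun e => h'.map e.trans

theorem tensor (h : IsIso M N) (h' : IsIso P Q) : IsIso (M.tensor P) (N.tensor Q) := by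
  obtain ⟨e⟩ := h
  obtain ⟨f⟩ := h'
  let F : TensorCarrier ⊤ M P →ₗ[ℝ] TensorCarrier ⊤ N Q :=
    tmap e.equiv.toLinearMap f.equiv.toLinearMap (fun s _ m => e.map_right s m)
      (fun s _ n => f.map_left s n)
  let G : TensorCarrier ⊤ N Q →ₗ[ℝ] TensorCarrier ⊤ M P :=
    tmap e.symm.equiv.toLinearMap f.symm.equiv.toLinearMap
      (fun s _ m => e.symm.map_right s m) (fun s _ n => f.symm.map_left s n)
  have hF : ∀ m n, F (tmk ⊤ M P m n) = tmk ⊤ N Q (e.equiv m) (f.equiv n) := fun _ _ => rfl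
  have hG : ∀ m n, G (tmk ⊤ N Q m n) = tmk ⊤ M P (e.equiv.symm m) (f.equiv.symm n) :=
    fun _ _ => rfl
  refine ⟨Iso.ofTensor (X := N.tensor Q) F G
    (tensor_ext_apply (F ∘ₗ G) LinearMap.id fun m n => by simp [hF, hG])
    (fun m n => by simp [hF, hG]) (fun r m n => ?_) (fun r m n => ?_)
    (fun i j m n hm hn => ?_) (fun d => tensorGr_le fun i j m n hij hm hn => ?_)⟩
  · rw [hF, hF, e.map_left]
    rfl
  · rw [hF, hF, f.map_right]
    rfl
  · rw [hF]
    exact tmk_mem_tensorGr rfl ((e.mem_gr_iff _ _).2 hm) ((f.mem_gr_iff _ _).2 hn)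
  · rw [Submodule.mem_comap, hG]
    exact tmk_mem_tensorGr hij ((e.symm.mem_gr_iff _ _).2 hm) ((f.symm.mem_gr_iff _ _).2 hn)

theorem shift (h : IsIso M N) (n : ℤ) : IsIso (M.shift n) (N.shift n) :=
  h.map fun e => ⟨e.equiv, e.map_left, e.map_right, fun d m => e.mem_gr_iff (d + n) m⟩

theorem sum (h : IsIso M N) (h' : IsIso P Q) : IsIso (M.sum P) (N.sum Q) := by
  obtain ⟨e⟩ := h
  obtain ⟨f⟩ := h'
  refine ⟨⟨e.equiv.prodCongr f.equiv, fun r m => ?_, fun r m => ?_, fun d m => ?_⟩⟩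
  · exact Prod.ext (e.map_left r m.1) (f.map_left r m.2)
  · exact Prod.ext (e.map_right r m.1) (f.map_right r m.2)
  · exact and_congr (e.mem_gr_iff d m.1) (f.mem_gr_iff d m.2)

theorem unit_tensor (M : GrBimod V) : IsIso ((GrBimod.unit V).tensor M) M := by
  let F : TensorCarrier ⊤ (GrBimod.unit V) M →ₗ[ℝ] M.carrier :=
    tlift M.left.toLinearMap fun s _ r m => by
      change M.left (s * r) m = M.left r (M.left s m)
      rw [mul_comm, map_mul]
      rfl
  have hF : ∀ (r : Pol V) m, F (tmk ⊤ (GrBimod.unit V) M r m) = M.left r m := fun _ _ => rfl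
  refine ⟨Iso.ofTensor F (tmkₗ ⊤ (GrBimod.unit V) M (1 : Pol V)) (fun m => ?_)
    (fun r m => ?_) (fun r s m => ?_) (fun r s m => ?_) (fun i j r m hr hm => ?_)
    (fun d m hm => ?_)⟩
  · rw [tmkₗ_apply, hF, map_one]
    rfl
  · rw [tmkₗ_apply, hF, ← tmk_right Algebra.mem_top]
    congr 1
    exact mul_one r
  · change M.left (r * s) m = M.left r (M.left s m)
    rw [map_mul]
    rfl
  · rw [hF, hF, M.left_right]
  · exact M.left_mem hr hm
  · exact tmk_mem_tensorGr (zero_add d) (one_mem_polGr (V := V)) hm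

theorem tensor_unit (M : GrBimod V) : IsIso (M.tensor (GrBimod.unit V)) M := by
  let F : TensorCarrier ⊤ M (GrBimod.unit V) →ₗ[ℝ] M.carrier :=
    tlift M.right.toLinearMap.flip fun s _ m r => by
      change M.right r (M.right s m) = M.right (s * r) m
      rw [mul_comm, map_mul]
      rfl
  have hF : ∀ m (r : Pol V), F (tmk ⊤ M (GrBimod.unit V) m r) = M.right r m := fun _ _ => rfl
  refine ⟨Iso.ofTensor F ((tmkₗ ⊤ M (GrBimod.unit V)).flip (1 : Pol V)) (fun m => ?_)
    (fun m r => ?_) (fun r m s => ?_) (fun r m s => ?_) (fun i j m r hm hr => ?_)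
    (fun d m hm => ?_)⟩
  · rw [LinearMap.flip_apply, tmkₗ_apply, hF, map_one]
    rfl
  · rw [LinearMap.flip_apply, tmkₗ_apply, hF, tmk_right Algebra.mem_top]
    congr 1
    exact mul_one r
  · rw [hF, hF, M.left_right]
  · change M.right (r * s) m = M.right r (M.right s m)
    rw [map_mul]
    rfl
  · rw [add_comm]
    exact M.right_mem hr hm
  · exact tmk_mem_tensorGr (add_zero d) hm (one_mem_polGr (V := V))

theorem shift_tensor (M N : GrBimod V) (n : ℤ) :
    IsIso ((M.shift n).tensor N) ((M.tensor N).shift n) := by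
  let F : TensorCarrier ⊤ (M.shift n) N →ₗ[ℝ] TensorCarrier ⊤ M N :=
    tlift (M := M.shift n) (tmkₗ ⊤ M N) fun s hs m k => tmk_right hs m k
  let G : TensorCarrier ⊤ M N →ₗ[ℝ] TensorCarrier ⊤ (M.shift n) N :=
    tlift (tmkₗ ⊤ (M.shift n) N) fun s hs m k => tmk_right (M := M.shift n) hs m k
  refine ⟨Iso.ofTensor (X := (M.tensor N).shift n) F G
    (tensor_ext_apply (F ∘ₗ G) LinearMap.id fun _ _ => rfl)
    (fun _ _ => rfl) (fun _ _ _ => rfl) (fun _ _ _ => rfl) (fun i j m k hm hk => ?_)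
    (fun d => tensorGr_le fun i j m k hij hm hk => ?_)⟩
  · exact tmk_mem_tensorGr (by ring) hm hk
  · refine tmk_mem_tensorGr (M := M.shift n) (i := i - n) (j := j) (by linarith) ?_ hk
    change m ∈ M.gr (i - n + n)
    rwa [sub_add_cancel]

theorem tensor_shift (M N : GrBimod V) (n : ℤ) :
    IsIso (M.tensor (N.shift n)) ((M.tensor N).shift n) := by
  let F : TensorCarrier ⊤ M (N.shift n) →ₗ[ℝ] TensorCarrier ⊤ M N :=
    tlift (N := N.shift n) (tmkₗ ⊤ M N) fun s hs m k => tmk_right hs m k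
  let G : TensorCarrier ⊤ M N →ₗ[ℝ] TensorCarrier ⊤ M (N.shift n) :=
    tlift (tmkₗ ⊤ M (N.shift n)) fun s hs m k => tmk_right (N := N.shift n) hs m k
  refine ⟨Iso.ofTensor (X := (M.tensor N).shift n) F G
    (tensor_ext_apply (F ∘ₗ G) LinearMap.id fun _ _ => rfl)
    (fun _ _ => rfl) (fun _ _ _ => rfl) (fun _ _ _ => rfl) (fun i j m k hm hk => ?_)
    (fun d => tensorGr_le fun i j m k hij hm hk => ?_)⟩
  · exact tmk_mem_tensorGr (by ring) hm hk
  · refine tmk_mem_tensorGr (N := N.shift n) (i := i) (j := j - n) (by linarith) hm ?_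
    change k ∈ N.gr (j - n + n)
    rwa [sub_add_cancel]

theorem shift_shift (M : GrBimod V) (a b : ℤ) : IsIso ((M.shift a).shift b) (M.shift (a + b)) := by
  refine ⟨⟨LinearEquiv.refl ℝ M.carrier, fun _ _ => rfl, fun _ _ => rfl, fun d x => ?_⟩⟩
  change x ∈ M.gr (d + (a + b)) ↔ x ∈ M.gr (d + b + a)
  rw [add_comm a b, add_assoc]

theorem shift_zero (M : GrBimod V) : IsIso (M.shift 0) M := by
  refine ⟨⟨LinearEquiv.refl ℝ M.carrier, fun _ _ => rfl, fun _ _ => rfl, fun d x => ?_⟩⟩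
  change x ∈ M.gr d ↔ x ∈ M.gr (d + 0)
  rw [add_zero]

theorem tensor_assoc (M N P : GrBimod V) :
    IsIso ((M.tensor N).tensor P) (M.tensor (N.tensor P)) := by
  let b : M.carrier →ₗ[ℝ] N.carrier →ₗ[ℝ] P.carrier →ₗ[ℝ] TensorCarrier ⊤ M (N.tensor P) :=
    { toFun := fun m => (tmkₗ ⊤ N P).compr₂ (tmkₗ ⊤ M (N.tensor P) m)
      map_add' := fun m m' => by
        ext n p
        exact tmk_add_left (N := N.tensor P) m m' (tmk ⊤ N P n p)
      map_smul' := fun c m => by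
        ext n p
        exact tmk_smul_left (N := N.tensor P) c m (tmk ⊤ N P n p) }
  have hb : ∀ m n p, b m n p = tmk ⊤ M (N.tensor P) m (tmk ⊤ N P n p) := fun _ _ _ => rfl
  let F₁ : TensorCarrier ⊤ M N →ₗ[ℝ] P.carrier →ₗ[ℝ] TensorCarrier ⊤ M (N.tensor P) :=
    tlift b fun s hs m n => by
      ext p
      rw [hb, hb, tmk_right hs]
      rfl
  let F : TensorCarrier ⊤ (M.tensor N) P →ₗ[ℝ] TensorCarrier ⊤ M (N.tensor P) :=
    tlift F₁ fun s hs x p => by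
      refine tensor_ext_apply (F₁.flip p ∘ₗ tensorRight ⊤ M N s) (F₁.flip (P.left s p))
        (fun m n => ?_) x
      change tmk ⊤ M (N.tensor P) m (tmk ⊤ N P (N.right s n) p) =
        tmk ⊤ M (N.tensor P) m (tmk ⊤ N P n (P.left s p))
      rw [tmk_right hs]
  let c : M.carrier → TensorCarrier ⊤ N P →ₗ[ℝ] TensorCarrier ⊤ (M.tensor N) P := fun m =>
    tlift (tmkₗ ⊤ (M.tensor N) P ∘ₗ tmkₗ ⊤ M N m) fun s hs n p => by
      change tmk ⊤ (M.tensor N) P (tmk ⊤ M N m (N.right s n)) p =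
        tmk ⊤ (M.tensor N) P (tmk ⊤ M N m n) (P.left s p)
      exact tmk_right (M := M.tensor N) hs (tmk ⊤ M N m n) p
  have hc : ∀ m n p, c m (tmk ⊤ N P n p) = tmk ⊤ (M.tensor N) P (tmk ⊤ M N m n) p :=
    fun _ _ _ => rfl
  let C : M.carrier →ₗ[ℝ] TensorCarrier ⊤ N P →ₗ[ℝ] TensorCarrier ⊤ (M.tensor N) P :=
    { toFun := c
      map_add' := fun m m' => tensor_hom_ext fun n p => by
        rw [LinearMap.add_apply, hc, hc, hc, tmk_add_left]
        exact tmk_add_left (M := M.tensor N) _ _ p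
      map_smul' := fun a m => tensor_hom_ext fun n p => by
        rw [LinearMap.smul_apply, hc, hc, tmk_smul_left]
        exact tmk_smul_left (M := M.tensor N) a _ p }
  let G : TensorCarrier ⊤ M (N.tensor P) →ₗ[ℝ] TensorCarrier ⊤ (M.tensor N) P :=
    tlift (N := N.tensor P) C fun s hs m x => by
      refine tensor_ext_apply (C (M.right s m)) (C m ∘ₗ tensorLeft ⊤ N P s) (fun n p => ?_) x
      change tmk ⊤ (M.tensor N) P (tmk ⊤ M N (M.right s m) n) p =
        tmk ⊤ (M.tensor N) P (tmk ⊤ M N m (N.left s n)) p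
      rw [tmk_right hs]
  have hF : ∀ m n p, F (tmk ⊤ (M.tensor N) P (tmk ⊤ M N m n) p) =
      tmk ⊤ M (N.tensor P) m (tmk ⊤ N P n p) := fun _ _ _ => rfl
  have hG : ∀ m n p, G (tmk ⊤ M (N.tensor P) m (tmk ⊤ N P n p)) =
      tmk ⊤ (M.tensor N) P (tmk ⊤ M N m n) p := fun _ _ _ => rfl
  let T : P.carrier → TensorCarrier ⊤ M N →ₗ[ℝ] TensorCarrier ⊤ (M.tensor N) P := fun p =>
    (tmkₗ ⊤ (M.tensor N) P).flip p
  let U : M.carrier → TensorCarrier ⊤ N P →ₗ[ℝ] TensorCarrier ⊤ M (N.tensor P) := fun m =>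
    tmkₗ ⊤ M (N.tensor P) m
  refine ⟨Iso.ofTensor (M := M.tensor N) (N := P) (X := M.tensor (N.tensor P)) F G
    (tensor_ext_apply (F ∘ₗ G) LinearMap.id fun m x => ?_)
    (fun x p => ?_) (fun r x p => ?_) (fun r x p => ?_) (fun i j x p hx hp => ?_)
    (fun d => tensorGr_le fun i j m x hij hm hx => ?_)⟩
  · exact tensor_ext_apply (F ∘ₗ G ∘ₗ U m) (U m) (fun n p => rfl) x
  · exact tensor_ext_apply (G ∘ₗ F ∘ₗ T p) (T p) (fun n p => rfl) x
  · exact tensor_ext_apply (F ∘ₗ T p ∘ₗ tensorLeft ⊤ M N r)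
      (tensorLeft ⊤ M (N.tensor P) r ∘ₗ F ∘ₗ T p) (fun m n => rfl) x
  · exact tensor_ext_apply (F ∘ₗ T (P.right r p))
      (tensorRight ⊤ M (N.tensor P) r ∘ₗ F ∘ₗ T p) (fun m n => rfl) x
  · have : tensorGr ⊤ M N i ≤ (tensorGr ⊤ M (N.tensor P) (i + j)).comap (F ∘ₗ T p) := by
      refine tensorGr_le ?_
      rintro a b m n rfl hm hn
      exact tmk_mem_tensorGr (N := N.tensor P) (add_assoc a b j).symm hm
        (tmk_mem_tensorGr rfl hn hp)
    exact this hx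
  · have : tensorGr ⊤ N P j ≤ (tensorGr ⊤ (M.tensor N) P d).comap (G ∘ₗ U m) := by
      refine tensorGr_le ?_
      rintro a b n p rfl hn hp
      exact tmk_mem_tensorGr (M := M.tensor N) (by rw [add_assoc, hij])
        (tmk_mem_tensorGr rfl hm hn) hp
    exact this hx

theorem sum_tensor (M N P : GrBimod V) :
    IsIso ((M.sum N).tensor P) ((M.tensor P).sum (N.tensor P)) := by
  let F : TensorCarrier ⊤ (M.sum N) P →ₗ[ℝ] TensorCarrier ⊤ M P × TensorCarrier ⊤ N P :=
    (tmap (M := M.sum N) (LinearMap.fst ℝ _ _) LinearMap.id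
      (fun _ _ _ => rfl) fun _ _ _ => rfl).prod
    (tmap (M := M.sum N) (LinearMap.snd ℝ _ _) LinearMap.id (fun _ _ _ => rfl) fun _ _ _ => rfl)
  let G₁ : TensorCarrier ⊤ M P →ₗ[ℝ] TensorCarrier ⊤ (M.sum N) P :=
    tmap (M' := M.sum N) (LinearMap.inl ℝ M.carrier N.carrier) LinearMap.id
      (fun s _ m => Prod.ext rfl (map_zero (N.right s)).symm) fun _ _ _ => rfl
  let G₂ : TensorCarrier ⊤ N P →ₗ[ℝ] TensorCarrier ⊤ (M.sum N) P :=
    tmap (M' := M.sum N) (LinearMap.inr ℝ M.carrier N.carrier) LinearMap.id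
      (fun s _ m => Prod.ext (map_zero (M.right s)).symm rfl) fun _ _ _ => rfl
  have hF : ∀ (x : M.carrier × N.carrier) p, F (tmk ⊤ (M.sum N) P x p) =
      (tmk ⊤ M P x.1 p, tmk ⊤ N P x.2 p) := fun _ _ => rfl
  have hG₁ : ∀ m p, G₁ (tmk ⊤ M P m p) =
      tmk ⊤ (M.sum N) P ((m, 0) : M.carrier × N.carrier) p := fun _ _ => rfl
  have hG₂ : ∀ n p, G₂ (tmk ⊤ N P n p) =
      tmk ⊤ (M.sum N) P ((0, n) : M.carrier × N.carrier) p := fun _ _ => rfl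
  refine ⟨Iso.ofTensor (M := M.sum N) (X := (M.tensor P).sum (N.tensor P)) F (G₁.coprod G₂)
    (fun x => ?_) (fun x p => ?_) (fun r x p => rfl) (fun r x p => rfl)
    (fun i j x p hx hp => ?_) (fun d x hx => ?_)⟩
  · have h₁ := tensor_ext_apply (F ∘ₗ G₁) (LinearMap.inl ℝ _ _) (fun m p => by
      rw [LinearMap.comp_apply, hG₁, hF]
      simp [tmk_zero_left]) x.1
    have h₂ := tensor_ext_apply (F ∘ₗ G₂) (LinearMap.inr ℝ _ _) (fun m p => by
      rw [LinearMap.comp_apply, hG₂, hF]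
      simp [tmk_zero_left]) x.2
    rw [LinearMap.comp_apply] at h₁ h₂
    rw [LinearMap.coprod_apply, map_add, h₁, h₂]
    exact Prod.ext (add_zero _) (zero_add _)
  · rw [hF, LinearMap.coprod_apply, hG₁, hG₂, ← tmk_add_left]
    congr 1
    exact Prod.ext (add_zero _) (zero_add _)
  · exact ⟨tmk_mem_tensorGr rfl hx.1 hp, tmk_mem_tensorGr rfl hx.2 hp⟩
  · rw [Submodule.mem_comap, LinearMap.coprod_apply]
    have h₁ : tensorGr ⊤ M P d ≤ (tensorGr ⊤ (M.sum N) P d).comap G₁ :=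
      tensorGr_le fun i j m p hij hm hp =>
        tmk_mem_tensorGr (M := M.sum N) hij ⟨hm, Submodule.zero_mem _⟩ hp
    have h₂ : tensorGr ⊤ N P d ≤ (tensorGr ⊤ (M.sum N) P d).comap G₂ :=
      tensorGr_le fun i j m p hij hm hp =>
        tmk_mem_tensorGr (M := M.sum N) hij ⟨Submodule.zero_mem _, hm⟩ hp
    exact Submodule.add_mem _ (h₁ hx.1) (h₂ hx.2)

theorem tensor_sum (P M N : GrBimod V) :
    IsIso (P.tensor (M.sum N)) ((P.tensor M).sum (P.tensor N)) := by
  let F : TensorCarrier ⊤ P (M.sum N) →ₗ[ℝ] TensorCarrier ⊤ P M × TensorCarrier ⊤ P N :=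
    (tmap (N := M.sum N) LinearMap.id (LinearMap.fst ℝ _ _)
      (fun _ _ _ => rfl) fun _ _ _ => rfl).prod
    (tmap (N := M.sum N) LinearMap.id (LinearMap.snd ℝ _ _) (fun _ _ _ => rfl) fun _ _ _ => rfl)
  let G₁ : TensorCarrier ⊤ P M →ₗ[ℝ] TensorCarrier ⊤ P (M.sum N) :=
    tmap (N' := M.sum N) LinearMap.id (LinearMap.inl ℝ M.carrier N.carrier)
      (fun _ _ _ => rfl) fun s _ m => Prod.ext rfl (map_zero (N.left s)).symm
  let G₂ : TensorCarrier ⊤ P N →ₗ[ℝ] TensorCarrier ⊤ P (M.sum N) :=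
    tmap (N' := M.sum N) LinearMap.id (LinearMap.inr ℝ M.carrier N.carrier)
      (fun _ _ _ => rfl) fun s _ m => Prod.ext (map_zero (M.left s)).symm rfl
  have hF : ∀ p (x : M.carrier × N.carrier), F (tmk ⊤ P (M.sum N) p x) =
      (tmk ⊤ P M p x.1, tmk ⊤ P N p x.2) := fun _ _ => rfl
  have hG₁ : ∀ p m, G₁ (tmk ⊤ P M p m) =
      tmk ⊤ P (M.sum N) p ((m, 0) : M.carrier × N.carrier) := fun _ _ => rfl
  have hG₂ : ∀ p n, G₂ (tmk ⊤ P N p n) =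
      tmk ⊤ P (M.sum N) p ((0, n) : M.carrier × N.carrier) := fun _ _ => rfl
  refine ⟨Iso.ofTensor (N := M.sum N) (X := (P.tensor M).sum (P.tensor N)) F (G₁.coprod G₂)
    (fun x => ?_) (fun p x => ?_) (fun r x p => rfl) (fun r x p => rfl)
    (fun i j p x hp hx => ?_) (fun d x hx => ?_)⟩
  · have h₁ := tensor_ext_apply (F ∘ₗ G₁) (LinearMap.inl ℝ _ _) (fun p m => by
      rw [LinearMap.comp_apply, hG₁, hF]
      simp [tmk_zero_right]) x.1
    have h₂ := tensor_ext_apply (F ∘ₗ G₂) (LinearMap.inr ℝ _ _) (fun p m => by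
      rw [LinearMap.comp_apply, hG₂, hF]
      simp [tmk_zero_right]) x.2
    rw [LinearMap.comp_apply] at h₁ h₂
    rw [LinearMap.coprod_apply, map_add, h₁, h₂]
    exact Prod.ext (add_zero _) (zero_add _)
  · rw [hF, LinearMap.coprod_apply, hG₁, hG₂, ← tmk_add_right]
    congr 1
    exact Prod.ext (add_zero _) (zero_add _)
  · exact ⟨tmk_mem_tensorGr rfl hp hx.1, tmk_mem_tensorGr rfl hp hx.2⟩
  · rw [Submodule.mem_comap, LinearMap.coprod_apply]
    have h₁ : tensorGr ⊤ P M d ≤ (tensorGr ⊤ P (M.sum N) d).comap G₁ :=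
      tensorGr_le fun i j p m hij hp hm =>
        tmk_mem_tensorGr (N := M.sum N) hij hp ⟨hm, Submodule.zero_mem _⟩
    have h₂ : tensorGr ⊤ P N d ≤ (tensorGr ⊤ P (M.sum N) d).comap G₂ :=
      tensorGr_le fun i j p m hij hp hm =>
        tmk_mem_tensorGr (N := M.sum N) hij hp ⟨Submodule.zero_mem _, hm⟩
    exact Submodule.add_mem _ (h₁ hx.1) (h₂ hx.2)

end IsIso

/-! ### Generated categories and their split Grothendieck rings -/

/-- The objects of the full subcategory of graded bimodules generated by `G`: the smallest class of
graded bimodules containing `G` and the unit `R` that is closed under tensor products over `R`,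
grading shifts, finite direct sums, direct summands and isomorphism; in other words, the direct
summands of finite direct sums of shifts of tensor products of elements of `G`. -/
inductive Generated (G : Set (GrBimod V)) : GrBimod V → Prop
  | of (M : GrBimod V) : M ∈ G → Generated G M
  | unit : Generated G (unit V)
  | tensor (M N : GrBimod V) : Generated G M → Generated G N → Generated G (M.tensor N)
  | shift (M : GrBimod V) (n : ℤ) : Generated G M → Generated G (M.shift n)
  | sum (M N : GrBimod V) : Generated G M → Generated G N → Generated G (M.sum N)
  | summand (M N P : GrBimod V) : Generated G M → IsIso M (N.sum P) → Generated G N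
  | iso (M N : GrBimod V) : Generated G M → IsIso M N → Generated G N

variable (G : Set (GrBimod V))

/-- Isomorphism of graded bimodules as an equivalence relation on the generated category. -/
def isoSetoid : Setoid {M : GrBimod V // Generated G M} where
  r M N := IsIso M.1 N.1
  iseqv := ⟨fun M => IsIso.refl M.1, IsIso.symm, IsIso.trans⟩

/-- The isomorphism classes of objects of the category generated by `G`. -/
def IsoClass : Type (u + 1) := Quotient (isoSetoid G)

variable {G}

/-- The isomorphism class of an object. -/
def isoClass (M : GrBimod V) (hM : Generated G M) : IsoClass G :=
  Quotient.mk (isoSetoid G) ⟨M, hM⟩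

theorem isoClass_eq_iff {M N : GrBimod V} {hM : Generated G M} {hN : Generated G N} :
    isoClass M hM = isoClass N hN ↔ IsIso M N :=
  Quotient.eq (r := isoSetoid G)

theorem IsoClass.ind {p : IsoClass G → Prop} (h : ∀ M hM, p (isoClass M hM)) (x : IsoClass G) :
    p x :=
  Quotient.ind (fun M => h M.1 M.2) x

/-- Isomorphism classes form a monoid under the tensor product. -/
instance : Monoid (IsoClass G) where
  mul := Quotient.map₂ (fun M N => ⟨M.1.tensor N.1, .tensor _ _ M.2 N.2⟩)
    fun _ _ h _ _ h' => IsIso.tensor h h'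
  one := isoClass (unit V) .unit
  mul_assoc x y z := by
    induction x using IsoClass.ind with | h M hM
    induction y using IsoClass.ind with | h N hN
    induction z using IsoClass.ind with | h P hP
    exact isoClass_eq_iff.2 (IsIso.tensor_assoc M N P)
  one_mul x := by
    induction x using IsoClass.ind with | h M hM
    exact isoClass_eq_iff.2 (IsIso.unit_tensor M)
  mul_one x := by
    induction x using IsoClass.ind with | h M hM
    exact isoClass_eq_iff.2 (IsIso.tensor_unit M)

theorem isoClass_mul {M N : GrBimod V} (hM : Generated G M) (hN : Generated G N) :
    isoClass M hM * isoClass N hN = isoClass (M.tensor N) (.tensor _ _ hM hN) := rfl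

theorem isoClass_one : (1 : IsoClass G) = isoClass (unit V) .unit := rfl

variable (G)

/-- The subgroup of the free abelian group on the isomorphism classes that is generated by the
elements `[M ⊕ N] - [M] - [N]`. -/
def splitRel : AddSubgroup (FreeAbelianGroup (IsoClass G)) :=
  AddSubgroup.closure {x | ∃ M N, ∃ (hM : Generated G M) (hN : Generated G N),
    x = FreeAbelianGroup.of (isoClass (M.sum N) (.sum _ _ hM hN)) -
      FreeAbelianGroup.of (isoClass M hM) - FreeAbelianGroup.of (isoClass N hN)}

theorem splitRel_mul_mem_left (x y : FreeAbelianGroup (IsoClass G)) (hy : y ∈ splitRel G) :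
    x * y ∈ splitRel G := by
  induction x using FreeAbelianGroup.induction_on with
  | zero => simp [zero_mem]
  | neg a ha => rw [neg_mul]; exact neg_mem ha
  | add a b ha hb => rw [add_mul]; exact add_mem ha hb
  | of a =>
    induction a using IsoClass.ind with | h P hP
    induction hy using AddSubgroup.closure_induction with
    | zero => simp [zero_mem]
    | neg a _ ha => rw [mul_neg]; exact neg_mem ha
    | add a b _ _ ha hb => rw [mul_add]; exact add_mem ha hb
    | mem z hz =>
      obtain ⟨M, N, hM, hN, rfl⟩ := hz
      refine AddSubgroup.subset_closure
        ⟨P.tensor M, P.tensor N, .tensor _ _ hP hM, .tensor _ _ hP hN, ?_⟩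
      rw [mul_sub, mul_sub, ← FreeAbelianGroup.of_mul, ← FreeAbelianGroup.of_mul,
        ← FreeAbelianGroup.of_mul, isoClass_mul, isoClass_mul, isoClass_mul,
        isoClass_eq_iff.2 (IsIso.tensor_sum P M N)]

theorem splitRel_mul_mem_right (x y : FreeAbelianGroup (IsoClass G)) (hx : x ∈ splitRel G) :
    x * y ∈ splitRel G := by
  induction y using FreeAbelianGroup.induction_on with
  | zero => simp [zero_mem]
  | neg a ha => rw [mul_neg]; exact neg_mem ha
  | add a b ha hb => rw [mul_add]; exact add_mem ha hb
  | of a =>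
    induction a using IsoClass.ind with | h P hP
    induction hx using AddSubgroup.closure_induction with
    | zero => simp [zero_mem]
    | neg a _ ha => rw [neg_mul]; exact neg_mem ha
    | add a b _ _ ha hb => rw [add_mul]; exact add_mem ha hb
    | mem z hz =>
      obtain ⟨M, N, hM, hN, rfl⟩ := hz
      refine AddSubgroup.subset_closure
        ⟨M.tensor P, N.tensor P, .tensor _ _ hM hP, .tensor _ _ hN hP, ?_⟩
      rw [sub_mul, sub_mul, ← FreeAbelianGroup.of_mul, ← FreeAbelianGroup.of_mul,
        ← FreeAbelianGroup.of_mul, isoClass_mul, isoClass_mul, isoClass_mul,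
        isoClass_eq_iff.2 (IsIso.sum_tensor M N P)]

/-- `splitRel` is a two-sided ideal for the product induced by the tensor product. -/
def splitIdeal : TwoSidedIdeal (FreeAbelianGroup (IsoClass G)) :=
  TwoSidedIdeal.mk' (splitRel G) (zero_mem _) add_mem neg_mem
    (fun {x y} h => splitRel_mul_mem_left G x y h) fun {x y} h => splitRel_mul_mem_right G x y h

/-- The split Grothendieck ring of the category generated by `G`: the free abelian group on the
isomorphism classes of objects modulo the relations `[M ⊕ N] = [M] + [N]`, with product
`[M] [N] = [M ⊗_R N]`. -/
def SplitGrothendieckRing : Type (u + 1) := (splitIdeal G).ringCon.Quotient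

instance : Ring (SplitGrothendieckRing G) :=
  inferInstanceAs (Ring (splitIdeal G).ringCon.Quotient)

variable {G}

/-- The class `⟨M⟩` of an object in the split Grothendieck ring. -/
def cls (M : GrBimod V) (hM : Generated G M) : SplitGrothendieckRing G :=
  (splitIdeal G).ringCon.mk' (FreeAbelianGroup.of (isoClass M hM))

theorem cls_eq_of_iso {M N : GrBimod V} (hM : Generated G M) (hN : Generated G N)
    (h : IsIso M N) : cls M hM = cls N hN := by
  rw [cls, cls, isoClass_eq_iff.2 h]

theorem cls_mul {M N : GrBimod V} (hM : Generated G M) (hN : Generated G N) :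
    cls M hM * cls N hN = cls (M.tensor N) (.tensor _ _ hM hN) := by
  rw [cls, cls, cls, ← isoClass_mul, FreeAbelianGroup.of_mul]
  exact (map_mul (splitIdeal G).ringCon.mk' _ _).symm

theorem cls_unit : cls (unit V) .unit = (1 : SplitGrothendieckRing G) :=
  map_one (splitIdeal G).ringCon.mk'

theorem cls_sum {M N : GrBimod V} (hM : Generated G M) (hN : Generated G N) :
    cls (M.sum N) (.sum _ _ hM hN) = cls M hM + cls N hN := by
  have h : (splitIdeal G).ringCon
      (FreeAbelianGroup.of (isoClass (M.sum N) (.sum _ _ hM hN)))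
      (FreeAbelianGroup.of (isoClass M hM) + FreeAbelianGroup.of (isoClass N hN)) := by
    rw [TwoSidedIdeal.rel_iff, splitIdeal, TwoSidedIdeal.mem_mk']
    exact AddSubgroup.subset_closure ⟨M, N, hM, hN, by abel⟩
  exact ((splitIdeal G).ringCon.eq.2 h).trans (map_add (splitIdeal G).ringCon.mk' _ _)

variable (G)

/-- The homomorphism `n ↦ ⟨R(n)⟩`. -/
def shiftHom : Multiplicative ℤ →* SplitGrothendieckRing G where
  toFun n := cls ((unit V).shift n.toAdd) (.shift _ _ .unit)
  map_one' := (cls_eq_of_iso _ _ (IsIso.shift_zero _)).trans cls_unit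
  map_mul' a b := by
    rw [cls_mul]
    refine cls_eq_of_iso _ _ (IsIso.symm ?_)
    refine (IsIso.shift_tensor _ _ _).trans ((IsIso.shift (IsIso.unit_tensor _) _).trans ?_)
    refine (IsIso.shift_shift _ _ _).trans ?_
    rw [toAdd_mul, add_comm]
    exact IsIso.refl _

variable {G}

theorem shiftHom_mul_cls (n : ℤ) {M : GrBimod V} (hM : Generated G M) :
    shiftHom G (.ofAdd n) * cls M hM = cls (M.shift n) (.shift _ _ hM) := by
  change cls _ _ * cls _ _ = _
  rw [cls_mul]
  exact cls_eq_of_iso _ _ ((IsIso.shift_tensor _ _ _).trans (IsIso.shift (IsIso.unit_tensor _) _))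

theorem cls_mul_shiftHom (n : ℤ) {M : GrBimod V} (hM : Generated G M) :
    cls M hM * shiftHom G (.ofAdd n) = cls (M.shift n) (.shift _ _ hM) := by
  change cls _ _ * cls _ _ = _
  rw [cls_mul]
  exact cls_eq_of_iso _ _ ((IsIso.tensor_shift _ _ _).trans (IsIso.shift (IsIso.tensor_unit _) _))

theorem SplitGrothendieckRing.induction {p : SplitGrothendieckRing G → Prop}
    (zero : p 0) (of : ∀ M hM, p (cls M hM)) (neg : ∀ x, p x → p (-x))
    (add : ∀ x y, p x → p y → p (x + y)) (x : SplitGrothendieckRing G) : p x := by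
  obtain ⟨x, rfl⟩ := (splitIdeal G).ringCon.mk'_surjective x
  induction x using FreeAbelianGroup.induction_on with
  | zero => exact zero
  | of a =>
    induction a using IsoClass.ind with | h M hM
    exact of M hM
  | neg a ha => exact neg _ ha
  | add a b ha hb => exact add _ _ ha hb

variable (G)

/-- The structure map `ℤ[v^{±1}] → ⟨C⟩`, `v^n ↦ ⟨R(n)⟩`. -/
def laurentHom : ℤ[T;T⁻¹] →ₐ[ℤ] SplitGrothendieckRing G :=
  AddMonoidAlgebra.lift ℤ (SplitGrothendieckRing G) ℤ (shiftHom G)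

theorem laurentHom_commutes (f : ℤ[T;T⁻¹]) (x : SplitGrothendieckRing G) :
    laurentHom G f * x = x * laurentHom G f := by
  induction f using AddMonoidAlgebra.induction_linear with
  | zero => rw [map_zero, zero_mul, mul_zero]
  | add f g hf hg => rw [map_add, add_mul, mul_add, hf, hg]
  | single n a =>
    have h : shiftHom G (.ofAdd n) * x = x * shiftHom G (.ofAdd n) := by
      induction x using SplitGrothendieckRing.induction with
      | zero => rw [zero_mul, mul_zero]
      | of M hM => rw [shiftHom_mul_cls, cls_mul_shiftHom]
      | neg x hx => rw [mul_neg, neg_mul, hx]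
      | add x y hx hy => rw [mul_add, add_mul, hx, hy]
    rw [laurentHom, AddMonoidAlgebra.lift_single, smul_mul_assoc, mul_smul_comm, h]

/-- The split Grothendieck ring is a `ℤ[v^{±1}]`-algebra, where `v` acts by the shift `(1)`. -/
instance : Algebra ℤ[T;T⁻¹] (SplitGrothendieckRing G) :=
  (laurentHom G).toRingHom.toAlgebra' (laurentHom_commutes G)

variable {G}

theorem T_smul_cls (n : ℤ) {M : GrBimod V} (hM : Generated G M) :
    (LaurentPolynomial.T n : ℤ[T;T⁻¹]) • cls M hM = cls (M.shift n) (.shift _ _ hM) := by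
  rw [Algebra.smul_def]
  change laurentHom G (AddMonoidAlgebra.single n 1) * _ = _
  rw [laurentHom, AddMonoidAlgebra.lift_single, one_smul, shiftHom_mul_cls]

end GrBimod

end Bimodules

/-! ### Bimodules attached to a reflection faithful representation -/

section Reflections

open GrBimod

variable {B W : Type*} {A : CoxeterMatrix B} [Group W] (cs : CoxeterSystem A W)
variable {V : Type u} [AddCommGroup V] [Module ℝ V] (ρ : Representation ℝ W V)

/-- A finite-dimensional real representation of a Coxeter group is reflection faithful if it is
faithful and the elements fixing a subspace of codimension one are exactly the reflections. -/
structure IsReflectionFaithful : Prop where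
  finiteDimensional : FiniteDimensional ℝ V
  injective : Function.Injective ρ
  isReflection_iff : ∀ w, cs.IsReflection w ↔
    Module.finrank ℝ (V ⧸ LinearMap.eqLocus (ρ w) LinearMap.id) = 1

/-- The action of `w` on the polynomial functions, `(w f)(v) = f(w⁻¹ v)`. -/
def polAct (w : W) : Pol V →ₐ[ℝ] Pol V :=
  SymmetricAlgebra.lift (SymmetricAlgebra.ι ℝ (Module.Dual ℝ V) ∘ₗ ρ.dual w)

theorem polAct_mem (w : W) (d : ℤ) (r : Pol V) (hr : r ∈ polGr V d) :
    polAct ρ w r ∈ polGr V d := by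
  have : polGr V d ≤ (polGr V d).comap (polAct ρ w).toLinearMap := by
    refine iSup₂_le fun n hn r hr => ?_
    refine mem_polGr n hn ?_
    have h := Submodule.mem_map_of_mem (f := (polAct ρ w).toLinearMap) hr
    rw [Submodule.map_pow] at h
    have hle : (LinearMap.range (SymmetricAlgebra.ι ℝ (Module.Dual ℝ V))).map
        (polAct ρ w).toLinearMap ≤ LinearMap.range (SymmetricAlgebra.ι ℝ (Module.Dual ℝ V)) := by
      rintro _ ⟨_, ⟨f, rfl⟩, rfl⟩
      exact ⟨ρ.dual w f, by simp [polAct]⟩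
    exact pow_le_pow_left' hle n h
  exact this hr

/-- The subring `R^t` of `t`-invariants. -/
def invariants (t : W) : Subalgebra ℝ (Pol V) := AlgHom.equalizer (polAct ρ t) (AlgHom.id ℝ _)

theorem invariants_isHomog (t : W) : IsHomog (invariants ρ t) := by
  have h : ∀ r d, components (polGr V) polGr_isInternal (polAct ρ t r) d =
      polAct ρ t (components (polGr V) polGr_isInternal r d) := by
    intro r d
    suffices h : Finsupp.lapply d ∘ₗ components (polGr V) polGr_isInternal ∘ₗ
        (polAct ρ t).toLinearMap =
        (polAct ρ t).toLinearMap ∘ₗ Finsupp.lapply d ∘ₗ components (polGr V) polGr_isInternal from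
      LinearMap.congr_fun h r
    refine hom_ext_gr (M := unit V) fun e m hm => ?_
    simp only [LinearMap.comp_apply, AlgHom.toLinearMap_apply]
    rw [components_of_mem _ _ hm, components_of_mem _ _ (polAct_mem ρ t e m hm)]
    by_cases hed : e = d
    · subst hed; simp
    · simp [Finsupp.single_eq_of_ne (Ne.symm hed)]
  intro s hs d
  have hs' : polAct ρ t s = s := hs
  change polAct ρ t _ = _
  rw [← h, hs']
  rfl

/-- The twisted bimodule `R_w`: the left module `R` with right operation `a · r = a w(r)`. -/
def twisted (w : W) : GrBimod V := twist (polAct ρ w) (polAct_mem ρ w)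

/-- The bimodule `B_t = R ⊗_{R^t} R(1)`. -/
def reflBimod (t : W) : GrBimod V :=
  (tensorOver (invariants ρ t) (invariants_isHomog ρ t) (unit V) (unit V)).shift 1

/-- The generators `B_t`, for `t` a reflection, of the category `C`. -/
def gensC : Set (GrBimod V) := {M | ∃ t, cs.IsReflection t ∧ M = reflBimod ρ t}

/-- The generators `B_t`, for `t` a reflection, and `R_w`, for `w` in `W`, of the category
`C^ext`. -/
def gensCext : Set (GrBimod V) := gensC cs ρ ∪ Set.range (twisted ρ)

/-- `M` is an object of the category `C`. -/
def InC (M : GrBimod V) : Prop := Generated (gensC cs ρ) M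

/-- `M` is an object of the category `C^ext`. -/
def InCext (M : GrBimod V) : Prop := Generated (gensCext cs ρ) M

/-- The split Grothendieck ring `⟨C^ext⟩`, a `ℤ[v^{±1}]`-algebra. -/
abbrev GrothendieckCext : Type (u + 1) := SplitGrothendieckRing (gensCext cs ρ)

end Reflections

end SoergelExt

end

noncomputable section

namespace SoergelExt

universe u

open GrBimod

/-! ### Morphisms of graded bimodules -/

section Morphisms

variable {V : Type u} [AddCommGroup V] [Module ℝ V]

/-! For a finite subset S of W let Q_S (`graphs ρ S`) be R ⊗ R modulo the elements vanishing on the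
graphs of all w ∈ S. Thus Q_{w} is R_w, and Q_{1} is R. For nonempty S the class of 1 spans the
component of Q_S of lowest degree and generates Q_S. Three facts follow from this alone.
Endomorphisms of degree 0 are scalars (`isBrick_graphs`). Q_S(n) is indecomposable
(`indecomposable_graphs`). Finally Q_S(n) determines n, by its lowest degree, and S, by the
annihilator of its generator (`eq_of_isIso_graphs`). Bimodules with scalar endomorphisms have the
exchange property (`IsBrick.exchange`), so direct sums of shifts of the Q_S have unique
decompositions and are closed under direct summands.

Identify W with the symmetric group on three letters, with T the odd permutations. Call S balanced
if it is nonempty with as many even as odd elements. There are 6 singletons and 9 + 9 + 1 balanced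
sets, 25 shapes in all. Sums of shifts of these Q_S are stable under right multiplication by the
generators. Indeed Q_S ⊗ R_w is Q_{Sw} (`graphs_tensor_twisted`), and Q_S ⊗ B_x is one of: Q_S(1) ⊕
Q_S(-1), if Sx = S; Q_{S ∪ Sx}(1), if S is a singleton or a pair {a, b} of opposite signs with b ≠
ax; Q_{S ∪ Sx}(1) ⊕ Q_{c, cx}(-1), if S = {c, cx, a, b} with a, b as above. The last two cases need
linear relations between the values of the roots on S. They come from three linear forms permuted by
W whose pairwise differences are the roots (`exists_isStandard`); reflection faithfulness is used to
find them.

A product with some B_x involves balanced sets only, so objects of C are sums of shifts of R and of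
balanced Q_S. Conversely every balanced Q_S occurs in C (`generated_graphs_of_isBalanced`). The
indecomposables that C^ext adds are therefore exactly the shifts of the R_w with w ≠ 1. Graded
multiplicities are well defined by uniqueness of decompositions, and they make the 25 classes a
basis of the split Grothendieck ring. -/

theorem commute_left_right (M : GrBimod V) (r s : Pol V) : Commute (M.left r) (M.right s) :=
  LinearMap.ext (M.left_right r s)

/-- The action of `R ⊗ R` on a graded bimodule, `(a ⊗ b) m = a m b`. -/
def act (M : GrBimod V) : Pol V ⊗[ℝ] Pol V →ₐ[ℝ] Module.End ℝ M.carrier :=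
  Algebra.TensorProduct.lift M.left M.right (commute_left_right M)

@[simp]
theorem act_tmul (M : GrBimod V) (a b : Pol V) (m : M.carrier) :
    act M (a ⊗ₜ b) m = M.left a (M.right b m) := by
  rw [act, Algebra.TensorProduct.lift_tmul]
  rfl

/-- A linear map is a morphism of graded bimodules if it commutes with both actions and preserves
degrees. -/
structure IsHom (M N : GrBimod V) (f : M.carrier →ₗ[ℝ] N.carrier) : Prop where
  left : ∀ r m, f (M.left r m) = N.left r (f m)
  right : ∀ r m, f (M.right r m) = N.right r (f m)
  gr : ∀ d, ∀ m ∈ M.gr d, f m ∈ N.gr d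

namespace IsHom

variable {M N P : GrBimod V} {f : M.carrier →ₗ[ℝ] N.carrier} {g : N.carrier →ₗ[ℝ] P.carrier}

theorem comp (hg : IsHom N P g) (hf : IsHom M N f) : IsHom M P (g ∘ₗ f) where
  left r m := by simp [hf.left, hg.left]
  right r m := by simp [hf.right, hg.right]
  gr d m hm := hg.gr d _ (hf.gr d m hm)

theorem map_act (hf : IsHom M N f) (θ : Pol V ⊗[ℝ] Pol V) (m : M.carrier) :
    f (act M θ m) = act N θ (f m) := by
  induction θ with
  | zero => simp
  | tmul a b => simp [hf.left, hf.right]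
  | add x y hx hy => simp [hx, hy]

theorem components_map (hf : IsHom M N f) (m : M.carrier) (d : ℤ) :
    components N.gr N.isInternal (f m) d = f (components M.gr M.isInternal m d) := by
  suffices h : Finsupp.lapply d ∘ₗ components N.gr N.isInternal ∘ₗ f =
      f ∘ₗ Finsupp.lapply d ∘ₗ components M.gr M.isInternal from LinearMap.congr_fun h m
  refine hom_ext_gr (M := M) fun e m hm => ?_
  simp only [LinearMap.comp_apply, Finsupp.lapply_apply]
  rw [components_of_mem _ _ hm, components_of_mem _ _ (hf.gr e m hm)]
  by_cases hed : e = d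
  · subst hed; simp
  · simp [Finsupp.single_eq_of_ne (Ne.symm hed)]

/-- Degrees are reflected automatically: if f m is homogeneous of degree d, then f m is also the
image of the degree d component of m, and injectivity identifies the two. -/
theorem isIso (hf : IsHom M N f) (hb : Function.Bijective f) : IsIso M N := by
  refine ⟨⟨LinearEquiv.ofBijective f hb, hf.left, hf.right, fun d m => ⟨fun h => ?_, hf.gr d m⟩⟩⟩
  have h1 : f m ∈ N.gr d := h
  have h2 : f m = f (components M.gr M.isInternal m d) := by
    rw [← hf.components_map, components_of_mem _ _ h1, Finsupp.single_eq_same]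
  rw [hb.1 h2]
  exact components_mem _ _ _ _

theorem inl (M N : GrBimod V) : IsHom M (M.sum N) (LinearMap.inl ℝ M.carrier N.carrier) where
  left r _ := Prod.ext rfl (map_zero (N.left r)).symm
  right r _ := Prod.ext rfl (map_zero (N.right r)).symm
  gr _ _ hm := ⟨hm, Submodule.zero_mem _⟩

theorem inr (M N : GrBimod V) : IsHom N (M.sum N) (LinearMap.inr ℝ M.carrier N.carrier) where
  left r _ := Prod.ext (map_zero (M.left r)).symm rfl
  right r _ := Prod.ext (map_zero (M.right r)).symm rfl
  gr _ _ hm := ⟨Submodule.zero_mem _, hm⟩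

theorem fst (M N : GrBimod V) : IsHom (M.sum N) M (LinearMap.fst ℝ M.carrier N.carrier) where
  left _ _ := rfl
  right _ _ := rfl
  gr _ _ hm := hm.1

theorem snd (M N : GrBimod V) : IsHom (M.sum N) N (LinearMap.snd ℝ M.carrier N.carrier) where
  left _ _ := rfl
  right _ _ := rfl
  gr _ _ hm := hm.2

theorem coprod {h : P.carrier →ₗ[ℝ] N.carrier} (hf : IsHom M N f) (hh : IsHom P N h) :
    IsHom (M.sum P) N (f.coprod h) where
  left r m := by simp [hf.left, hh.left]
  right r m := by simp [hf.right, hh.right]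
  gr d m hm := Submodule.add_mem _ (hf.gr d _ hm.1) (hh.gr d _ hm.2)

theorem of_iso (e : Iso M N) : IsHom M N e.equiv.toLinearMap where
  left := e.map_left
  right := e.map_right
  gr d m hm := (e.mem_gr_iff d m).2 hm

end IsHom

/-- The kernel of a morphism of graded bimodules. -/
abbrev kernel {M N : GrBimod V} {f : M.carrier →ₗ[ℝ] N.carrier} (hf : IsHom M N f) :
    GrBimod V where
  carrier := LinearMap.ker f
  left :=
    { toFun := fun r => (M.left r).restrict fun m hm => by
        rw [LinearMap.mem_ker] at hm ⊢
        rw [hf.left, hm, map_zero]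
      map_one' := by ext; simp
      map_mul' := fun r s => by ext; simp
      map_zero' := by ext; simp
      map_add' := fun r s => by ext; simp
      commutes' := fun c => by ext; simp }
  right :=
    { toFun := fun r => (M.right r).restrict fun m hm => by
        rw [LinearMap.mem_ker] at hm ⊢
        rw [hf.right, hm, map_zero]
      map_one' := by ext; simp
      map_mul' := fun r s => by ext; simp
      map_zero' := by ext; simp
      map_add' := fun r s => by ext; simp
      commutes' := fun c => by ext; simp }
  left_right r s m := Subtype.ext (M.left_right r s m)
  gr d := (M.gr d).comap (LinearMap.ker f).subtype
  isInternal := by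
    -- Components are formed in M; a linear retraction onto the kernel turns them into elements of
    -- the kernel.
    obtain ⟨π, hπ⟩ := (LinearMap.ker f).subtype.exists_leftInverse_of_injective
      (Submodule.ker_subtype _)
    refine isInternal_of_components _ ?_ (Finsupp.mapRange.linearMap π ∘ₗ
      components M.gr M.isInternal ∘ₗ (LinearMap.ker f).subtype) ?_
    · rw [eq_top_iff]
      rintro ⟨m, hm⟩ -
      have h1 : ∀ d, f (components M.gr M.isInternal m d) = 0 := fun d => by
        rw [← hf.components_map, LinearMap.mem_ker.1 hm, map_zero, Finsupp.zero_apply]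
      have h2 : (⟨m, hm⟩ : LinearMap.ker f) = ∑ d ∈ (components M.gr M.isInternal m).support,
          ⟨components M.gr M.isInternal m d, h1 d⟩ := by
        ext
        rw [AddSubmonoidClass.coe_finsetSum]
        exact (components_sum M.gr M.isInternal m).symm
      rw [h2]
      exact Submodule.sum_mem _ fun d _ => Submodule.mem_iSup_of_mem d (components_mem _ _ m d)
    · rintro d ⟨m, hm⟩ hmd
      have hmd' : m ∈ M.gr d := hmd
      simp only [LinearMap.comp_apply, Submodule.subtype_apply]
      rw [components_of_mem _ _ hmd']
      simp only [Finsupp.mapRange.linearMap_apply, Finsupp.mapRange_single]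
      congr 1
      exact LinearMap.congr_fun hπ ⟨m, hm⟩
  left_mem hr hm := M.left_mem hr hm
  right_mem hr hm := M.right_mem hr hm

theorem IsHom.kernel_subtype {M N : GrBimod V} {f : M.carrier →ₗ[ℝ] N.carrier}
    (hf : IsHom M N f) : IsHom (kernel hf) M (LinearMap.ker f).subtype where
  left _ _ := rfl
  right _ _ := rfl
  gr _ _ hm := hm

/-- The quotient of a graded bimodule by a graded sub-bimodule. -/
abbrev quotient (M : GrBimod V) (K : Submodule ℝ M.carrier) (hl : ∀ r, K ≤ K.comap (M.left r))
    (hr : ∀ r, K ≤ K.comap (M.right r))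
    (hK : ∀ m ∈ K, ∀ d, components M.gr M.isInternal m d ∈ K) : GrBimod V where
  carrier := M.carrier ⧸ K
  left :=
    { toFun := fun r => K.mapQ K (M.left r) (hl r)
      map_one' := by ext; simp
      map_mul' := fun r s => by ext; simp
      map_zero' := by ext; simp
      map_add' := fun r s => by ext; simp
      commutes' := fun c => by ext; simp }
  right :=
    { toFun := fun r => K.mapQ K (M.right r) (hr r)
      map_one' := by ext; simp
      map_mul' := fun r s => by ext; simp
      map_zero' := by ext; simp
      map_add' := fun r s => by ext; simp
      commutes' := fun c => by ext; simp }
  left_right r s m := by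
    obtain ⟨m, rfl⟩ := K.mkQ_surjective m
    exact congrArg K.mkQ (M.left_right r s m)
  gr d := (M.gr d).map K.mkQ
  isInternal := by
    refine isInternal_of_components _ ?_ (K.liftQ (Finsupp.mapRange.linearMap K.mkQ ∘ₗ
      components M.gr M.isInternal) fun m hm => ?_) ?_
    · rw [← Submodule.map_iSup, isInternal_iSup_eq_top M.isInternal, Submodule.map_top,
        Submodule.range_mkQ]
    · rw [LinearMap.mem_ker]
      ext d
      simpa using hK m hm d
    · rintro d _ ⟨m, hm, rfl⟩
      simp [components_of_mem _ _ hm]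
  left_mem := by
    rintro i d r _ hr ⟨m, hm, rfl⟩
    exact ⟨_, M.left_mem hr hm, rfl⟩
  right_mem := by
    rintro i d r _ hr ⟨m, hm, rfl⟩
    exact ⟨_, M.right_mem hr hm, rfl⟩

theorem IsHom.quotient_mkQ {M : GrBimod V} {K : Submodule ℝ M.carrier}
    (hl : ∀ r, K ≤ K.comap (M.left r)) (hr : ∀ r, K ≤ K.comap (M.right r))
    (hK : ∀ m ∈ K, ∀ d, components M.gr M.isInternal m d ∈ K) :
    IsHom M (quotient M K hl hr hK) K.mkQ where
  left _ _ := rfl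
  right _ _ := rfl
  gr _ m hm := ⟨m, hm, rfl⟩

/-- The zero bimodule. -/
abbrev zeroBimod (V : Type u) [AddCommGroup V] [Module ℝ V] : GrBimod V where
  carrier := PUnit.{u + 1}
  left :=
    { toFun := fun _ => 0
      map_one' := by ext
      map_mul' := fun _ _ => by ext
      map_zero' := rfl
      map_add' := fun _ _ => by ext
      commutes' := fun _ => by ext }
  right :=
    { toFun := fun _ => 0
      map_one' := by ext
      map_mul' := fun _ _ => by ext
      map_zero' := rfl
      map_add' := fun _ _ => by ext
      commutes' := fun _ => by ext }
  left_right _ _ _ := rfl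
  gr _ := ⊤
  isInternal := isInternal_of_components _ (Subsingleton.elim _ _) 0 fun _ _ _ => by ext
  left_mem _ _ := trivial
  right_mem _ _ := trivial

end Morphisms

/-! ### The Krull–Schmidt property -/

section KrullSchmidt

variable {V : Type u} [AddCommGroup V] [Module ℝ V]

namespace GrBimod.IsIso

variable {M N P : GrBimod V}

theorem sum_comm (M N : GrBimod V) : IsIso (M.sum N) (N.sum M) :=
  ⟨⟨LinearEquiv.prodComm ℝ M.carrier N.carrier, fun _ _ => rfl, fun _ _ => rfl,
    fun _ _ => And.comm⟩⟩

theorem sum_assoc (M N P : GrBimod V) : IsIso ((M.sum N).sum P) (M.sum (N.sum P)) :=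
  ⟨⟨LinearEquiv.prodAssoc ℝ M.carrier N.carrier P.carrier, fun _ _ => rfl, fun _ _ => rfl,
    fun _ _ => (and_assoc (a := _ ∈ M.gr _) (b := _ ∈ N.gr _) (c := _ ∈ P.gr _)).symm⟩⟩

theorem sum_of_subsingleton (M N : GrBimod V) [Subsingleton N.carrier] : IsIso (M.sum N) M :=
  (IsHom.fst M N).isIso ⟨fun _ _ h => Prod.ext h (Subsingleton.elim _ _), fun m => ⟨(m, 0), rfl⟩⟩

theorem of_subsingleton (M N : GrBimod V) [Subsingleton M.carrier] [Subsingleton N.carrier] :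
    IsIso M N :=
  (show IsHom M N 0 from ⟨fun _ _ => Subsingleton.elim _ _, fun _ _ => Subsingleton.elim _ _,
    fun _ _ _ => Submodule.zero_mem _⟩).isIso
    ⟨fun _ _ _ => Subsingleton.elim _ _, fun _ => ⟨0, Subsingleton.elim _ _⟩⟩

theorem subsingleton (h : IsIso M N) [Subsingleton N.carrier] : Subsingleton M.carrier :=
  h.elim fun e => e.equiv.toEquiv.subsingleton

theorem indecomposable (h : IsIso M N) (hN : N.Indecomposable) : M.Indecomposable := by
  refine ⟨?_, fun P Q hPQ => hN.2 P Q (h.symm.trans hPQ)⟩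
  have := hN.1
  exact h.elim fun e => e.equiv.toEquiv.nontrivial

theorem shift_sum (M N : GrBimod V) (n : ℤ) :
    IsIso ((M.sum N).shift n) ((M.shift n).sum (N.shift n)) :=
  ⟨⟨LinearEquiv.refl ℝ _, fun _ _ => rfl, fun _ _ => rfl, fun _ _ => Iff.rfl⟩⟩

end GrBimod.IsIso

/-- A graded bimodule whose only endomorphisms are the scalars. -/
def IsBrick (Q : GrBimod V) : Prop :=
  ∀ f : Q.carrier →ₗ[ℝ] Q.carrier, IsHom Q Q f → ∃ c : ℝ, f = c • LinearMap.id

/-- The composite Q → M → Q is an invertible scalar, so Q splits off M with complement ker p. Inside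
M ⊕ N the sum of ker p and N is the kernel of (m, n) ↦ p m, which is a complement of the image of Q;
X is another complement, hence isomorphic to it by projection along Q. -/
theorem exchange_of_ne_zero {Q X M N : GrBimod V} (e : Iso (Q.sum X) (M.sum N)) {c : ℝ}
    (hc : c ≠ 0) (h : ∀ q, (e.symm.equiv ((e.equiv (q, 0)).1, 0)).1 = c • q) :
    ∃ M' : GrBimod V, IsIso M (Q.sum M') ∧ IsIso X (M'.sum N) := by
  let i : Q.carrier →ₗ[ℝ] M.carrier :=
    LinearMap.fst ℝ _ _ ∘ₗ e.equiv.toLinearMap ∘ₗ LinearMap.inl ℝ Q.carrier X.carrier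
  let p : M.carrier →ₗ[ℝ] Q.carrier :=
    LinearMap.fst ℝ _ _ ∘ₗ e.symm.equiv.toLinearMap ∘ₗ LinearMap.inl ℝ M.carrier N.carrier
  have hi : IsHom Q M i := (IsHom.fst M N).comp ((IsHom.of_iso e).comp (IsHom.inl Q X))
  have hp : IsHom M Q p := (IsHom.fst Q X).comp ((IsHom.of_iso e.symm).comp (IsHom.inl M N))
  have hpi : ∀ q, p (i q) = c • q := h
  refine ⟨kernel hp, IsIso.symm ((hi.coprod hp.kernel_subtype).isIso ⟨?_, fun m => ?_⟩),
    IsIso.symm (((IsHom.snd Q X).comp ((IsHom.of_iso e.symm).comp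
      (((IsHom.inl M N).comp hp.kernel_subtype).coprod (IsHom.inr M N)))).isIso ⟨?_, fun x => ?_⟩)⟩
  · rw [injective_iff_map_eq_zero]
    rintro ⟨q, k, hk⟩ hqk
    have h1 : i q + k = 0 := hqk
    have h2 : c • q = 0 := by
      have := congrArg p h1
      rwa [map_add, hpi, LinearMap.mem_ker.1 hk, add_zero, map_zero] at this
    have h3 : q = 0 := (smul_eq_zero.1 h2).resolve_left hc
    subst h3
    rw [map_zero, zero_add] at h1
    subst h1
    rfl
  · refine ⟨(c⁻¹ • p m, ⟨m - i (c⁻¹ • p m), ?_⟩), ?_⟩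
    · rw [LinearMap.mem_ker, map_sub, hpi, smul_smul, mul_inv_cancel₀ hc, one_smul, sub_self]
    · exact add_sub_cancel _ _
  · rw [injective_iff_map_eq_zero]
    rintro ⟨⟨k, hk⟩, n⟩ hkn
    have h0 : (e.symm.equiv ((k, 0) + (0, n))).2 = 0 := hkn
    obtain ⟨q, hq⟩ : ∃ q, e.symm.equiv (k, n) = (q, 0) := by
      refine ⟨_, Prod.ext rfl ?_⟩
      rw [← h0, Prod.mk_add_mk, add_zero, zero_add]
    have h1 : e.equiv (q, 0) = (k, n) := by
      rw [← hq]
      exact e.equiv.apply_symm_apply _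
    have h2 : i q = k := congrArg Prod.fst h1
    have h3 : c • q = 0 := by rw [← hpi, h2]; exact hk
    have h4 : q = 0 := (smul_eq_zero.1 h3).resolve_left hc
    subst h4
    have h5 : ((k, n) : M.carrier × N.carrier) = 0 := by
      rw [← h1]
      exact map_zero e.equiv
    obtain ⟨rfl, rfl⟩ := Prod.mk.inj h5
    rfl
  · rcases hmn : e.equiv (0, x) with ⟨m, n⟩
    -- Adding the image of (q, 0) does not change the X-component, and this q brings the M-component
    -- into ker p.
    let q := -(c⁻¹ • p m)
    refine ⟨(⟨m + i q, ?_⟩, n + (e.equiv (q, 0)).2), ?_⟩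
    · rw [LinearMap.mem_ker, map_add, hpi, smul_neg, smul_smul, mul_inv_cancel₀ hc, one_smul,
        add_neg_cancel]
    · change (e.symm.equiv ((m + i q, 0) + (0, n + (e.equiv (q, 0)).2))).2 = x
      have h1 : ((m + i q, 0) + (0, n + (e.equiv (q, 0)).2) : M.carrier × N.carrier) =
          e.equiv (q, x) := by
        have h2 : ((q, x) : Q.carrier × X.carrier) = (0, x) + (q, 0) := by simp
        rw [h2, map_add, hmn, Prod.mk_add_mk, add_zero, zero_add]
        rfl
      rw [h1]
      exact congrArg Prod.snd (e.equiv.symm_apply_apply _)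

/-- The exchange property of bricks. -/
theorem IsBrick.exchange {Q X M N : GrBimod V} (hQ : IsBrick Q)
    (h : IsIso (Q.sum X) (M.sum N)) :
    (∃ M' : GrBimod V, IsIso M (Q.sum M') ∧ IsIso X (M'.sum N)) ∨
      ∃ N' : GrBimod V, IsIso N (Q.sum N') ∧ IsIso X (M.sum N') := by
  obtain ⟨e⟩ := h
  let f := LinearMap.fst ℝ _ _ ∘ₗ e.symm.equiv.toLinearMap ∘ₗ LinearMap.inl ℝ M.carrier N.carrier ∘ₗ
    LinearMap.fst ℝ _ _ ∘ₗ e.equiv.toLinearMap ∘ₗ LinearMap.inl ℝ Q.carrier X.carrier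
  have hf : IsHom Q Q f := (IsHom.fst Q X).comp ((IsHom.of_iso e.symm).comp ((IsHom.inl M N).comp
    ((IsHom.fst M N).comp ((IsHom.of_iso e).comp (IsHom.inl Q X)))))
  obtain ⟨c, hc⟩ := hQ f hf
  have hc' : ∀ q, (e.symm.equiv ((e.equiv (q, 0)).1, 0)).1 = c • q := LinearMap.congr_fun hc
  -- The endomorphisms of Q through M and through N add up to the identity. If the first is zero,
  -- the second is the identity and the roles of M and N are swapped.
  by_cases h0 : c = 0
  · right
    subst h0
    let s : Iso (M.sum N) (N.sum M) := ⟨LinearEquiv.prodComm ℝ M.carrier N.carrier,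
      fun _ _ => rfl, fun _ _ => rfl, fun _ _ => And.comm⟩
    have h1 : ∀ q, ((e.trans s).symm.equiv (((e.trans s).equiv (q, 0)).1, 0)).1 = (1 : ℝ) • q := by
      intro q
      change (e.symm.equiv (0, (e.equiv (q, 0)).2)).1 = _
      have h2 := congrArg Prod.fst (e.equiv.symm_apply_apply (q, 0))
      have h3 : e.equiv (q, 0) = ((e.equiv (q, 0)).1, 0) + (0, (e.equiv (q, 0)).2) := by simp
      rw [h3, map_add] at h2
      have h4 := hc' q
      rw [zero_smul] at h4
      rw [one_smul]
      refine Eq.trans ?_ h2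
      refine Eq.trans ?_ (congrArg (· + _) h4.symm)
      exact (zero_add _).symm
    obtain ⟨N', h1, h2⟩ := exchange_of_ne_zero (e.trans s) one_ne_zero h1
    exact ⟨N', h1, h2.trans (IsIso.sum_comm _ _)⟩
  · exact .inl (exchange_of_ne_zero e h0 hc')

variable {ι : Type*} (F : ι → GrBimod V)

/-- The direct sum of a list of graded bimodules. -/
def bigSum : List ι → GrBimod V
  | [] => zeroBimod V
  | a :: l => (F a).sum (bigSum l)

instance : Subsingleton (bigSum F []).carrier := inferInstanceAs (Subsingleton PUnit)

variable {F}

theorem isIso_bigSum_singleton (a : ι) : IsIso (F a) (bigSum F [a]) :=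
  (IsIso.sum_of_subsingleton _ _).symm

theorem bigSum_append (l l' : List ι) :
    IsIso (bigSum F (l ++ l')) ((bigSum F l).sum (bigSum F l')) := by
  induction l with
  | nil => exact ((IsIso.sum_comm _ _).trans (IsIso.sum_of_subsingleton _ (bigSum F []))).symm
  | cons a l ih => exact ((IsIso.refl _).sum ih).trans (IsIso.sum_assoc _ _ _).symm

theorem bigSum_perm {l l' : List ι} (h : l.Perm l') : IsIso (bigSum F l) (bigSum F l') := by
  induction h with
  | nil => exact IsIso.refl _
  | cons a _ ih => exact (IsIso.refl _).sum ih
  | swap a b l =>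
    exact (IsIso.sum_assoc _ _ _).symm.trans
      (((IsIso.sum_comm _ _).sum (IsIso.refl _)).trans (IsIso.sum_assoc _ _ _))
  | trans _ _ h h' => exact h.trans h'

/-- A direct summand of a direct sum of bricks is a direct sum of some of them. -/
theorem exists_bigSum_of_sum (hF : ∀ i, IsBrick (F i)) {l : List ι} {M N : GrBimod V}
    (h : IsIso (M.sum N) (bigSum F l)) : ∃ l' : List ι, l' ⊆ l ∧ IsIso M (bigSum F l') := by
  induction l generalizing M N with
  | nil =>
    refine ⟨[], List.Subset.refl _, ?_⟩
    have := h.subsingleton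
    have : Subsingleton M.carrier := (LinearMap.inl_injective (R := ℝ) (M := M.carrier)
      (M₂ := N.carrier)).subsingleton
    exact IsIso.of_subsingleton _ _
  | cons a l ih =>
    obtain ⟨M', h1, h2⟩ | ⟨N', h1, h2⟩ := (hF a).exchange h.symm
    · obtain ⟨l', hl', h3⟩ := ih h2.symm
      exact ⟨a :: l', List.cons_subset_cons a hl', h1.trans ((IsIso.refl _).sum h3)⟩
    · obtain ⟨l', hl', h3⟩ := ih h2.symm
      exact ⟨l', List.subset_cons_of_subset a hl', h3⟩

/-- By exchange, F a splits off either the head or the rest of the list. In the first case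
indecomposability of the head forces it to be F a itself. -/
theorem bigSum_cancel (hF : ∀ i, IsBrick (F i)) (hF' : ∀ i, (F i).Indecomposable)
    (hinj : ∀ i j, IsIso (F i) (F j) → i = j) [DecidableEq ι] {l : List ι} {a : ι}
    {X : GrBimod V} (h : IsIso ((F a).sum X) (bigSum F l)) :
    a ∈ l ∧ IsIso X (bigSum F (l.erase a)) := by
  induction l generalizing X with
  | nil =>
    have := h.subsingleton
    have h1 : Subsingleton (F a).carrier := (LinearMap.inl_injective (R := ℝ)
      (M := (F a).carrier) (M₂ := X.carrier)).subsingleton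
    exact absurd (hF' a).1 (not_nontrivial_iff_subsingleton.2 h1)
  | cons b l ih =>
    obtain ⟨M', h1, h2⟩ | ⟨N', h1, h2⟩ := (hF a).exchange h
    · have h3 : Subsingleton M'.carrier := ((hF' b).2 _ _ h1).resolve_left
        (not_subsingleton_iff_nontrivial.2 (hF' a).1)
      obtain rfl := hinj _ _ (h1.trans (IsIso.sum_of_subsingleton _ _))
      refine ⟨List.mem_cons_self, ?_⟩
      rw [List.erase_cons_head]
      exact h2.trans ((IsIso.sum_comm _ _).trans (IsIso.sum_of_subsingleton _ _))
    · obtain ⟨h3, h4⟩ := ih h1.symm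
      refine ⟨List.mem_cons_of_mem _ h3, ?_⟩
      -- When b = a, `erase` removes the head although a was found in the tail; a permutation of the
      -- tail repairs this.
      by_cases hab : b = a
      · subst hab
        rw [List.erase_cons_head]
        exact h2.trans (((IsIso.refl _).sum h4).trans (bigSum_perm (List.perm_cons_erase h3).symm))
      · rw [List.erase_cons_tail (by simpa using hab)]
        exact h2.trans ((IsIso.refl _).sum h4)

/-- The uniqueness half of Krull–Schmidt: the summands of l are cancelled one at a time against
those of l'. -/
theorem perm_of_isIso_bigSum (hF : ∀ i, IsBrick (F i)) (hF' : ∀ i, (F i).Indecomposable)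
    (hinj : ∀ i j, IsIso (F i) (F j) → i = j) {l l' : List ι}
    (h : IsIso (bigSum F l) (bigSum F l')) : l.Perm l' := by
  classical
  induction l generalizing l' with
  | nil =>
    cases l' with
    | nil => exact .refl _
    | cons a l' => exact absurd (bigSum_cancel hF hF' hinj h.symm).1 List.not_mem_nil
  | cons a l ih =>
    obtain ⟨h1, h2⟩ := bigSum_cancel hF hF' hinj h
    exact ((ih h2).cons a).trans (List.perm_cons_erase h1).symm

end KrullSchmidt

/-! ### The cyclic bimodules attached to finite subsets of the group -/

section Cyclic

variable {V : Type u} [AddCommGroup V] [Module ℝ V]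

theorem polGr_eq_bot {d : ℤ} (hd : d < 0) : polGr V d = ⊥ := by
  rw [polGr, iSup₂_eq_bot]
  intro n hn
  omega

theorem mem_polGr_zero {r : Pol V} (hr : r ∈ polGr V 0) : ∃ c : ℝ, r = c • 1 := by
  have h : polGr V 0 ≤ ℝ ∙ 1 := by
    refine iSup₂_le fun n hn => ?_
    obtain rfl : n = 0 := by omega
    rw [pow_zero, Submodule.one_eq_span]
  obtain ⟨c, hc⟩ := Submodule.mem_span_singleton.1 (h hr)
  exact ⟨c, hc.symm⟩

/-- The degree `d` component of `R ⊗ R`. -/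
def envGr (V : Type u) [AddCommGroup V] [Module ℝ V] (d : ℤ) :
    Submodule ℝ (Pol V ⊗[ℝ] Pol V) :=
  Submodule.span ℝ {x | ∃ i j a b, i + j = d ∧ a ∈ polGr V i ∧ b ∈ polGr V j ∧ x = a ⊗ₜ b}

theorem tmul_mem_envGr {i j d : ℤ} (h : i + j = d) {a b : Pol V} (ha : a ∈ polGr V i)
    (hb : b ∈ polGr V j) : a ⊗ₜ b ∈ envGr V d :=
  Submodule.subset_span ⟨i, j, a, b, h, ha, hb, rfl⟩

theorem envGr_le {d : ℤ} {K : Submodule ℝ (Pol V ⊗[ℝ] Pol V)}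
    (h : ∀ i j a b, i + j = d → a ∈ polGr V i → b ∈ polGr V j → a ⊗ₜ b ∈ K) : envGr V d ≤ K := by
  rw [envGr, Submodule.span_le]
  rintro _ ⟨i, j, a, b, hij, ha, hb, rfl⟩
  exact h i j a b hij ha hb

/-- The bilinear map `(a, b) ↦ ∑ (a_i ⊗ b_j) v^{i+j}`. -/
def envComponents (V : Type u) [AddCommGroup V] [Module ℝ V] :
    Pol V →ₗ[ℝ] Pol V →ₗ[ℝ] ℤ →₀ Pol V ⊗[ℝ] Pol V :=
  (Finsupp.lsum ℝ fun i : ℤ => (Finsupp.lsum ℝ fun j : ℤ =>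
      ((TensorProduct.mk ℝ (Pol V) (Pol V)).compr₂ (Finsupp.lsingle (i + j))).flip).flip).compl₁₂
    (components (polGr V) polGr_isInternal) (components (polGr V) polGr_isInternal)

theorem envComponents_of_mem {i j : ℤ} {a b : Pol V} (ha : a ∈ polGr V i) (hb : b ∈ polGr V j) :
    envComponents V a b = Finsupp.single (i + j) (a ⊗ₜ b) := by
  simp [envComponents, components_of_mem _ _ ha, components_of_mem _ _ hb]

theorem tmul_mem_iSup_envGr (a b : Pol V) : a ⊗ₜ b ∈ ⨆ d, envGr V d := by
  rw [← components_sum (polGr V) polGr_isInternal a, ← components_sum (polGr V) polGr_isInternal b,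
    Finsupp.sum, Finsupp.sum, TensorProduct.sum_tmul]
  refine Submodule.sum_mem _ fun i _ => ?_
  rw [TensorProduct.tmul_sum]
  exact Submodule.sum_mem _ fun j _ => Submodule.mem_iSup_of_mem _
    (tmul_mem_envGr rfl (components_mem _ _ a _) (components_mem _ _ b _))

theorem envGr_isInternal : DirectSum.IsInternal (envGr V) := by
  refine isInternal_of_components _ ?_ (TensorProduct.lift (envComponents V)) ?_
  · rw [eq_top_iff]
    rintro x -
    induction x with
    | zero => exact Submodule.zero_mem _
    | tmul a b => exact tmul_mem_iSup_envGr a b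
    | add x y hx hy => exact Submodule.add_mem _ hx hy
  · intro d x hx
    have : envGr V d ≤ LinearMap.eqLocus (TensorProduct.lift (envComponents V))
        (Finsupp.lsingle d) := by
      refine envGr_le ?_
      rintro i j a b rfl ha hb
      simp [envComponents_of_mem ha hb]
    exact this hx

theorem mul_mem_envGr {d e : ℤ} {x y : Pol V ⊗[ℝ] Pol V} (hx : x ∈ envGr V d)
    (hy : y ∈ envGr V e) : x * y ∈ envGr V (d + e) := by
  suffices envGr V d * envGr V e ≤ envGr V (d + e) from this (Submodule.mul_mem_mul hx hy)
  rw [envGr, envGr, Submodule.span_mul_span, Submodule.span_le]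
  rintro _ ⟨_, ⟨i, j, a, b, rfl, ha, hb, rfl⟩, _, ⟨k, l, a', b', rfl, ha', hb', rfl⟩, rfl⟩
  simp only [Algebra.TensorProduct.tmul_mul_tmul]
  exact tmul_mem_envGr (by ring) (mul_mem_polGr ha ha') (mul_mem_polGr hb hb')

theorem envGr_eq_bot {d : ℤ} (hd : d < 0) : envGr V d = ⊥ := by
  refine eq_bot_iff.2 (envGr_le fun i j a b hij ha hb => ?_)
  rw [Submodule.mem_bot]
  rcases lt_or_ge i 0 with hi | hi
  · rw [polGr_eq_bot hi, Submodule.mem_bot] at ha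
    rw [ha, TensorProduct.zero_tmul]
  · rw [polGr_eq_bot (show j < 0 by omega), Submodule.mem_bot] at hb
    rw [hb, TensorProduct.tmul_zero]

theorem mem_envGr_zero {x : Pol V ⊗[ℝ] Pol V} (hx : x ∈ envGr V 0) : ∃ c : ℝ, x = c • 1 := by
  have h : envGr V 0 ≤ ℝ ∙ 1 := by
    refine envGr_le fun i j a b hij ha hb => ?_
    rcases lt_trichotomy i 0 with hi | rfl | hi
    · rw [polGr_eq_bot hi, Submodule.mem_bot] at ha
      rw [ha, TensorProduct.zero_tmul]
      exact Submodule.zero_mem _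
    · obtain rfl : j = 0 := by omega
      obtain ⟨c, rfl⟩ := mem_polGr_zero ha
      obtain ⟨d, rfl⟩ := mem_polGr_zero hb
      rw [TensorProduct.smul_tmul_smul]
      exact Submodule.smul_mem _ _ (Submodule.mem_span_singleton_self _)
    · rw [polGr_eq_bot (show j < 0 by omega), Submodule.mem_bot] at hb
      rw [hb, TensorProduct.tmul_zero]
      exact Submodule.zero_mem _
  obtain ⟨c, hc⟩ := Submodule.mem_span_singleton.1 (h hx)
  exact ⟨c, hc.symm⟩

/-- The graded bimodule `R ⊗ R`. -/
abbrev env (V : Type u) [AddCommGroup V] [Module ℝ V] : GrBimod V where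
  carrier := Pol V ⊗[ℝ] Pol V
  left := (Algebra.lmul ℝ (Pol V ⊗[ℝ] Pol V)).comp Algebra.TensorProduct.includeLeft
  right := (Algebra.lmul ℝ (Pol V ⊗[ℝ] Pol V)).comp Algebra.TensorProduct.includeRight
  left_right r s m := mul_left_comm (r ⊗ₜ[ℝ] (1 : Pol V)) ((1 : Pol V) ⊗ₜ[ℝ] s) m
  gr := envGr V
  isInternal := envGr_isInternal
  left_mem hr hm := mul_mem_envGr (tmul_mem_envGr (add_zero _) hr one_mem_polGr) hm
  right_mem hr hm := mul_mem_envGr (tmul_mem_envGr (zero_add _) one_mem_polGr hr) hm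

theorem act_env (θ x : Pol V ⊗[ℝ] Pol V) : act (env V) θ x = θ * x := by
  induction θ with
  | zero => rw [map_zero, zero_mul]; rfl
  | tmul a b =>
    rw [act_tmul]
    change (a ⊗ₜ[ℝ] (1 : Pol V)) * (((1 : Pol V) ⊗ₜ[ℝ] b) * x) = _
    rw [← mul_assoc, Algebra.TensorProduct.tmul_mul_tmul, mul_one, one_mul]
  | add y z hy hz => rw [map_add, LinearMap.add_apply, hy, hz, add_mul]

theorem act_mem_gr (M : GrBimod V) {d e : ℤ} {θ : Pol V ⊗[ℝ] Pol V} {m : M.carrier}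
    (hθ : θ ∈ envGr V d) (hm : m ∈ M.gr e) : act M θ m ∈ M.gr (d + e) := by
  have : envGr V d ≤ (M.gr (d + e)).comap ((act M).toLinearMap.flip m) := by
    refine envGr_le fun i j a b hij ha hb => ?_
    subst hij
    change act M (a ⊗ₜ b) m ∈ M.gr (i + j + e)
    rw [act_tmul, add_assoc]
    exact M.left_mem ha (M.right_mem hb hm)
  exact this hθ

variable {G : Type*} [Group G] (ρ : Representation ℝ G V)

/-- The evaluation `a ⊗ b ↦ a w(b)` on the graph of `w`. -/
def ev (w : G) : Pol V ⊗[ℝ] Pol V →ₐ[ℝ] Pol V :=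
  Algebra.TensorProduct.productMap (AlgHom.id ℝ (Pol V)) (polAct ρ w)

@[simp]
theorem ev_tmul (w : G) (a b : Pol V) : ev ρ w (a ⊗ₜ b) = a * polAct ρ w b := by
  simp [ev]

theorem isHom_ev (w : G) : IsHom (env V) (twisted ρ w) (ev ρ w).toLinearMap where
  left r m := by
    change ev ρ w ((r ⊗ₜ 1) * m) = r * ev ρ w m
    rw [map_mul, ev_tmul, map_one, mul_one]
  right r m := by
    change ev ρ w ((1 ⊗ₜ r) * m) = polAct ρ w r * ev ρ w m
    rw [map_mul, ev_tmul, one_mul]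
  gr d m hm := by
    have : envGr V d ≤ (polGr V d).comap (ev ρ w).toLinearMap := by
      refine envGr_le fun i j a b hij ha hb => ?_
      subst hij
      change ev ρ w (a ⊗ₜ b) ∈ polGr V (i + j)
      rw [ev_tmul]
      exact mul_mem_polGr ha (polAct_mem ρ w j b hb)
    exact this hm

/-- A map to R that sees the right action through w sees all of R ⊗ R through evaluation on the
graph of w. Annihilators in tensor products are computed by finding enough such maps. -/
theorem map_act_eq_ev_mul {M : GrBimod V} {w : G} {ψ : M.carrier →ₗ[ℝ] Pol V}
    (hl : ∀ r m, ψ (M.left r m) = r * ψ m) (hr : ∀ r m, ψ (M.right r m) = polAct ρ w r * ψ m)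
    (θ : Pol V ⊗[ℝ] Pol V) (m : M.carrier) : ψ (act M θ m) = ev ρ w θ * ψ m := by
  induction θ with
  | zero => simp
  | tmul a b => rw [act_tmul, hl, hr, ev_tmul, mul_assoc]
  | add y z hy hz => rw [map_add, map_add, LinearMap.add_apply, map_add, hy, hz, add_mul]

/-- The elements of `R ⊗ R` vanishing on the graphs of the elements of `S`. -/
def vanish (S : Finset G) : Submodule ℝ (Pol V ⊗[ℝ] Pol V) :=
  ⨅ w ∈ S, LinearMap.ker (ev ρ w).toLinearMap

theorem mem_vanish {S : Finset G} {θ : Pol V ⊗[ℝ] Pol V} :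
    θ ∈ vanish ρ S ↔ ∀ w ∈ S, ev ρ w θ = 0 := by
  simp [vanish, Submodule.mem_iInf]

/-- The graded bimodule of polynomial functions on the union of the graphs of the elements
of `S`. -/
abbrev graphs (S : Finset G) : GrBimod V :=
  quotient (env V) (vanish ρ S)
    (fun r θ hθ => (mem_vanish ρ).2 fun w hw => by
      have h := (isHom_ev ρ w).left r θ
      have h2 := (mem_vanish ρ).1 hθ w hw
      refine h.trans ?_
      change r * ev ρ w θ = 0
      rw [h2, mul_zero])
    (fun r θ hθ => (mem_vanish ρ).2 fun w hw => by
      have h := (isHom_ev ρ w).right r θ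
      have h2 := (mem_vanish ρ).1 hθ w hw
      refine h.trans ?_
      change polAct ρ w r * ev ρ w θ = 0
      rw [h2, mul_zero])
    (fun θ hθ d => (mem_vanish ρ).2 fun w hw => by
      have h := (isHom_ev ρ w).components_map θ d
      have h2 : (ev ρ w).toLinearMap θ = 0 := (mem_vanish ρ).1 hθ w hw
      refine h.symm.trans ((congrArg (fun y => components (twisted ρ w).gr
        (twisted ρ w).isInternal y d) h2).trans ?_)
      exact DFunLike.congr_fun
        (map_zero (components (twisted ρ w).gr (twisted ρ w).isInternal)) d)

/-- The class of an element of `R ⊗ R` in `graphs ρ S`. -/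
def gmk (S : Finset G) : Pol V ⊗[ℝ] Pol V →ₗ[ℝ] (graphs ρ S).carrier := (vanish ρ S).mkQ

theorem gmk_surjective (S : Finset G) : Function.Surjective (gmk ρ S) :=
  (vanish ρ S).mkQ_surjective

theorem isHom_gmk (S : Finset G) : IsHom (env V) (graphs ρ S) (gmk ρ S) := by
  exact IsHom.quotient_mkQ _ _ _

theorem gmk_eq_zero {S : Finset G} {θ : Pol V ⊗[ℝ] Pol V} :
    gmk ρ S θ = 0 ↔ ∀ w ∈ S, ev ρ w θ = 0 := by
  rw [← mem_vanish]
  exact Submodule.Quotient.mk_eq_zero _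

theorem act_graphs (S : Finset G) (θ x : Pol V ⊗[ℝ] Pol V) :
    act (graphs ρ S) θ (gmk ρ S x) = gmk ρ S (θ * x) := by
  rw [← (isHom_gmk ρ S).map_act, act_env]

theorem graphs_gr_eq_bot (S : Finset G) {d : ℤ} (hd : d < 0) : (graphs ρ S).gr d = ⊥ := by
  change (envGr V d).map _ = ⊥
  rw [envGr_eq_bot hd, Submodule.map_bot]

theorem mem_graphs_gr_zero {S : Finset G} {m : (graphs ρ S).carrier}
    (hm : m ∈ (graphs ρ S).gr 0) : ∃ c : ℝ, m = c • gmk ρ S 1 := by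
  obtain ⟨x, hx, rfl⟩ := hm
  obtain ⟨c, rfl⟩ := mem_envGr_zero hx
  exact ⟨c, map_smul (gmk ρ S) c 1⟩

theorem one_mem_envGr : (1 : Pol V ⊗[ℝ] Pol V) ∈ envGr V 0 :=
  tmul_mem_envGr (add_zero 0) one_mem_polGr one_mem_polGr

theorem gmk_one_mem (S : Finset G) : gmk ρ S 1 ∈ (graphs ρ S).gr 0 :=
  (isHom_gmk ρ S).gr 0 _ one_mem_envGr

theorem gmk_one_ne_zero {S : Finset G} (hS : S.Nonempty) : gmk ρ S 1 ≠ 0 := by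
  obtain ⟨w, hw⟩ := hS
  intro h
  have := (gmk_eq_zero ρ).1 h w hw
  rw [map_one] at this
  exact one_ne_zero this

/-- A morphism out of `graphs ρ S` is given by an element that is killed by the elements of
`R ⊗ R` vanishing on `S`. -/
theorem exists_hom_graphs {S : Finset G} {N : GrBimod V} {d : ℤ} {n : N.carrier}
    (hn : n ∈ N.gr d) (h : ∀ θ ∈ vanish ρ S, act N θ n = 0) :
    ∃ f : (graphs ρ S).carrier →ₗ[ℝ] N.carrier, IsHom ((graphs ρ S).shift (-d)) N f ∧
      ∀ θ, f (gmk ρ S θ) = act N θ n := by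
  let f : (graphs ρ S).carrier →ₗ[ℝ] N.carrier :=
    (vanish ρ S).liftQ ((act N).toLinearMap.flip n) h
  have hf : ∀ θ, f (gmk ρ S θ) = act N θ n := fun _ => rfl
  refine ⟨f, ⟨fun r m => ?_, fun r m => ?_, ?_⟩, hf⟩
  · obtain ⟨θ, rfl⟩ := gmk_surjective ρ S m
    change f (gmk ρ S ((r ⊗ₜ 1) * θ)) = _
    rw [hf, hf, map_mul, Module.End.mul_apply, act_tmul, map_one, Module.End.one_apply]
  · obtain ⟨θ, rfl⟩ := gmk_surjective ρ S m
    change f (gmk ρ S ((1 ⊗ₜ r) * θ)) = _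
    rw [hf, hf, map_mul, Module.End.mul_apply, act_tmul, map_one, Module.End.one_apply]
  · rintro e _ ⟨θ, hθ, rfl⟩
    have := act_mem_gr N hθ hn
    rwa [neg_add_cancel_right] at this

/-- An endomorphism preserves the component of the generator 1, which consists of the real multiples
of 1; it is then determined by the multiple to which it sends 1. -/
theorem isBrick_graphs (S : Finset G) (n : ℤ) : IsBrick ((graphs ρ S).shift n) := by
  intro f hf
  have h1 : f (gmk ρ S 1) ∈ (graphs ρ S).gr 0 := by
    have h2 : gmk ρ S 1 ∈ ((graphs ρ S).shift n).gr (-n) := by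
      change _ ∈ (graphs ρ S).gr (-n + n)
      rw [neg_add_cancel]
      exact gmk_one_mem ρ S
    have h3 : f (gmk ρ S 1) ∈ (graphs ρ S).gr (-n + n) := hf.gr _ _ h2
    rwa [neg_add_cancel] at h3
  obtain ⟨c, hc⟩ := mem_graphs_gr_zero ρ h1
  refine ⟨c, LinearMap.ext fun m => ?_⟩
  obtain ⟨θ, rfl⟩ := gmk_surjective ρ S m
  have h4 : gmk ρ S θ = act ((graphs ρ S).shift n) θ (gmk ρ S 1) := by
    refine Eq.trans ?_ (act_graphs ρ S θ 1).symm
    rw [mul_one]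
  change f (gmk ρ S θ) = c • gmk ρ S θ
  rw [h4, hf.map_act, hc]
  exact map_smul (act ((graphs ρ S).shift n) θ) c _

/-- If the generator corresponds to (a, b) in N ⊕ P, then (a, 0) has the same degree and is a
multiple of (a, b). So a = 0 or b = 0, and a summand generated by 0 vanishes. -/
theorem indecomposable_graphs {S : Finset G} (hS : S.Nonempty) (n : ℤ) :
    ((graphs ρ S).shift n).Indecomposable := by
  refine ⟨⟨⟨gmk ρ S 1, 0, gmk_one_ne_zero ρ hS⟩⟩, ?_⟩
  rintro N P ⟨e⟩
  have h1 : gmk ρ S 1 ∈ ((graphs ρ S).shift n).gr (-n) := by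
    change _ ∈ (graphs ρ S).gr (-n + n)
    rw [neg_add_cancel]
    exact gmk_one_mem ρ S
  have key : ∀ x : N.carrier × P.carrier, x ∈ (N.sum P).gr (-n) →
      ∃ c : ℝ, x = c • e.equiv (gmk ρ S 1) := by
    intro x hx
    have h2 : e.equiv.symm x ∈ ((graphs ρ S).shift n).gr (-n) := (e.symm.mem_gr_iff _ _).2 hx
    have h3 : e.equiv.symm x ∈ (graphs ρ S).gr (-n + n) := h2
    rw [neg_add_cancel] at h3
    obtain ⟨c, hc⟩ := mem_graphs_gr_zero ρ h3
    refine ⟨c, ?_⟩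
    rw [← map_smul]
    exact e.equiv.symm_apply_eq.1 hc
  have hgen : ∀ x : N.carrier × P.carrier, ∃ θ, x = act (N.sum P) θ (e.equiv (gmk ρ S 1)) := by
    intro x
    obtain ⟨θ, hθ⟩ := gmk_surjective ρ S (e.equiv.symm x)
    refine ⟨θ, ?_⟩
    refine (e.equiv.symm_apply_eq.1 hθ.symm).trans ?_
    have := (IsHom.of_iso e).map_act θ (gmk ρ S 1)
    refine Eq.trans ?_ this
    refine congrArg e.equiv ?_
    refine Eq.trans ?_ (act_graphs ρ S θ 1).symm
    rw [mul_one]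
  have h2 : e.equiv (gmk ρ S 1) ∈ (N.sum P).gr (-n) := (e.mem_gr_iff _ _).2 h1
  generalize e.equiv (gmk ρ S 1) = x at key hgen h2
  obtain ⟨a, b⟩ := x
  obtain ⟨c, hc⟩ := key (a, 0) ⟨h2.1, Submodule.zero_mem _⟩
  obtain ⟨h3, h4⟩ := Prod.mk.inj hc
  rcases smul_eq_zero.1 h4.symm with rfl | rfl
  · left
    rw [zero_smul] at h3
    refine subsingleton_of_forall_eq 0 fun y => ?_
    obtain ⟨θ, hθ⟩ := hgen (y, 0)
    have h5 := congrArg (LinearMap.fst ℝ N.carrier P.carrier) hθ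
    rw [(IsHom.fst N P).map_act] at h5
    refine h5.trans ?_
    simp [h3]
  · right
    refine subsingleton_of_forall_eq 0 fun y => ?_
    obtain ⟨θ, hθ⟩ := hgen (0, y)
    have h5 := congrArg (LinearMap.snd ℝ N.carrier P.carrier) hθ
    rw [(IsHom.snd N P).map_act] at h5
    refine h5.trans ?_
    simp

/-- Distinct group elements act differently on R, and R is a domain, so for w outside S some product
of differences vanishes on every graph of S but not on that of w. -/
theorem vanish_le_vanish_iff (hρ : Function.Injective (polAct ρ)) {S S' : Finset G} :
    vanish ρ S ≤ vanish ρ S' ↔ S' ⊆ S := by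
  classical
  refine ⟨fun h w hw => ?_, fun h θ hθ => (mem_vanish ρ).2 fun w hw =>
    (mem_vanish ρ).1 hθ w (h hw)⟩
  by_contra hwS
  have h1 : ∀ u ∈ S, ∃ b, polAct ρ w b - polAct ρ u b ≠ 0 := by
    intro u hu
    by_contra! h2
    have : w = u := hρ (AlgHom.ext fun b => sub_eq_zero.1 (h2 b))
    exact hwS (this ▸ hu)
  choose! b hb using h1
  -- The factor for u evaluates to u'(b u) − u(b u) on the graph of u': it is zero for u' = u and
  -- nonzero for u' = w by the choice of b.
  let θ : Pol V ⊗[ℝ] Pol V := ∏ u ∈ S, (1 ⊗ₜ b u - polAct ρ u (b u) ⊗ₜ 1)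
  have h2 : θ ∈ vanish ρ S := by
    refine (mem_vanish ρ).2 fun u hu => ?_
    rw [map_prod]
    exact Finset.prod_eq_zero hu (by simp)
  have h3 := (mem_vanish ρ).1 (h h2) w hw
  rw [map_prod, Finset.prod_eq_zero_iff] at h3
  obtain ⟨u, hu, h4⟩ := h3
  exact hb u hu (by simpa using h4)

/-- The shift is read off the lowest nonzero degree, and S off the annihilator of the generator
there, since `vanish ρ S` determines S. -/
theorem eq_of_isIso_graphs (hρ : Function.Injective (polAct ρ)) {S S' : Finset G}
    (hS : S.Nonempty) (hS' : S'.Nonempty) {n n' : ℤ}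
    (h : IsIso ((graphs ρ S).shift n) ((graphs ρ S').shift n')) : S = S' ∧ n = n' := by
  -- One inequality and one inclusion; the inverse isomorphism supplies the opposite ones.
  have key : ∀ {S S' : Finset G} {n n' : ℤ}, S.Nonempty →
      IsIso ((graphs ρ S).shift n) ((graphs ρ S').shift n') →
      n ≤ n' ∧ (n = n' → S ⊆ S') := by
    rintro S S' n n' hS ⟨e⟩
    have h1 : gmk ρ S 1 ∈ ((graphs ρ S).shift n).gr (-n) := by
      change _ ∈ (graphs ρ S).gr (-n + n)
      rw [neg_add_cancel]
      exact gmk_one_mem ρ S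
    have h2 : e.equiv (gmk ρ S 1) ∈ (graphs ρ S').gr (-n + n') := (e.mem_gr_iff _ _).2 h1
    constructor
    · by_contra hn
      rw [graphs_gr_eq_bot ρ S' (by omega), Submodule.mem_bot] at h2
      exact gmk_one_ne_zero ρ hS (e.equiv.map_eq_zero_iff.1 h2)
    · rintro rfl
      rw [neg_add_cancel] at h2
      obtain ⟨c, hc⟩ := mem_graphs_gr_zero ρ h2
      rw [← vanish_le_vanish_iff ρ hρ]
      intro θ hθ
      rw [mem_vanish, ← gmk_eq_zero] at hθ ⊢
      have h3 := (IsHom.of_iso e).map_act θ (gmk ρ S 1)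
      have h4 : act ((graphs ρ S').shift n) θ (e.equiv (gmk ρ S 1)) = c • gmk ρ S' θ := by
        rw [hc]
        refine (map_smul (act ((graphs ρ S').shift n) θ) c _).trans ?_
        refine congrArg (c • ·) ((act_graphs ρ S' θ 1).trans ?_)
        rw [mul_one]
      rw [hθ, smul_zero] at h4
      have h5 : e.equiv (act ((graphs ρ S).shift n) θ (gmk ρ S 1)) = 0 := h3.trans h4
      have h6 := e.equiv.map_eq_zero_iff.1 h5
      rw [← mul_one θ, ← act_graphs]
      exact h6
  have h1 := key hS h
  have h2 := key hS' h.symm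
  have hn : n = n' := le_antisymm h1.1 h2.1
  exact ⟨(h1.2 hn).antisymm (h2.2 hn.symm), hn⟩

end Cyclic

/-! ### Tensor products with the generators -/

section Products

variable {V : Type u} [AddCommGroup V] [Module ℝ V]
variable {G : Type*} [Group G] (ρ : Representation ℝ G V)

theorem polAct_one : polAct ρ 1 = AlgHom.id ℝ (Pol V) := by
  refine SymmetricAlgebra.algHom_ext (LinearMap.ext fun f => ?_)
  simp [polAct]
  rfl

theorem polAct_mul (v w : G) : polAct ρ (v * w) = (polAct ρ v).comp (polAct ρ w) := by
  refine SymmetricAlgebra.algHom_ext (LinearMap.ext fun f => ?_)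
  simp [polAct]
  rfl

theorem polAct_mul_apply (v w : G) (r : Pol V) :
    polAct ρ (v * w) r = polAct ρ v (polAct ρ w r) := by
  rw [polAct_mul, AlgHom.comp_apply]

theorem polAct_injective (w : G) : Function.Injective (polAct ρ w) := by
  refine Function.LeftInverse.injective (g := polAct ρ w⁻¹) fun r => ?_
  rw [← polAct_mul_apply, inv_mul_cancel, polAct_one, AlgHom.id_apply]

theorem polAct_ι (w : G) (f : Module.Dual ℝ V) :
    polAct ρ w (SymmetricAlgebra.ι ℝ _ f) = SymmetricAlgebra.ι ℝ _ (ρ.dual w f) := by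
  simp [polAct]

variable {ρ}

/-- The recognition principle for Q_S: a homogeneous generator whose annihilator is the ideal of S.
The shift is by −d because the generator of Q_S sits in degree 0. -/
theorem isIso_graphs_of_generator {N : GrBimod V} {S : Finset G} {d : ℤ} {n : N.carrier}
    (hn : n ∈ N.gr d) (hker : ∀ θ, act N θ n = 0 ↔ θ ∈ vanish ρ S)
    (hgen : ∀ m, ∃ θ, act N θ n = m) : IsIso N ((graphs ρ S).shift (-d)) := by
  obtain ⟨f, hf, hfθ⟩ := exists_hom_graphs ρ hn fun θ => (hker θ).2
  refine IsIso.symm (hf.isIso ⟨?_, fun m => ?_⟩)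
  · rw [injective_iff_map_eq_zero]
    intro q hq
    obtain ⟨θ, rfl⟩ := gmk_surjective ρ S q
    exact (gmk_eq_zero ρ).2 ((mem_vanish ρ).1 ((hker θ).1 ((hfθ θ).symm.trans hq)))
  · obtain ⟨θ, rfl⟩ := hgen m
    exact ⟨gmk ρ S θ, hfθ θ⟩

theorem isIso_graphs_sum_of_generators {N : GrBimod V} {S₁ S₂ : Finset G} {d₁ d₂ : ℤ}
    {n₁ n₂ : N.carrier} (hn₁ : n₁ ∈ N.gr d₁) (hn₂ : n₂ ∈ N.gr d₂)
    (hk₁ : ∀ θ ∈ vanish ρ S₁, act N θ n₁ = 0) (hk₂ : ∀ θ ∈ vanish ρ S₂, act N θ n₂ = 0)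
    (hinj : ∀ θ₁ θ₂, act N θ₁ n₁ + act N θ₂ n₂ = 0 → θ₁ ∈ vanish ρ S₁ ∧ θ₂ ∈ vanish ρ S₂)
    (hgen : ∀ m, ∃ θ₁ θ₂, act N θ₁ n₁ + act N θ₂ n₂ = m) :
    IsIso N (((graphs ρ S₁).shift (-d₁)).sum ((graphs ρ S₂).shift (-d₂))) := by
  obtain ⟨f₁, hf₁, hfθ₁⟩ := exists_hom_graphs ρ hn₁ hk₁
  obtain ⟨f₂, hf₂, hfθ₂⟩ := exists_hom_graphs ρ hn₂ hk₂
  refine IsIso.symm ((hf₁.coprod hf₂).isIso ⟨?_, fun m => ?_⟩)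
  · rw [injective_iff_map_eq_zero]
    rintro ⟨q₁, q₂⟩ hq
    obtain ⟨θ₁, rfl⟩ := gmk_surjective ρ S₁ q₁
    obtain ⟨θ₂, rfl⟩ := gmk_surjective ρ S₂ q₂
    have h1 : f₁ (gmk ρ S₁ θ₁) + f₂ (gmk ρ S₂ θ₂) = 0 := hq
    rw [hfθ₁, hfθ₂] at h1
    obtain ⟨h2, h3⟩ := hinj _ _ h1
    exact Prod.ext ((gmk_eq_zero ρ).2 ((mem_vanish ρ).1 h2))
      ((gmk_eq_zero ρ).2 ((mem_vanish ρ).1 h3))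
  · obtain ⟨θ₁, θ₂, rfl⟩ := hgen m
    exact ⟨(gmk ρ S₁ θ₁, gmk ρ S₂ θ₂), congrArg₂ (· + ·) (hfθ₁ θ₁) (hfθ₂ θ₂)⟩

/-- The sub-bimodule generated by an element. -/
def genBy (N : GrBimod V) (n : N.carrier) : Submodule ℝ N.carrier :=
  LinearMap.range ((act N).toLinearMap.flip n)

theorem mem_genBy {N : GrBimod V} {n m : N.carrier} : m ∈ genBy N n ↔ ∃ θ, act N θ n = m := Iff.rfl

theorem self_mem_genBy (N : GrBimod V) (n : N.carrier) : n ∈ genBy N n :=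
  ⟨1, by simp⟩

theorem act_mem_genBy {N : GrBimod V} {n m : N.carrier} (hm : m ∈ genBy N n)
    (θ : Pol V ⊗[ℝ] Pol V) : act N θ m ∈ genBy N n := by
  obtain ⟨θ', rfl⟩ := hm
  refine ⟨θ * θ', ?_⟩
  change act N (θ * θ') n = act N θ (act N θ' n)
  rw [map_mul, Module.End.mul_apply]

theorem left_eq_act (N : GrBimod V) (r : Pol V) (m : N.carrier) :
    N.left r m = act N (r ⊗ₜ 1) m := by
  rw [act_tmul, map_one, Module.End.one_apply]

theorem right_eq_act (N : GrBimod V) (r : Pol V) (m : N.carrier) :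
    N.right r m = act N (1 ⊗ₜ r) m := by
  rw [act_tmul, map_one, Module.End.one_apply]

variable (ρ)

/-- The evaluation of a function on the union of the graphs of the elements of `S` at one of
the graphs. -/
def gev {S : Finset G} (v : S) : (graphs ρ S).carrier →ₗ[ℝ] Pol V :=
  (vanish ρ S).liftQ (ev ρ v).toLinearMap fun _ hθ => (mem_vanish ρ).1 hθ v v.2

@[simp]
theorem gev_gmk {S : Finset G} (v : S) (θ : Pol V ⊗[ℝ] Pol V) : gev ρ v (gmk ρ S θ) = ev ρ v θ :=
  rfl

theorem gev_left {S : Finset G} (v : S) (r : Pol V) (q : (graphs ρ S).carrier) :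
    gev ρ v ((graphs ρ S).left r q) = r * gev ρ v q := by
  obtain ⟨θ, rfl⟩ := gmk_surjective ρ S q
  rw [left_eq_act, act_graphs, gev_gmk, gev_gmk, map_mul, ev_tmul, map_one, mul_one]

theorem gev_right {S : Finset G} (v : S) (r : Pol V) (q : (graphs ρ S).carrier) :
    gev ρ v ((graphs ρ S).right r q) = polAct ρ v r * gev ρ v q := by
  obtain ⟨θ, rfl⟩ := gmk_surjective ρ S q
  rw [right_eq_act, act_graphs, gev_gmk, gev_gmk, map_mul, ev_tmul, one_mul]

theorem graphs_ext {S : Finset G} {q q' : (graphs ρ S).carrier}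
    (h : ∀ v : S, gev ρ v q = gev ρ v q') : q = q' := by
  obtain ⟨θ, rfl⟩ := gmk_surjective ρ S q
  obtain ⟨θ', rfl⟩ := gmk_surjective ρ S q'
  rw [← sub_eq_zero, ← map_sub, gmk_eq_zero]
  intro w hw
  rw [map_sub, sub_eq_zero]
  exact h ⟨w, hw⟩

theorem gmk_induction {S : Finset G} (K : Submodule ℝ (graphs ρ S).carrier)
    (h : ∀ a b, (graphs ρ S).left a ((graphs ρ S).right b (gmk ρ S 1)) ∈ K)
    (q : (graphs ρ S).carrier) : q ∈ K := by
  obtain ⟨θ, rfl⟩ := gmk_surjective ρ S q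
  induction θ with
  | zero => rw [map_zero]; exact K.zero_mem
  | tmul a b =>
    have := h a b
    rwa [← act_tmul, act_graphs, mul_one] at this
  | add x y hx hy => rw [map_add]; exact K.add_mem hx hy

variable [DecidableEq G]

/-- Every tensor is of the form q ⊗ 1, so the product is Q_S as a left module; only the right action
changes, and the graph of v becomes that of vw. -/
theorem graphs_tensor_twisted (S : Finset G) (w : G) :
    IsIso ((graphs ρ S).tensor (twisted ρ w)) (graphs ρ (S.image (· * w))) := by
  let N := (graphs ρ S).tensor (twist (polAct ρ w) (polAct_mem ρ w))
  let Q := graphs ρ S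
  let T := twist (polAct ρ w) (polAct_mem ρ w)
  let n : N.carrier := tmk ⊤ Q T (gmk ρ S 1) (1 : Pol V)
  have hn : n ∈ N.gr 0 := tmk_mem_tensorGr (add_zero 0) (gmk_one_mem ρ S) one_mem_polGr
  have hmove : ∀ q (r : Pol V), tmk ⊤ Q T q r =
      tmk ⊤ Q T (Q.right r q) (1 : Pol V) := by
    intro q r
    rw [tmk_right Algebra.mem_top]
    congr 1
    exact (mul_one r).symm
  have hone : ∀ x : N.carrier, ∃ q, x = tmk ⊤ Q T q (1 : Pol V) := by
    intro x
    refine tensor_span x (K := LinearMap.range ((tmkₗ ⊤ Q T).flip (1 : Pol V)))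
      (fun q r => ⟨Q.right r q, (hmove q r).symm⟩) |>.imp fun q hq => hq.symm
  -- The value of q ⊗ r over v is q(v) v(r). The right action sees this value through vw, and all
  -- these values together separate the elements.
  let ψ : S → N.carrier →ₗ[ℝ] Pol V := fun v =>
    tlift ((LinearMap.mul ℝ (Pol V)).compl₁₂ (gev ρ v) (polAct ρ v).toLinearMap) (by
      intro s _ q r
      change gev ρ v (Q.right s q) * polAct ρ v r = gev ρ v q * polAct ρ v (s * r)
      rw [gev_right, map_mul]
      ring)
  have hψ : ∀ v q (r : Pol V), ψ v (tmk ⊤ Q T q r) = gev ρ v q * polAct ρ v r :=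
    fun _ _ _ => rfl
  have hψl : ∀ v r x, ψ v (N.left r x) = r * ψ v x := by
    intro v r x
    refine tensor_ext_apply (ψ v ∘ₗ N.left r) (LinearMap.mul ℝ (Pol V) r ∘ₗ ψ v) (fun q a => ?_) x
    change gev ρ v (Q.left r q) * polAct ρ v a = r * (gev ρ v q * polAct ρ v a)
    rw [gev_left, mul_assoc]
  have hψr : ∀ v r x, ψ v (N.right r x) = polAct ρ (v * w) r * ψ v x := by
    intro v r x
    refine tensor_ext_apply (ψ v ∘ₗ N.right r)
      (LinearMap.mul ℝ (Pol V) (polAct ρ (v * w) r) ∘ₗ ψ v) (fun q a => ?_) x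
    change gev ρ v q * polAct ρ v (polAct ρ w r * a) =
      polAct ρ (v * w) r * (gev ρ v q * polAct ρ v a)
    rw [map_mul, polAct_mul_apply]
    ring
  have hsep : ∀ x, (∀ v, ψ v x = 0) → x = 0 := by
    intro x hx
    obtain ⟨q, rfl⟩ := hone x
    have : q = 0 := graphs_ext ρ fun v => by
      have := hx v
      rw [hψ, map_one, mul_one] at this
      rw [this, map_zero]
    rw [this, tmk_zero_left]
  have key := isIso_graphs_of_generator (ρ := ρ) (S := S.image (· * w)) hn (fun θ => ?_) fun m => ?_
  · exact key.trans (by rw [neg_zero]; exact IsIso.shift_zero _)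
  · have h1 : ∀ v, ψ v (act N θ n) = ev ρ (v * w) θ := by
      intro v
      rw [map_act_eq_ev_mul ρ (hψl v) (hψr v)]
      change _ * (ev ρ v 1 * polAct ρ v 1) = _
      rw [map_one, map_one, mul_one, mul_one]
    rw [mem_vanish]
    constructor
    · intro h2 u hu
      obtain ⟨v, hv, rfl⟩ := Finset.mem_image.1 hu
      rw [← h1 ⟨v, hv⟩, h2, map_zero]
    · intro h2
      refine hsep _ fun v => ?_
      rw [h1]
      exact h2 _ (Finset.mem_image_of_mem _ v.2)
  · rw [← mem_genBy]
    obtain ⟨q, rfl⟩ := hone m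
    -- Right multiplication in R_w is twisted by w, so b is obtained by acting with w⁻¹(b).
    refine gmk_induction ρ ((genBy N n).comap ((tmkₗ ⊤ Q T).flip (1 : Pol V)))
      (fun a b => ⟨a ⊗ₜ polAct ρ w⁻¹ b, ?_⟩) q
    change act N (a ⊗ₜ polAct ρ w⁻¹ b) n = tmk ⊤ Q T (Q.left a (Q.right b (gmk ρ S 1))) (1 : Pol V)
    rw [Q.left_right, ← hmove, act_tmul]
    change tmk ⊤ Q T (Q.left a (gmk ρ S 1)) (polAct ρ w (polAct ρ w⁻¹ b) * 1) = _
    rw [mul_one, ← polAct_mul_apply, mul_inv_cancel, polAct_one]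
    rfl

end Products

/-! ### Products of Q_S with the reflection bimodules B_x -/

section Products

variable {V : Type u} [AddCommGroup V] [Module ℝ V]
variable {G : Type*} [Group G] (ρ : Representation ℝ G V)

/-- `α` is an equation of the hyperplane fixed by the reflection `x`. -/
structure IsRoot (x : G) (α : Pol V) : Prop where
  mul_self : x * x = 1
  ne_zero : α ≠ 0
  mem : α ∈ polGr V 2
  map_eq : polAct ρ x α = -α
  exists_eq : ∀ r, ∃ r₀ ∈ invariants ρ x, ∃ r₁ ∈ invariants ρ x, r = r₀ + r₁ * α

variable {ρ}

theorem polAct_of_mem_invariants {x : G} {r : Pol V} (hr : r ∈ invariants ρ x) :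
    polAct ρ x r = r := hr

variable (ρ)

/-- The tensor `q ⊗ (a ⊗ b)` in `Q_S ⊗ B_x`. -/
def tri (S : Finset G) (x : G) (q : (graphs ρ S).carrier) (a b : Pol V) :
    ((graphs ρ S).tensor (reflBimod ρ x)).carrier :=
  tmk ⊤ (graphs ρ S) (reflBimod ρ x) q (tmk (invariants ρ x) (unit V) (unit V) a b)

section

variable {ρ} {S : Finset G} {x : G} {q q' : (graphs ρ S).carrier} {a a' b b' r : Pol V}

theorem left_tri : ((graphs ρ S).tensor (reflBimod ρ x)).left r (tri ρ S x q a b) =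
    tri ρ S x ((graphs ρ S).left r q) a b := rfl

theorem right_tri : ((graphs ρ S).tensor (reflBimod ρ x)).right r (tri ρ S x q a b) =
    tri ρ S x q a (r * b) := rfl

theorem tri_right : tri ρ S x ((graphs ρ S).right r q) a b = tri ρ S x q (r * a) b :=
  tmk_right (M := graphs ρ S) (N := reflBimod ρ x) Algebra.mem_top q
    (tmk (invariants ρ x) (unit V) (unit V) a b)

theorem tri_invariant (hr : r ∈ invariants ρ x) : tri ρ S x q (r * a) b = tri ρ S x q a (r * b) :=
  congrArg (tmk ⊤ (graphs ρ S) (reflBimod ρ x) q)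
    (tmk_right (M := unit V) (N := unit V) hr a b)

theorem tri_add_mid : tri ρ S x q (a + a') b = tri ρ S x q a b + tri ρ S x q a' b := by
  refine (congrArg (tmk ⊤ (graphs ρ S) (reflBimod ρ x) q)
    (tmk_add_left (M := unit V) (N := unit V) a a' b)).trans ?_
  exact tmk_add_right (M := graphs ρ S) (N := reflBimod ρ x) _ _ _

theorem tri_smul_mid (c : ℝ) : tri ρ S x q (c • a) b = c • tri ρ S x q a b := by
  refine (congrArg (tmk ⊤ (graphs ρ S) (reflBimod ρ x) q)
    (tmk_smul_left (M := unit V) (N := unit V) c a b)).trans ?_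
  exact tmk_smul_right (M := graphs ρ S) (N := reflBimod ρ x) _ _ _

theorem tri_add_last : tri ρ S x q a (b + b') = tri ρ S x q a b + tri ρ S x q a b' := by
  refine (congrArg (tmk ⊤ (graphs ρ S) (reflBimod ρ x) q)
    (tmk_add_right (M := unit V) (N := unit V) a b b')).trans ?_
  exact tmk_add_right (M := graphs ρ S) (N := reflBimod ρ x) _ _ _

theorem tri_add_first : tri ρ S x (q + q') a b = tri ρ S x q a b + tri ρ S x q' a b :=
  tmk_add_left (M := graphs ρ S) (N := reflBimod ρ x) _ _ _

theorem tri_zero_first : tri ρ S x 0 a b = 0 :=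
  tmk_zero_left (M := graphs ρ S) (N := reflBimod ρ x) _

theorem tri_mem_gr {i j k d : ℤ} (h : i + (j + k) - 1 = d) (hq : q ∈ (graphs ρ S).gr i)
    (ha : a ∈ polGr V j) (hb : b ∈ polGr V k) :
    tri ρ S x q a b ∈ ((graphs ρ S).tensor (reflBimod ρ x)).gr d := by
  refine tmk_mem_tensorGr (M := graphs ρ S) (N := reflBimod ρ x) (i := i) (j := j + k - 1)
    (by omega) hq ?_
  change tmk _ _ _ _ _ ∈ tensorGr (invariants ρ x) (unit V) (unit V) (j + k - 1 + 1)
  rw [sub_add_cancel]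
  exact tmk_mem_tensorGr (M := unit V) (N := unit V) rfl ha hb

theorem tri_induction (K : Submodule ℝ ((graphs ρ S).tensor (reflBimod ρ x)).carrier)
    (h : ∀ q a b, tri ρ S x q a b ∈ K)
    (m : ((graphs ρ S).tensor (reflBimod ρ x)).carrier) : m ∈ K := by
  refine tensor_span m fun q β => ?_
  exact tensor_span (K := K.comap (tmkₗ ⊤ (graphs ρ S) (reflBimod ρ x) q)) β fun a b => h q a b

end

/-- The function `q ⊗ (a ⊗ b) ↦ q(v) v(a) v(y(b))`, for `y` acting trivially on `R^x`. -/
def triEv {S : Finset G} {x : G} (v : S) {y : G} (hy : ∀ s ∈ invariants ρ x, polAct ρ y s = s) :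
    ((graphs ρ S).tensor (reflBimod ρ x)).carrier →ₗ[ℝ] Pol V :=
  let φ : TensorCarrier (invariants ρ x) (unit V) (unit V) →ₗ[ℝ] Pol V :=
    tlift ((LinearMap.mul ℝ (Pol V)).compl₁₂ (polAct ρ v).toLinearMap
      (polAct ρ (v * y)).toLinearMap) (by
        intro s hs a b
        change polAct ρ v (s * a) * polAct ρ (v * y) b = polAct ρ v a * polAct ρ (v * y) (s * b)
        rw [map_mul, map_mul, polAct_mul_apply ρ _ _ s, hy s hs]
        ring)
  tlift (M := graphs ρ S) (N := reflBimod ρ x)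
    ((LinearMap.mul ℝ (Pol V)).compl₁₂ (gev ρ v) φ) (by
      intro s _ q β
      change gev ρ v ((graphs ρ S).right s q) * φ β = gev ρ v q * φ (tensorLeft _ _ _ s β)
      have h : φ (tensorLeft _ (unit V) (unit V) s β) = polAct ρ v s * φ β := by
        refine tensor_ext_apply (φ ∘ₗ tensorLeft _ (unit V) (unit V) s)
          (LinearMap.mul ℝ (Pol V) (polAct ρ v s) ∘ₗ φ) (fun a b => ?_) β
        change polAct ρ v (s * a) * polAct ρ (v * y) b =
          polAct ρ v s * (polAct ρ v a * polAct ρ (v * y) b)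
        rw [map_mul, mul_assoc]
      rw [gev_right, h]
      ring)

variable {S : Finset G} {x y : G} (v : S) (hy : ∀ s ∈ invariants ρ x, polAct ρ y s = s)

theorem triEv_tri (q a b) :
    triEv ρ v hy (tri ρ S x q a b) = gev ρ v q * (polAct ρ v a * polAct ρ (v * y) b) := rfl

theorem triEv_left (r m) :
    triEv ρ v hy (((graphs ρ S).tensor (reflBimod ρ x)).left r m) = r * triEv ρ v hy m := by
  suffices h : m ∈ LinearMap.eqLocus
      (triEv ρ v hy ∘ₗ ((graphs ρ S).tensor (reflBimod ρ x)).left r)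
      (LinearMap.mul ℝ (Pol V) r ∘ₗ triEv ρ v hy) from h
  refine tri_induction _ (fun q a b => ?_) m
  change triEv ρ v hy (((graphs ρ S).tensor (reflBimod ρ x)).left r (tri ρ S x q a b)) =
    r * triEv ρ v hy (tri ρ S x q a b)
  rw [left_tri, triEv_tri, triEv_tri, gev_left]
  ring

theorem triEv_right (r m) :
    triEv ρ v hy (((graphs ρ S).tensor (reflBimod ρ x)).right r m) =
      polAct ρ (v * y) r * triEv ρ v hy m := by
  suffices h : m ∈ LinearMap.eqLocus
      (triEv ρ v hy ∘ₗ ((graphs ρ S).tensor (reflBimod ρ x)).right r)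
      (LinearMap.mul ℝ (Pol V) (polAct ρ (v * y) r) ∘ₗ triEv ρ v hy) from h
  refine tri_induction _ (fun q a b => ?_) m
  change triEv ρ v hy (((graphs ρ S).tensor (reflBimod ρ x)).right r (tri ρ S x q a b)) =
    polAct ρ (v * y) r * triEv ρ v hy (tri ρ S x q a b)
  rw [right_tri, triEv_tri, triEv_tri, map_mul]
  ring

theorem triEv_act (θ m) : triEv ρ v hy (act ((graphs ρ S).tensor (reflBimod ρ x)) θ m) =
    ev ρ (v * y) θ * triEv ρ v hy m :=
  map_act_eq_ev_mul ρ (triEv_left ρ v hy) (triEv_right ρ v hy) θ m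

/-- The choices y = 1 and y = x in `triEv` give two values over each v ∈ S, attached to the graphs
of v and of vx. -/
theorem polAct_one_of_mem (s : Pol V) (_ : s ∈ invariants ρ x) : polAct ρ 1 s = s := by
  rw [polAct_one, AlgHom.id_apply]

theorem polAct_self_of_mem (s : Pol V) (hs : s ∈ invariants ρ x) : polAct ρ x s = s := hs

variable {ρ} {α : Pol V} (hα : IsRoot ρ x α)
include hα

/-- By R = R^x + R^x α, the last factor is reduced to 1 or α: invariant coefficients cross the
tensor product over R^x, and the middle factor is then absorbed into q. -/
theorem exists_eq_tri (m : ((graphs ρ S).tensor (reflBimod ρ x)).carrier) :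
    ∃ q₁ q₂, m = tri ρ S x q₁ 1 1 + tri ρ S x q₂ 1 α := by
  let f : (graphs ρ S).carrier × (graphs ρ S).carrier →ₗ[ℝ]
      ((graphs ρ S).tensor (reflBimod ρ x)).carrier :=
    ((tmkₗ ⊤ (graphs ρ S) (reflBimod ρ x)).flip
      (tmk _ (unit V) (unit V) (1 : Pol V) (1 : Pol V))).coprod
      ((tmkₗ ⊤ (graphs ρ S) (reflBimod ρ x)).flip (tmk _ (unit V) (unit V) (1 : Pol V) α))
  suffices h : m ∈ LinearMap.range f by
    obtain ⟨⟨q₁, q₂⟩, rfl⟩ := h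
    exact ⟨q₁, q₂, rfl⟩
  refine tri_induction _ (fun q a b => ?_) m
  obtain ⟨b₀, hb₀, b₁, hb₁, rfl⟩ := hα.exists_eq b
  refine ⟨((graphs ρ S).right (b₀ * a) q, (graphs ρ S).right (b₁ * a) q), ?_⟩
  change tri ρ S x ((graphs ρ S).right (b₀ * a) q) 1 1 +
    tri ρ S x ((graphs ρ S).right (b₁ * a) q) 1 α = _
  rw [tri_right, tri_right, mul_one, mul_one, tri_invariant hb₀, tri_invariant hb₁, tri_add_last,
    mul_one]

/-- For m = q₁ ⊗ 1 ⊗ 1 + q₂ ⊗ 1 ⊗ α the two values over v are q₁(v) ± q₂(v) v(α). As v(α) ≠ 0 in a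
domain, their vanishing forces q₁(v) = q₂(v) = 0. Elements of the product may thus be treated as
functions on pairs (v, y). -/
theorem tri_ext {m : ((graphs ρ S).tensor (reflBimod ρ x)).carrier}
    (h1 : ∀ v : S, triEv ρ v (x := x) (polAct_one_of_mem ρ) m = 0)
    (h2 : ∀ v : S, triEv ρ v (polAct_self_of_mem ρ) m = 0) : m = 0 := by
  obtain ⟨q₁, q₂, rfl⟩ := exists_eq_tri hα m
  have key : ∀ v : S, gev ρ v q₁ = 0 ∧ gev ρ v q₂ = 0 := by
    intro v
    have h3 := h1 v
    have h4 := h2 v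
    rw [map_add, triEv_tri, triEv_tri, mul_one] at h3
    rw [map_add, triEv_tri, triEv_tri, polAct_mul_apply, polAct_mul_apply, hα.map_eq] at h4
    simp only [map_one, mul_one, one_mul, map_neg] at h3 h4
    have h5 : gev ρ v q₁ = 0 := by
      have : (2 : ℝ) • gev ρ v q₁ = 0 := by
        rw [two_smul]
        linear_combination h3 + h4
      exact (smul_eq_zero.1 this).resolve_left two_ne_zero
    rw [h5, zero_add] at h3
    refine ⟨h5, (mul_eq_zero.1 h3).resolve_right fun h => hα.ne_zero ?_⟩
    exact polAct_injective ρ v (h.trans (map_zero _).symm)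
  have hq₁ : q₁ = 0 := graphs_ext ρ fun v => by rw [(key v).1, map_zero]
  have hq₂ : q₂ = 0 := graphs_ext ρ fun v => by rw [(key v).2, map_zero]
  rw [hq₁, hq₂, tri_zero_first, tri_zero_first, add_zero]

/-- The outer factors come from the bimodule actions, and the middle one is reduced to 1 or α by R =
R^x + R^x α. So two elements generate the product over R ⊗ R. -/
theorem mem_of_tri_mem (K : Submodule ℝ ((graphs ρ S).tensor (reflBimod ρ x)).carrier)
    (hK : ∀ θ, ∀ m ∈ K, act _ θ m ∈ K) (h1 : tri ρ S x (gmk ρ S 1) 1 1 ∈ K)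
    (h2 : tri ρ S x (gmk ρ S 1) α 1 ∈ K)
    (m : ((graphs ρ S).tensor (reflBimod ρ x)).carrier) : m ∈ K := by
  have h3 : ∀ c, tri ρ S x (gmk ρ S 1) c 1 ∈ K := by
    intro c
    obtain ⟨c₀, hc₀, c₁, hc₁, rfl⟩ := hα.exists_eq c
    rw [tri_add_mid, ← mul_one c₀, tri_invariant hc₀, tri_invariant hc₁, ← right_tri, ← right_tri,
      right_eq_act, right_eq_act]
    exact K.add_mem (hK _ _ h1) (hK _ _ h2)
  refine tri_induction K (fun q a b => ?_) m
  refine gmk_induction ρ (K.comap ((tmkₗ ⊤ (graphs ρ S) (reflBimod ρ x)).flip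
    (tmk _ (unit V) (unit V) a b))) (fun a₀ b₀ => ?_) q
  change tri ρ S x _ a b ∈ K
  rw [← left_tri, tri_right, ← mul_one b, ← right_tri, left_eq_act, right_eq_act]
  exact hK _ _ (hK _ _ (h3 _))

/-- The generators are 1 ⊗ 1 ⊗ 1, in degree −1 with all values 1, and 1 ⊗ α ⊗ 1 − 1 ⊗ 1 ⊗ α, in
degree 1 with value 0 over (v, 1) and 2 v(α) over (v, x). This triangular shape gives independence.
Stability of S ensures that every value lies over a graph in S, so both generators are killed by
`vanish ρ S`. -/
theorem graphs_tensor_refl_of_stable (hS : ∀ v ∈ S, v * x ∈ S) :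
    IsIso ((graphs ρ S).tensor (reflBimod ρ x))
      (((graphs ρ S).shift 1).sum ((graphs ρ S).shift (-1))) := by
  have hn₁ : tri ρ S x (gmk ρ S 1) 1 1 ∈ ((graphs ρ S).tensor (reflBimod ρ x)).gr (-1) :=
    tri_mem_gr (by norm_num) (gmk_one_mem ρ S) one_mem_polGr one_mem_polGr
  have hn₂ : tri ρ S x (gmk ρ S 1) α 1 - tri ρ S x (gmk ρ S 1) 1 α ∈
      ((graphs ρ S).tensor (reflBimod ρ x)).gr 1 :=
    Submodule.sub_mem _ (tri_mem_gr (by norm_num) (gmk_one_mem ρ S) hα.mem one_mem_polGr)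
      (tri_mem_gr (by norm_num) (gmk_one_mem ρ S) one_mem_polGr hα.mem)
  have hev : ∀ (v : S) {y : G} (hy : ∀ s ∈ invariants ρ x, polAct ρ y s = s) θ,
      triEv ρ v hy (act _ θ (tri ρ S x (gmk ρ S 1) 1 1)) = ev ρ (v * y) θ := by
    intro v y hy θ
    rw [triEv_act, triEv_tri, gev_gmk]
    simp
  have hev₂ : ∀ (v : S) {y : G} (hy : ∀ s ∈ invariants ρ x, polAct ρ y s = s) θ,
      triEv ρ v hy (act _ θ (tri ρ S x (gmk ρ S 1) α 1 - tri ρ S x (gmk ρ S 1) 1 α)) =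
        ev ρ (v * y) θ * (polAct ρ v α - polAct ρ (v * y) α) := by
    intro v y hy θ
    rw [triEv_act, map_sub, triEv_tri, triEv_tri, gev_gmk]
    simp
  have hkill : ∀ n, ∀ θ ∈ vanish ρ S, act ((graphs ρ S).tensor (reflBimod ρ x)) θ n = 0 := by
    intro n θ hθ
    rw [mem_vanish] at hθ
    refine tri_ext hα (fun v => ?_) fun v => ?_
    · rw [triEv_act, mul_one, hθ v v.2, zero_mul]
    · rw [triEv_act, hθ _ (hS v v.2), zero_mul]
  have key := isIso_graphs_sum_of_generators (ρ := ρ) (S₁ := S) (S₂ := S) hn₁ hn₂ (hkill _)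
    (hkill _) (fun θ₁ θ₂ h => ?_) fun m => ?_
  · rwa [neg_neg] at key
  · have h1 : θ₁ ∈ vanish ρ S := (mem_vanish ρ).2 fun w hw => by
      have h2 := congrArg (triEv ρ ⟨w, hw⟩ (x := x) (polAct_one_of_mem ρ)) h
      rw [map_add, hev, hev₂, map_zero, mul_one, sub_self, mul_zero, add_zero] at h2
      exact h2
    refine ⟨h1, (mem_vanish ρ).2 fun w hw => ?_⟩
    -- The graph of w is reached a second time as (wx)x, where the second generator has a nonzero
    -- value.
    have h2 := congrArg (triEv ρ ⟨w * x, hS w hw⟩ (polAct_self_of_mem ρ)) h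
    rw [map_add, hev, hev₂, map_zero, polAct_mul_apply, hα.map_eq] at h2
    simp only [mul_assoc, hα.mul_self, mul_one] at h2
    rw [(mem_vanish ρ).1 h1 w hw, zero_add] at h2
    refine (mul_eq_zero.1 h2).resolve_right fun h3 => hα.ne_zero ?_
    have h4 : (2 : ℝ) • polAct ρ w α = 0 := by
      rw [two_smul]
      rw [map_neg] at h3
      linear_combination -h3
    exact polAct_injective ρ _ (((smul_eq_zero.1 h4).resolve_left two_ne_zero).trans
      (map_zero _).symm)
  · set n₁ := tri ρ S x (gmk ρ S 1) 1 1
    set n₂ := tri ρ S x (gmk ρ S 1) α 1 - tri ρ S x (gmk ρ S 1) 1 α with hn₂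
    suffices h : m ∈ genBy _ n₁ ⊔ genBy _ n₂ by
      obtain ⟨_, ⟨θ₁, rfl⟩, _, ⟨θ₂, rfl⟩, h⟩ := Submodule.mem_sup.1 h
      exact ⟨θ₁, θ₂, h⟩
    refine mem_of_tri_mem hα _ (fun θ m hm => ?_)
      (Submodule.mem_sup_left (self_mem_genBy _ _)) ?_ m
    · obtain ⟨a, ha, b, hb, rfl⟩ := Submodule.mem_sup.1 hm
      rw [map_add]
      exact Submodule.add_mem_sup (act_mem_genBy ha θ) (act_mem_genBy hb θ)
    · have h2 : tri ρ S x (gmk ρ S 1) α 1 = act _ (1 ⊗ₜ α) n₁ + n₂ := by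
        rw [← right_eq_act, right_tri, mul_one, hn₂, add_sub_cancel]
      rw [h2]
      exact Submodule.add_mem_sup (act_mem_genBy (self_mem_genBy _ _) _) (self_mem_genBy _ _)

variable [DecidableEq G]

/-- The hypothesis says that in Q_S right multiplication of 1 by α is left multiplication by r plus
right multiplication by f. Since f is invariant it passes through B_x to the far right, so 1 ⊗ α ⊗ 1
lies in the sub-bimodule generated by 1 ⊗ 1 ⊗ 1. The values of this one generator are 1 over all
graphs of S ∪ Sx. -/
theorem graphs_tensor_refl_of_cyclic {r f : Pol V} (hf : f ∈ invariants ρ x)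
    (hrf : ∀ v ∈ S, polAct ρ v α = r + polAct ρ v f) :
    IsIso ((graphs ρ S).tensor (reflBimod ρ x))
      ((graphs ρ (S ∪ S.image (· * x))).shift 1) := by
  have hn : tri ρ S x (gmk ρ S 1) 1 1 ∈ ((graphs ρ S).tensor (reflBimod ρ x)).gr (-1) :=
    tri_mem_gr (by norm_num) (gmk_one_mem ρ S) one_mem_polGr one_mem_polGr
  have hev : ∀ (v : S) {y : G} (hy : ∀ s ∈ invariants ρ x, polAct ρ y s = s) θ,
      triEv ρ v hy (act _ θ (tri ρ S x (gmk ρ S 1) 1 1)) = ev ρ (v * y) θ := by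
    intro v y hy θ
    rw [triEv_act, triEv_tri, gev_gmk]
    simp
  have key := isIso_graphs_of_generator (ρ := ρ) (S := S ∪ S.image (· * x)) hn
    (fun θ => ?_) fun m => ?_
  · rwa [neg_neg] at key
  · rw [mem_vanish]
    constructor
    · intro h w hw
      rcases Finset.mem_union.1 hw with hw | hw
      · have := hev ⟨w, hw⟩ (polAct_one_of_mem ρ) θ
        rw [h, map_zero, mul_one] at this
        exact this.symm
      · obtain ⟨v, hv, rfl⟩ := Finset.mem_image.1 hw
        have := hev ⟨v, hv⟩ (polAct_self_of_mem ρ) θ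
        rw [h, map_zero] at this
        exact this.symm
    · intro h
      refine tri_ext hα (fun v => ?_) fun v => ?_
      · rw [hev, mul_one]
        exact h _ (Finset.mem_union_left _ v.2)
      · rw [hev]
        exact h _ (Finset.mem_union_right _ (Finset.mem_image_of_mem _ v.2))
  · rw [← mem_genBy]
    refine mem_of_tri_mem hα _ (fun θ m hm => act_mem_genBy hm θ) (self_mem_genBy _ _) ?_ m
    have h1 : (graphs ρ S).right α (gmk ρ S 1) =
        (graphs ρ S).left r (gmk ρ S 1) + (graphs ρ S).right f (gmk ρ S 1) := by
      refine graphs_ext ρ fun v => ?_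
      rw [map_add, gev_left, gev_right, gev_right, hrf v v.2]
      ring
    have h2 : tri ρ S x (gmk ρ S 1) α 1 =
        act _ (r ⊗ₜ 1 + 1 ⊗ₜ f) (tri ρ S x (gmk ρ S 1) 1 1) := by
      rw [← mul_one α, ← tri_right, h1, tri_add_first, tri_right, tri_invariant hf, map_add,
        LinearMap.add_apply, ← left_eq_act, ← right_eq_act, left_tri, right_tri]
    rw [h2]
    exact act_mem_genBy (self_mem_genBy _ _) _

/-- The second generator is r ⊗ 1 ⊗ 1 + 1 ⊗ f ⊗ 1 with f = β + kα. Its value over (v, y) is r + v(f)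
for either y, so it is supported over c and cx. Together with 1 ⊗ 1 ⊗ 1 it generates because k ≠ 0
allows solving for α. -/
theorem graphs_tensor_refl_of_split {c : G} (hc : c ∈ S) (hcx : c * x ∈ S) {r β : Pol V} {k : ℝ}
    (hk : k ≠ 0) (hr : r ∈ polGr V 2) (hβ : β ∈ invariants ρ x) (hβ₂ : β ∈ polGr V 2)
    (hz : ∀ v ∈ S, v ≠ c → v ≠ c * x → r + polAct ρ v (β + k • α) = 0) :
    IsIso ((graphs ρ S).tensor (reflBimod ρ x))
      (((graphs ρ (S ∪ S.image (· * x))).shift 1).sum ((graphs ρ {c, c * x}).shift (-1))) := by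
  set f := β + k • α with hf
  have hf₂ : f ∈ polGr V 2 := Submodule.add_mem _ hβ₂ (Submodule.smul_mem _ _ hα.mem)
  have hn₁ : tri ρ S x (gmk ρ S 1) 1 1 ∈ ((graphs ρ S).tensor (reflBimod ρ x)).gr (-1) :=
    tri_mem_gr (by norm_num) (gmk_one_mem ρ S) one_mem_polGr one_mem_polGr
  have hn₂ : tri ρ S x ((graphs ρ S).left r (gmk ρ S 1)) 1 1 + tri ρ S x (gmk ρ S 1) f 1 ∈
      ((graphs ρ S).tensor (reflBimod ρ x)).gr 1 :=
    Submodule.add_mem _ (tri_mem_gr (by norm_num) ((graphs ρ S).left_mem hr (gmk_one_mem ρ S))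
      one_mem_polGr one_mem_polGr)
      (tri_mem_gr (by norm_num) (gmk_one_mem ρ S) hf₂ one_mem_polGr)
  have hev : ∀ (v : S) {y : G} (hy : ∀ s ∈ invariants ρ x, polAct ρ y s = s) θ,
      triEv ρ v hy (act _ θ (tri ρ S x (gmk ρ S 1) 1 1)) = ev ρ (v * y) θ := by
    intro v y hy θ
    rw [triEv_act, triEv_tri, gev_gmk]
    simp
  have hev₂ : ∀ (v : S) {y : G} (hy : ∀ s ∈ invariants ρ x, polAct ρ y s = s) θ,
      triEv ρ v hy (act _ θ (tri ρ S x ((graphs ρ S).left r (gmk ρ S 1)) 1 1 +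
        tri ρ S x (gmk ρ S 1) f 1)) = ev ρ (v * y) θ * (r + polAct ρ v f) := by
    intro v y hy θ
    rw [triEv_act, map_add, triEv_tri, triEv_tri, gev_left, gev_gmk]
    simp
  have hcc : c * x * x = c := by rw [mul_assoc, hα.mul_self, mul_one]
  have key := isIso_graphs_sum_of_generators (ρ := ρ) (S₁ := S ∪ S.image (· * x))
    (S₂ := {c, c * x}) hn₁ hn₂ (fun θ hθ => ?_) (fun θ hθ => ?_) (fun θ₁ θ₂ h => ?_) fun m => ?_
  · rwa [neg_neg] at key
  · rw [mem_vanish] at hθ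
    refine tri_ext hα (fun v => ?_) fun v => ?_
    · rw [hev, mul_one]
      exact hθ _ (Finset.mem_union_left _ v.2)
    · rw [hev]
      exact hθ _ (Finset.mem_union_right _ (Finset.mem_image_of_mem _ v.2))
  · rw [mem_vanish] at hθ
    have h1 : ev ρ c θ = 0 := hθ c (by simp)
    have h2 : ev ρ (c * x) θ = 0 := hθ (c * x) (by simp)
    refine tri_ext hα (fun v => ?_) fun v => ?_
    · rw [hev₂, mul_one]
      by_cases hv : v.1 = c
      · rw [hv, h1, zero_mul]
      · by_cases hv' : v.1 = c * x
        · rw [hv', h2, zero_mul]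
        · rw [hz v v.2 hv hv', mul_zero]
    · rw [hev₂]
      by_cases hv : v.1 = c
      · rw [hv, h2, zero_mul]
      · by_cases hv' : v.1 = c * x
        · rw [hv', hcc, h1, zero_mul]
        · rw [hz v v.2 hv hv', mul_zero]
  · have e1 : ∀ v ∈ S, ev ρ v θ₁ + ev ρ v θ₂ * (r + polAct ρ v f) = 0 := by
      intro v hv
      have := congrArg (triEv ρ ⟨v, hv⟩ (x := x) (polAct_one_of_mem ρ)) h
      rwa [map_add, hev, hev₂, map_zero, mul_one] at this
    have e2 : ∀ v ∈ S, ev ρ (v * x) θ₁ + ev ρ (v * x) θ₂ * (r + polAct ρ v f) = 0 := by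
      intro v hv
      have := congrArg (triEv ρ ⟨v, hv⟩ (polAct_self_of_mem ρ)) h
      rwa [map_add, hev, hev₂, map_zero] at this
    have hne : polAct ρ c f - polAct ρ (c * x) f ≠ 0 := by
      have h1 : polAct ρ c f - polAct ρ (c * x) f = (2 * k) • polAct ρ c α := by
        rw [polAct_mul_apply, hf, map_add, map_add, map_add, map_smul, map_smul, map_smul,
          hα.map_eq, polAct_of_mem_invariants hβ, map_neg, smul_neg, mul_smul, two_smul]
        ring
      rw [h1]
      refine smul_ne_zero (mul_ne_zero two_ne_zero hk) fun h2 => hα.ne_zero ?_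
      exact polAct_injective ρ _ (h2.trans (map_zero _).symm)
    -- The pairs (c, 1) and (cx, x) both lie over the graph of c, while the second generator takes
    -- there values differing by c(f) − cx(f) = 2k c(α) ≠ 0. Subtracting kills θ₂ on c. The pairs
    -- (c, x) and (cx, 1) do the same for cx.
    have a1 := e1 c hc
    have a2 := e2 c hc
    have a3 := e1 (c * x) hcx
    have a4 := e2 (c * x) hcx
    rw [hcc] at a4
    have b1 : ev ρ c θ₂ = 0 := by
      refine (mul_eq_zero.1 ?_).resolve_right hne
      linear_combination a1 - a4
    have b2 : ev ρ (c * x) θ₂ = 0 := by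
      refine (mul_eq_zero.1 ?_).resolve_right hne
      linear_combination a2 - a3
    rw [b1, zero_mul, add_zero] at a1
    rw [b2, zero_mul, add_zero] at a2
    constructor
    · rw [mem_vanish]
      have h3 : ∀ v ∈ S, ev ρ v θ₁ = 0 ∧ ev ρ (v * x) θ₁ = 0 := by
        intro v hv
        by_cases h4 : v = c
        · rw [h4]
          exact ⟨a1, a2⟩
        · by_cases h5 : v = c * x
          · rw [h5, hcc]
            exact ⟨a2, a1⟩
          · have h6 := e1 v hv
            have h7 := e2 v hv
            rw [hz v hv h4 h5, mul_zero, add_zero] at h6 h7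
            exact ⟨h6, h7⟩
      intro w hw
      rcases Finset.mem_union.1 hw with hw | hw
      · exact (h3 w hw).1
      · obtain ⟨v, hv, rfl⟩ := Finset.mem_image.1 hw
        exact (h3 v hv).2
    · rw [mem_vanish]
      intro w hw
      rcases Finset.mem_insert.1 hw with rfl | hw
      · exact b1
      · rw [Finset.mem_singleton.1 hw]
        exact b2
  · set n₁ := tri ρ S x (gmk ρ S 1) 1 1 with hn₁
    set n₂ := tri ρ S x ((graphs ρ S).left r (gmk ρ S 1)) 1 1 + tri ρ S x (gmk ρ S 1) f 1 with hn₂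
    suffices h : m ∈ genBy _ n₁ ⊔ genBy _ n₂ by
      obtain ⟨_, ⟨θ₁, rfl⟩, _, ⟨θ₂, rfl⟩, h⟩ := Submodule.mem_sup.1 h
      exact ⟨θ₁, θ₂, h⟩
    refine mem_of_tri_mem hα _ (fun θ m hm => ?_)
      (Submodule.mem_sup_left (self_mem_genBy _ _)) ?_ m
    · obtain ⟨a, ha, b, hb, rfl⟩ := Submodule.mem_sup.1 hm
      rw [map_add]
      exact Submodule.add_mem_sup (act_mem_genBy ha θ) (act_mem_genBy hb θ)
    -- From kα = f − β: the f-term is n₂ minus r times n₁, and β, being invariant, acts from the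
    -- right.
    · have h2 : tri ρ S x (gmk ρ S 1) α 1 =
          k⁻¹ • (act _ (-(r ⊗ₜ 1) - 1 ⊗ₜ β) n₁ + n₂) := by
        rw [eq_inv_smul_iff₀ hk, map_sub, map_neg, LinearMap.sub_apply, LinearMap.neg_apply,
          ← left_eq_act, ← right_eq_act, right_tri, left_tri, hn₂, hf, tri_add_mid, tri_smul_mid]
        have h3 : tri ρ S x (gmk ρ S 1) β 1 = tri ρ S x (gmk ρ S 1) 1 (β * 1) := by
          rw [← tri_invariant hβ, mul_one]
        rw [h3]
        abel
      rw [h2]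
      exact Submodule.smul_mem _ _
        (Submodule.add_mem_sup (act_mem_genBy (self_mem_genBy _ _) _) (self_mem_genBy _ _))

end Products

/-! ### Generated categories with a finite list of indecomposable objects up to shift -/

section Decomposition

variable {V : Type u} [AddCommGroup V] [Module ℝ V] {ι : Type*} (Q : ι → GrBimod V)

/-- The shifts of a family of graded bimodules. -/
def shifts (a : ι × ℤ) : GrBimod V := (Q a.1).shift a.2

/-- `M` is a finite direct sum of shifts of the `Q i` with `p i`. -/
def IsSumOf (p : ι → Prop) (M : GrBimod V) : Prop :=
  ∃ l : List (ι × ℤ), (∀ a ∈ l, p a.1) ∧ IsIso M (bigSum (shifts Q) l)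

variable {Q} {p : ι → Prop} {M N : GrBimod V}

namespace IsSumOf

theorem of_iso (hM : IsSumOf Q p M) (h : IsIso N M) : IsSumOf Q p N :=
  let ⟨l, hl, hM⟩ := hM
  ⟨l, hl, h.trans hM⟩

theorem single {i : ι} (hi : p i) (n : ℤ) : IsSumOf Q p ((Q i).shift n) :=
  ⟨[(i, n)], by simpa using hi, isIso_bigSum_singleton (F := shifts Q) (i, n)⟩

theorem of_subsingleton [Subsingleton M.carrier] : IsSumOf Q p M :=
  ⟨[], by simp, IsIso.of_subsingleton _ _⟩

theorem sum (hM : IsSumOf Q p M) (hN : IsSumOf Q p N) : IsSumOf Q p (M.sum N) := by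
  obtain ⟨l, hl, hM⟩ := hM
  obtain ⟨l', hl', hN⟩ := hN
  refine ⟨l ++ l', fun a ha => ?_, (hM.sum hN).trans (bigSum_append l l').symm⟩
  exact (List.mem_append.1 ha).elim (hl a) (hl' a)

theorem bigSum_induction {motive : GrBimod V → Prop} (hM : IsSumOf Q p M)
    (iso : ∀ {M N}, IsIso M N → motive N → motive M) (zero : motive (zeroBimod V))
    (add : ∀ i n M, p i → motive M → motive (((Q i).shift n).sum M)) : motive M := by
  obtain ⟨l, hl, h⟩ := hM
  refine iso h ?_
  clear h
  induction l with
  | nil => exact zero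
  | cons a l ih =>
    exact add a.1 a.2 _ (hl a List.mem_cons_self) (ih fun b hb => hl b (List.mem_cons_of_mem _ hb))

theorem shift (hM : IsSumOf Q p M) (n : ℤ) : IsSumOf Q p (M.shift n) := by
  refine hM.bigSum_induction (motive := fun M => IsSumOf Q p (M.shift n))
    (fun h hN => hN.of_iso (h.shift n)) of_subsingleton fun i k M hi ih => ?_
  exact (((single hi (k + n)).of_iso (IsIso.shift_shift _ _ _)).sum ih).of_iso
    (IsIso.shift_sum _ _ _)

theorem tensor (hN : ∀ i, p i → IsSumOf Q p ((Q i).tensor N)) (hM : IsSumOf Q p M) :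
    IsSumOf Q p (M.tensor N) := by
  refine hM.bigSum_induction (motive := fun M => IsSumOf Q p (M.tensor N))
    (fun h hN => hN.of_iso (h.tensor (IsIso.refl _))) ?_ fun i k M hi ih => ?_
  · have : Subsingleton ((zeroBimod V).tensor N).carrier := by
      refine subsingleton_of_forall_eq 0 fun x => ?_
      rw [← Submodule.mem_bot ℝ]
      exact tensor_span x fun m n => tmk_zero_left n
    exact of_subsingleton
  · exact ((((hN i hi).shift k).of_iso (IsIso.shift_tensor _ _ _)).sum ih).of_iso
      (IsIso.sum_tensor _ _ _)

theorem left_of_sum (hQ : ∀ a, IsBrick (shifts Q a)) (h : IsSumOf Q p (M.sum N)) :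
    IsSumOf Q p M := by
  obtain ⟨l, hl, h⟩ := h
  obtain ⟨l', hl', h⟩ := exists_bigSum_of_sum hQ h
  exact ⟨l', fun a ha => hl a (hl' ha), h⟩

/-- The objects of a generated category are direct sums of the given bricks, provided that these
are stable under right multiplication by the generators. -/
theorem of_generated (hQ : ∀ a, IsBrick (shifts Q a)) {𝒢 : Set (GrBimod V)}
    (hunit : IsSumOf Q p (unit V)) (h𝒢 : ∀ N ∈ 𝒢, ∀ i, p i → IsSumOf Q p ((Q i).tensor N))
    (hM : Generated 𝒢 M) : IsSumOf Q p M := by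
  -- Quantifying over all left factors L makes the induction work: tensor products reduce to
  -- successive right multiplications by associativity, and direct summands to closure of sums of
  -- bricks under summands.
  suffices h : ∀ L, IsSumOf Q p L → IsSumOf Q p (L.tensor M) from
    (h _ hunit).of_iso (IsIso.unit_tensor M).symm
  induction hM with
  | of N hN => exact fun L hL => tensor (h𝒢 N hN) hL
  | unit => exact fun L hL => hL.of_iso (IsIso.tensor_unit L)
  | tensor M N _ _ hM hN => exact fun L hL => (hN _ (hM L hL)).of_iso (IsIso.tensor_assoc _ _ _).symm
  | shift M n _ hM => exact fun L hL => ((hM L hL).shift n).of_iso (IsIso.tensor_shift _ _ _)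
  | sum M N _ _ hM hN => exact fun L hL => ((hM L hL).sum (hN L hL)).of_iso (IsIso.tensor_sum _ _ _)
  | summand M N P _ hMN hM =>
    exact fun L hL => left_of_sum hQ (N := L.tensor P)
      ((hM L hL).of_iso ((IsIso.tensor_sum _ _ _).symm.trans ((IsIso.refl L).tensor hMN.symm)))
  | iso M N _ hMN hM => exact fun L hL => (hM L hL).of_iso ((IsIso.refl L).tensor hMN.symm)

/-- An indecomposable direct sum of indecomposable bimodules is one of them. -/
theorem exists_isIso (hQ : ∀ a, Nontrivial (shifts Q a).carrier) (hM : IsSumOf Q p M)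
    (hM' : M.Indecomposable) : ∃ i n, p i ∧ IsIso M ((Q i).shift n) := by
  obtain ⟨l, hl, h⟩ := hM
  cases l with
  | nil => exact absurd hM'.1 (not_nontrivial_iff_subsingleton.2 h.subsingleton)
  | cons a l =>
    have := (hM'.2 _ _ h).resolve_left (not_subsingleton_iff_nontrivial.2 (hQ a))
    exact ⟨a.1, a.2, hl a List.mem_cons_self, h.trans (IsIso.sum_of_subsingleton _ _)⟩

end IsSumOf

theorem generated_zero (𝒢 : Set (GrBimod V)) : Generated 𝒢 (zeroBimod V) :=
  .summand (unit V) _ (unit V) .unit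
    ((IsIso.sum_comm _ _).trans (IsIso.sum_of_subsingleton _ _)).symm

theorem GrBimod.Generated.mono {𝒢 𝒢' : Set (GrBimod V)} (h : 𝒢 ⊆ 𝒢') (hM : Generated 𝒢 M) :
    Generated 𝒢' M := by
  induction hM with
  | of N hN => exact .of _ (h hN)
  | unit => exact .unit
  | tensor M N _ _ hM hN => exact .tensor _ _ hM hN
  | shift M n _ hM => exact .shift _ _ hM
  | sum M N _ _ hM hN => exact .sum _ _ hM hN
  | summand M N P _ hMN hM => exact .summand _ _ _ hM hMN
  | iso M N _ hMN hM => exact .iso _ _ hM hMN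

theorem GrBimod.Generated.of_shift {𝒢 : Set (GrBimod V)} {n : ℤ} (hM : Generated 𝒢 (M.shift n)) :
    Generated 𝒢 M := by
  refine .iso _ _ (.shift _ (-n) hM) ((IsIso.shift_shift _ _ _).trans ?_)
  rw [add_neg_cancel]
  exact IsIso.shift_zero _

/-! ### The split Grothendieck ring -/

variable {𝒢 : Set (GrBimod V)}

theorem cls_zero (h : Generated 𝒢 (zeroBimod V)) : cls (zeroBimod V) h = 0 := by
  have h1 := cls_sum h h
  have h2 : cls _ (.sum _ _ h h) = cls (zeroBimod V) h :=
    cls_eq_of_iso _ _ (IsIso.sum_of_subsingleton _ _)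
  rw [h2] at h1
  exact left_eq_add.1 h1

section Basis

variable (hQ : ∀ a, IsBrick (shifts Q a)) (hQ' : ∀ a, (shifts Q a).Indecomposable)
  (hinj : ∀ a b, IsIso (shifts Q a) (shifts Q b) → a = b)
  (hgen : ∀ M, Generated 𝒢 M → IsSumOf Q (fun _ => True) M)

/-- The sum `∑ v^n [i]` over the members `(i, n)` of a list. -/
def listClass (l : List (ι × ℤ)) : ι →₀ ℤ[T;T⁻¹] :=
  (l.map fun a => Finsupp.single a.1 (LaurentPolynomial.T a.2)).sum

include hgen in
theorem exists_list (x : IsoClass 𝒢) :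
    ∃ l : List (ι × ℤ), ∀ M hM, isoClass M hM = x → IsIso M (bigSum (shifts Q) l) := by
  induction x using IsoClass.ind with | h N hN
  obtain ⟨l, -, hl⟩ := hgen N hN
  exact ⟨l, fun M hM h => (isoClass_eq_iff.1 h).trans hl⟩

/-- The graded multiplicities of the indecomposable summands. -/
def multiplicity (x : IsoClass 𝒢) : ι →₀ ℤ[T;T⁻¹] :=
  listClass (exists_list hgen x).choose

include hQ hQ' hinj in
-- Independence of the chosen decomposition, by uniqueness up to permutation.
theorem multiplicity_eq {l : List (ι × ℤ)} (hM : Generated 𝒢 M)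
    (h : IsIso M (bigSum (shifts Q) l)) :
    multiplicity hgen (isoClass M hM) = listClass l := by
  have h1 := (exists_list hgen (isoClass M hM)).choose_spec M hM rfl
  exact ((perm_of_isIso_bigSum hQ hQ' hinj (h1.symm.trans h)).map _).sum_eq

include hQ hQ' hinj in
theorem lift_multiplicity_eq_zero {x : FreeAbelianGroup (IsoClass 𝒢)} (hx : x ∈ splitRel 𝒢) :
    FreeAbelianGroup.lift (multiplicity hgen) x = 0 := by
  induction hx using AddSubgroup.closure_induction with
  | zero => exact map_zero _
  | neg a _ ha => rw [map_neg, ha, neg_zero]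
  | add a b _ _ ha hb => rw [map_add, ha, hb, add_zero]
  | mem z hz =>
    obtain ⟨M, N, hM, hN, rfl⟩ := hz
    obtain ⟨l, -, hl⟩ := hgen M hM
    obtain ⟨l', -, hl'⟩ := hgen N hN
    simp only [map_sub, FreeAbelianGroup.lift_apply_of]
    rw [multiplicity_eq hQ hQ' hinj hgen hM hl, multiplicity_eq hQ hQ' hinj hgen hN hl',
      multiplicity_eq hQ hQ' hinj hgen _ ((hl.sum hl').trans (bigSum_append l l').symm)]
    simp [listClass]

include hQ hQ' hinj in
theorem exists_multiplicityHom : ∃ Φ : SplitGrothendieckRing 𝒢 →+ (ι →₀ ℤ[T;T⁻¹]),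
    ∀ M hM, Φ (cls M hM) = multiplicity hgen (isoClass M hM) := by
  refine ⟨⟨⟨Quotient.lift (FreeAbelianGroup.lift (multiplicity hgen)) ?_, ?_⟩, ?_⟩, ?_⟩
  · intro a b hab
    have h1 : (splitIdeal 𝒢).ringCon a b := hab
    rw [TwoSidedIdeal.rel_iff, splitIdeal, TwoSidedIdeal.mem_mk'] at h1
    have h2 := lift_multiplicity_eq_zero hQ hQ' hinj hgen h1
    rwa [map_sub, sub_eq_zero] at h2
  · exact map_zero (FreeAbelianGroup.lift (multiplicity hgen))
  · intro x y
    induction x using Quotient.inductionOn with | h x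
    induction y using Quotient.inductionOn with | h y
    exact map_add (FreeAbelianGroup.lift (multiplicity hgen)) x y
  · intro M hM
    exact FreeAbelianGroup.lift_apply_of _ _

variable (hQgen : ∀ i, Generated 𝒢 (Q i))

include hgen in
theorem linearCombination_surjective :
    Function.Surjective
      (Finsupp.linearCombination ℤ[T;T⁻¹] fun i => cls (Q i) (hQgen i)) := by
  rw [← LinearMap.range_eq_top, eq_top_iff]
  rintro x -
  have key : ∀ l : List (ι × ℤ), ∃ h : Generated 𝒢 (bigSum (shifts Q) l),
      cls _ h ∈ LinearMap.range
        (Finsupp.linearCombination ℤ[T;T⁻¹] fun i => cls (Q i) (hQgen i)) := by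
    intro l
    induction l with
    | nil =>
      exact ⟨generated_zero 𝒢, (congrArg (· ∈ LinearMap.range _) (cls_zero _)).mpr (zero_mem _)⟩
    | cons a l ih =>
      obtain ⟨h, hl⟩ := ih
      refine ⟨.sum _ _ (.shift _ a.2 (hQgen a.1)) h, ?_⟩
      have h1 := cls_sum (Generated.shift _ a.2 (hQgen a.1)) h
      refine (congrArg (· ∈ LinearMap.range _) h1).mpr (add_mem ?_ hl)
      rw [← T_smul_cls _ (hQgen a.1)]
      exact ⟨Finsupp.single a.1 (LaurentPolynomial.T a.2), by simp⟩
  induction x using SplitGrothendieckRing.induction with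
  | zero => exact zero_mem _
  | of M hM =>
    obtain ⟨l, -, hl⟩ := hgen M hM
    obtain ⟨h, h'⟩ := key l
    rwa [cls_eq_of_iso hM h hl]
  | neg x hx => exact neg_mem hx
  | add x y hx hy => exact add_mem hx hy

include hQ hQ' hinj hgen in
-- The multiplicities give a left inverse. It is only known to be additive, so the identity is
-- checked on integer multiples of v^n times a basis vector, where the class is that of a single Q i
-- shifted by n.
theorem linearCombination_injective :
    Function.Injective
      (Finsupp.linearCombination ℤ[T;T⁻¹] fun i => cls (Q i) (hQgen i)) := by
  obtain ⟨Φ, hΦ⟩ := exists_multiplicityHom hQ hQ' hinj hgen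
  refine Function.LeftInverse.injective (g := Φ) fun f => ?_
  suffices h : Φ.comp (Finsupp.linearCombination ℤ[T;T⁻¹]
      fun i => cls (Q i) (hQgen i)).toAddMonoidHom = AddMonoidHom.id _ from DFunLike.congr_fun h f
  refine Finsupp.addHom_ext fun i g => ?_
  induction g using AddMonoidAlgebra.induction_linear with
  | zero => simp
  | add g g' hg hg' => rw [Finsupp.single_add, map_add, map_add, hg, hg']
  | single n a =>
    have h1 : (AddMonoidAlgebra.single n a : ℤ[T;T⁻¹]) = a • LaurentPolynomial.T n := by
      refine Eq.trans ?_ (AddMonoidAlgebra.smul_single _ _ _).symm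
      simp
    rw [h1, ← Finsupp.smul_single, map_zsmul, map_zsmul]
    congr 1
    simp only [AddMonoidHom.comp_apply, LinearMap.toAddMonoidHom_coe,
      Finsupp.linearCombination_single, AddMonoidHom.id_apply]
    rw [T_smul_cls, hΦ]
    refine (multiplicity_eq hQ hQ' hinj hgen (.shift _ n (hQgen i))
      (isIso_bigSum_singleton (F := shifts Q) (i, n))).trans ?_
    simp [listClass]

include hQ hQ' hinj hgen hQgen in
/-- The classes of the indecomposable objects up to shift form a basis of the split Grothendieck
ring. -/
theorem exists_basis : Nonempty (Module.Basis ι ℤ[T;T⁻¹] (SplitGrothendieckRing 𝒢)) :=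
  ⟨.ofRepr (LinearEquiv.ofBijective _ ⟨linearCombination_injective hQ hQ' hinj hgen hQgen,
    linearCombination_surjective hgen hQgen⟩).symm⟩

end Basis

end Decomposition

/-! ### The symmetric group on three letters -/

section Combinatorics

open Equiv

/-- A set of permutations is balanced if it is nonempty and contains as many even as odd
permutations. -/
def IsBalanced (S : Finset (Perm (Fin 3))) : Prop :=
  S.Nonempty ∧ (S.filter fun w => Perm.sign w = 1).card = (S.filter fun w => Perm.sign w = -1).card

instance : DecidablePred IsBalanced := fun _ => inferInstanceAs (Decidable (_ ∧ _))

/-- The sets of permutations that parametrize the indecomposable bimodules. -/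
def Shape : Type := {S : Finset (Perm (Fin 3)) // S.card = 1 ∨ IsBalanced S}

instance : Fintype Shape :=
  inferInstanceAs (Fintype {S : Finset (Perm (Fin 3)) // S.card = 1 ∨ IsBalanced S})

set_option maxRecDepth 100000

/-- There are 6 singletons, 3 · 3 pairs, 3 · 3 quadruples and the whole group. -/
theorem card_shape : Fintype.card Shape = 25 := by
  change Fintype.card {S : Finset (Perm (Fin 3)) // S.card = 1 ∨ IsBalanced S} = 25
  decide +kernel

/-- The three alternatives are those of the product formulas: stable, cyclic and split. -/
theorem IsBalanced.cases : ∀ S : Finset (Perm (Fin 3)), IsBalanced S → ∀ x, Perm.sign x = -1 →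
    S.image (· * x) = S ∨
    (∃ a ∈ S, ∃ b ∈ S, S = {a, b} ∧ Perm.sign a ≠ Perm.sign b ∧ b ≠ a * x) ∨
    (∃ c ∈ S, ∃ a ∈ S, ∃ b ∈ S, S = {c, c * x, a, b} ∧ Perm.sign a ≠ Perm.sign b ∧
      b ≠ a * x) := by
  decide +kernel

theorem IsBalanced.union : ∀ S : Finset (Perm (Fin 3)), S.card = 1 ∨ IsBalanced S →
    ∀ x, Perm.sign x = -1 → IsBalanced (S ∪ S.image (· * x)) := by
  decide +kernel

theorem isBalanced_pair : ∀ c x : Perm (Fin 3), Perm.sign x = -1 → IsBalanced {c, c * x} := by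
  decide +kernel

theorem IsBalanced.image : ∀ S : Finset (Perm (Fin 3)), IsBalanced S → ∀ w,
    IsBalanced (S.image (· * w)) := by
  decide +kernel

/-- The element a⁻¹b is odd and different from x. The letter j is the one fixed by a⁻¹b, i is the
one fixed by x, and a⁻¹b exchanges i with the third letter x j. -/
theorem exists_index_of_ne_mul : ∀ a b x : Perm (Fin 3), Perm.sign x = -1 →
    Perm.sign a ≠ Perm.sign b → b ≠ a * x →
    ∃ i j, x i = i ∧ x j ≠ j ∧ a j = b j ∧ a (x j) = b i ∧ b (x j) = a i := by
  decide +kernel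

theorem exists_not_fixed : ∀ x : Perm (Fin 3), Perm.sign x = -1 → ∃ i, x i ≠ i := by
  decide +kernel

/-- Pairs are sorted by how they arise in C: those containing 1 from R ⊗ B_x, the others, equal to
{y, xy}, as the small summand of a product with a quadruple. -/
theorem IsBalanced.eq_pair : ∀ S : Finset (Perm (Fin 3)), IsBalanced S → S.card = 2 →
    (∃ x, Perm.sign x = -1 ∧ S = {1, x}) ∨
    ∃ x y, Perm.sign x = -1 ∧ Perm.sign y = -1 ∧ x ≠ y ∧ S = {y, y * (y * x * y)} := by
  decide +kernel

theorem IsBalanced.eq_union : ∀ S : Finset (Perm (Fin 3)), IsBalanced S → S.card = 4 →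
    ∃ a b x, Perm.sign x = -1 ∧ Perm.sign a ≠ Perm.sign b ∧ b ≠ a * x ∧
      S = {a, b} ∪ ({a, b} : Finset (Perm (Fin 3))).image (· * x) := by
  decide +kernel

theorem IsBalanced.card : ∀ S : Finset (Perm (Fin 3)), IsBalanced S →
    S.card = 2 ∨ S.card = 4 ∨ S = Finset.univ := by
  decide +kernel

theorem isBalanced_of_sign_ne : ∀ a b : Perm (Fin 3), Perm.sign a ≠ Perm.sign b →
    IsBalanced {a, b} := by
  decide +kernel

/-- With t = yxy one has yt = xy. The quadruple obtained from {1, x} and y therefore has the form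
{c, ct, a, b} with c = y, a = 1, b = x, ready for the split formula with t. -/
theorem quadruple_eq : ∀ x y : Perm (Fin 3), Perm.sign x = -1 → Perm.sign y = -1 → x ≠ y →
    Perm.sign (y * x * y) = -1 ∧ x ≠ 1 * (y * x * y) ∧
    ({1, x} ∪ ({1, x} : Finset (Perm (Fin 3))).image (· * y)) = {y, y * (y * x * y), 1, x} ∧
    (({y, y * (y * x * y), 1, x} : Finset (Perm (Fin 3))) ∪
      ({y, y * (y * x * y), 1, x} : Finset (Perm (Fin 3))).image (· * (y * x * y))) =
        Finset.univ := by
  decide +kernel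

theorem exists_distinct_transpositions : ∃ x y : Perm (Fin 3),
    Perm.sign x = -1 ∧ Perm.sign y = -1 ∧ x ≠ y := by
  decide +kernel

end Combinatorics

/-! ### Products and classification for standard representations of the symmetric group -/

section Standard

open Equiv

variable {V : Type u} [AddCommGroup V] [Module ℝ V]

/-- Linear forms `g i` that are permuted by the symmetric group and whose differences are the
equations of the reflecting hyperplanes. -/
structure IsStandard (ρ : Representation ℝ (Perm (Fin 3)) V) (g : Fin 3 → Pol V) : Prop where
  injective : Function.Injective (polAct ρ)
  mem : ∀ i, g i ∈ polGr V 2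
  map_eq : ∀ w i, polAct ρ w (g i) = g (w i)
  isRoot : ∀ x i, Perm.sign x = -1 → x i ≠ i → IsRoot ρ x (g i - g (x i))

/-- The bimodules `B_t`, for `t` an odd permutation. -/
def oddGens (ρ : Representation ℝ (Perm (Fin 3)) V) : Set (GrBimod V) :=
  {M | ∃ x, Perm.sign x = -1 ∧ M = reflBimod ρ x}

/-- The bimodules attached to the shapes. -/
def shapeBimod (ρ : Representation ℝ (Perm (Fin 3)) V) (S : Shape) : GrBimod V := graphs ρ S.1

theorem isIso_twisted_graphs {G : Type*} [Group G] [DecidableEq G] (ρ : Representation ℝ G V)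
    (w : G) : IsIso (twisted ρ w) (graphs ρ {w}) := by
  let M := twist (polAct ρ w) (polAct_mem ρ w)
  have hact : ∀ θ (r : Pol V), act M θ r = ev ρ w θ * r := fun θ r =>
    map_act_eq_ev_mul ρ (M := M) (ψ := LinearMap.id) (fun _ _ => rfl) (fun _ _ => rfl) θ r
  have key := isIso_graphs_of_generator (ρ := ρ) (S := {w}) (N := M) (n := (1 : Pol V))
    (one_mem_polGr (V := V)) (fun θ => ?_) fun m => ⟨m ⊗ₜ 1, ?_⟩
  · exact key.trans (by rw [neg_zero]; exact IsIso.shift_zero _)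
  · rw [hact, mul_one, mem_vanish]
    simp
  · rw [hact, mul_one, ev_tmul, map_one, mul_one]

variable {ρ : Representation ℝ (Perm (Fin 3)) V} {g : Fin 3 → Pol V} (h : IsStandard ρ g)

theorem isIso_unit_graphs : IsIso (unit V) (graphs ρ {1}) := by
  refine IsIso.trans ?_ (isIso_twisted_graphs ρ 1)
  have : twisted ρ 1 = unit V := by
    simp only [twisted, polAct_one]
  rw [this]
  exact IsIso.refl _

theorem graphs_singleton_tensor_refl (h : IsStandard ρ g) (a : Perm (Fin 3)) {x : Perm (Fin 3)}
    (hx : Perm.sign x = -1) : IsIso ((graphs ρ {a}).tensor (reflBimod ρ x))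
      ((graphs ρ ({a} ∪ ({a} : Finset (Perm (Fin 3))).image (· * x))).shift 1) := by
  obtain ⟨i, hi⟩ := exists_not_fixed x hx
  -- Over a single graph, right multiplication by α is a left multiplication, so f = 0 suffices.
  refine graphs_tensor_refl_of_cyclic (h.isRoot x i hx hi)
    (r := polAct ρ a (g i - g (x i))) (f := 0) (zero_mem _) fun v hv => ?_
  rw [Finset.mem_singleton.1 hv, map_zero, add_zero]

theorem graphs_pair_tensor_refl (h : IsStandard ρ g) {a b x : Perm (Fin 3)}
    (hx : Perm.sign x = -1) (hab : Perm.sign a ≠ Perm.sign b) (hb : b ≠ a * x) :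
    IsIso ((graphs ρ {a, b}).tensor (reflBimod ρ x))
      ((graphs ρ ({a, b} ∪ ({a, b} : Finset (Perm (Fin 3))).image (· * x))).shift 1) := by
  obtain ⟨i, j, hi, hj, h1, h2, h3⟩ := exists_index_of_ne_mul a b x hx hab hb
  -- With α = g j − g (x j) and the x-invariant f = g i, one needs v(α) − v(f) to agree for v = a
  -- and v = b. It does, since a j = b j while a and b exchange the images of i and x j.
  refine graphs_tensor_refl_of_cyclic (h.isRoot x j hx hj)
    (r := g (a j) - g (a (x j)) - g (a i)) (f := g i) ?_ fun v hv => ?_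
  · change polAct ρ x (g i) = g i
    rw [h.map_eq, hi]
  · rw [map_sub, h.map_eq, h.map_eq, h.map_eq]
    rcases Finset.mem_insert.1 hv with rfl | hv
    · ring
    · rw [Finset.mem_singleton.1 hv, h1, h2, h3]
      ring

theorem graphs_quadruple_tensor_refl (h : IsStandard ρ g) {c a b x : Perm (Fin 3)}
    (hx : Perm.sign x = -1) (hab : Perm.sign a ≠ Perm.sign b) (hb : b ≠ a * x) :
    IsIso ((graphs ρ {c, c * x, a, b}).tensor (reflBimod ρ x))
      (((graphs ρ ({c, c * x, a, b} ∪
        ({c, c * x, a, b} : Finset (Perm (Fin 3))).image (· * x))).shift 1).sum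
          ((graphs ρ {c, c * x}).shift (-1))) := by
  obtain ⟨-, j, -, hj, h1, -, -⟩ := exists_index_of_ne_mul a b x hx hab hb
  have hxx := (h.isRoot x j hx hj).mul_self
  have hxj : x (x j) = j := by
    rw [← Perm.mul_apply, hxx, Perm.one_apply]
  -- These choices give f = β + α/2 = g j, with β the invariant half-sum of g j and g (x j). Since a
  -- j = b j, the function r + v(f) vanishes at both v = a and v = b.
  refine graphs_tensor_refl_of_split (h.isRoot x j hx hj) (c := c) (by simp) (by simp)
    (r := -g (a j)) (β := (2⁻¹ : ℝ) • (g j + g (x j))) (k := 2⁻¹) (by norm_num)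
    (neg_mem (h.mem _)) ?_ (Submodule.smul_mem _ _ (add_mem (h.mem _) (h.mem _))) ?_
  · change polAct ρ x _ = _
    rw [map_smul, map_add, h.map_eq, h.map_eq, hxj, add_comm]
    rfl
  · intro v hv hvc hvx
    have h2 : (2⁻¹ : ℝ) • (g j + g (x j)) + (2⁻¹ : ℝ) • (g j - g (x j)) = g j := by
      module
    rw [h2, h.map_eq]
    simp only [Finset.mem_insert, Finset.mem_singleton, hvc, hvx, false_or] at hv
    rcases hv with rfl | rfl
    · exact neg_add_cancel _
    · rw [h1]
      exact neg_add_cancel _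

/-- Products of shapes with the generators `B_x`. -/
theorem isSumOf_tensor_refl (h : IsStandard ρ g) {p : Shape → Prop}
    (hp : ∀ S : Shape, IsBalanced S.1 → p S) (S : Shape) {x : Perm (Fin 3)}
    (hx : Perm.sign x = -1) : IsSumOf (shapeBimod ρ) p ((shapeBimod ρ S).tensor (reflBimod ρ x)) := by
  have hbal : ∀ (T : Finset (Perm (Fin 3))) (n : ℤ), IsBalanced T →
      IsSumOf (shapeBimod ρ) p ((graphs ρ T).shift n) := fun T n hT =>
    IsSumOf.single (Q := shapeBimod ρ) (i := ⟨T, .inr hT⟩) (hp _ hT) n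
  obtain ⟨S, hS⟩ := S
  change IsSumOf (shapeBimod ρ) p ((graphs ρ S).tensor (reflBimod ρ x))
  have hunion := hbal _ 1 (IsBalanced.union S hS x hx)
  rcases hS with hS | hS
  · obtain ⟨a, rfl⟩ := Finset.card_eq_one.1 hS
    exact hunion.of_iso (graphs_singleton_tensor_refl h a hx)
  · rcases IsBalanced.cases S hS x hx with h1 | ⟨a, -, b, -, rfl, hab, hb⟩ |
      ⟨c, -, a, -, b, -, rfl, hab, hb⟩
    · obtain ⟨i, hi⟩ := exists_not_fixed x hx
      refine ((hbal S 1 hS).sum (hbal S (-1) hS)).of_iso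
        (graphs_tensor_refl_of_stable (h.isRoot x i hx hi) fun v hv => ?_)
      rw [← h1]
      exact Finset.mem_image_of_mem _ hv
    · exact hunion.of_iso (graphs_pair_tensor_refl h hx hab hb)
    · exact (hunion.sum (hbal _ (-1) (isBalanced_pair c x hx))).of_iso
        (graphs_quadruple_tensor_refl h hx hab hb)

theorem isSumOf_tensor_twisted (S : Shape) (w : Perm (Fin 3)) :
    IsSumOf (shapeBimod ρ) (fun _ => True) ((shapeBimod ρ S).tensor (twisted ρ w)) := by
  have hS : (S.1.image (· * w)).card = 1 ∨ IsBalanced (S.1.image (· * w)) := by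
    refine S.2.imp (fun h => ?_) fun h => IsBalanced.image _ h w
    rw [Finset.card_image_of_injective _ (mul_left_injective w), h]
  exact (IsSumOf.single (Q := shapeBimod ρ) (i := ⟨_, hS⟩) trivial 0).of_iso
    ((graphs_tensor_twisted ρ S.1 w).trans (IsIso.shift_zero _).symm)

theorem isBrick_shapeBimod (a : Shape × ℤ) : IsBrick (shifts (shapeBimod ρ) a) :=
  isBrick_graphs ρ a.1.1 a.2

theorem Shape.nonempty (S : Shape) : S.1.Nonempty := by
  rcases S.2 with h | h
  · exact Finset.card_pos.1 (by omega)
  · exact h.1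

theorem indecomposable_shapeBimod (a : Shape × ℤ) : (shifts (shapeBimod ρ) a).Indecomposable :=
  indecomposable_graphs ρ a.1.nonempty a.2

theorem eq_of_isIso_shapeBimod (h : IsStandard ρ g) (a b : Shape × ℤ)
    (hab : IsIso (shifts (shapeBimod ρ) a) (shifts (shapeBimod ρ) b)) : a = b := by
  obtain ⟨h1, h2⟩ := eq_of_isIso_graphs ρ h.injective a.1.nonempty b.1.nonempty hab
  exact Prod.ext (Subtype.ext h1) h2

theorem isSumOf_unit {p : Shape → Prop} (hp : p ⟨{1}, .inl rfl⟩) :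
    IsSumOf (shapeBimod ρ) p (unit V) :=
  (IsSumOf.single (Q := shapeBimod ρ) hp 0).of_iso
    (isIso_unit_graphs.trans (IsIso.shift_zero _).symm)

/-- The objects of `C` are direct sums of shifts of `R` and of the bimodules attached to balanced
sets. -/
theorem isSumOf_of_generated_oddGens (h : IsStandard ρ g) {M : GrBimod V}
    (hM : Generated (oddGens ρ) M) :
    IsSumOf (shapeBimod ρ) (fun S => S.1 = {1} ∨ IsBalanced S.1) M := by
  refine IsSumOf.of_generated isBrick_shapeBimod (isSumOf_unit (.inl rfl)) ?_ hM
  rintro _ ⟨x, hx, rfl⟩ S -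
  exact isSumOf_tensor_refl h (fun _ => .inr) S hx

theorem isSumOf_of_generated (h : IsStandard ρ g) {M : GrBimod V}
    (hM : Generated (oddGens ρ ∪ Set.range (twisted ρ)) M) :
    IsSumOf (shapeBimod ρ) (fun _ => True) M := by
  refine IsSumOf.of_generated isBrick_shapeBimod (isSumOf_unit trivial) ?_ hM
  rintro _ (⟨x, hx, rfl⟩ | ⟨w, rfl⟩) S -
  · exact isSumOf_tensor_refl h (fun _ _ => trivial) S hx
  · exact isSumOf_tensor_twisted S w

theorem generated_graphs_one : Generated (oddGens ρ) (graphs ρ {1}) :=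
  .iso _ _ .unit isIso_unit_graphs

theorem GrBimod.Generated.tensor_refl {M : GrBimod V} (hM : Generated (oddGens ρ) M) {x : Perm (Fin 3)}
    (hx : Perm.sign x = -1) : Generated (oddGens ρ) (M.tensor (reflBimod ρ x)) :=
  .tensor _ _ hM (.of _ ⟨x, hx, rfl⟩)

/-- The bimodules attached to balanced sets are objects of `C`. -/
theorem generated_graphs_of_isBalanced (h : IsStandard ρ g) {S : Finset (Perm (Fin 3))}
    (hS : IsBalanced S) : Generated (oddGens ρ) (graphs ρ S) := by
  have h1 : ∀ x, Perm.sign x = -1 → Generated (oddGens ρ) (graphs ρ {1, x}) := by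
    intro x hx
    have h2 := Generated.of_shift (.iso _ _ (generated_graphs_one.tensor_refl hx)
      (graphs_singleton_tensor_refl h 1 hx))
    have h3 : ({1} ∪ ({1} : Finset (Perm (Fin 3))).image (· * x)) = {1, x} := by simp
    rwa [h3] at h2
  have hpair : ∀ {a b x : Perm (Fin 3)}, Perm.sign x = -1 → Perm.sign a ≠ Perm.sign b →
      b ≠ a * x → Generated (oddGens ρ) (graphs ρ {a, b}) → Generated (oddGens ρ)
        (graphs ρ ({a, b} ∪ ({a, b} : Finset (Perm (Fin 3))).image (· * x))) :=
    fun hx hab hb hM => Generated.of_shift (.iso _ _ (hM.tensor_refl hx)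
      (graphs_pair_tensor_refl h hx hab hb))
  -- Multiplying {1, x} by B_y gives a quadruple, and multiplying that by B_{yxy} splits into the
  -- whole group and the pair {y, xy}; both are direct summands, hence in C.
  have hquad : ∀ x y : Perm (Fin 3), Perm.sign x = -1 → Perm.sign y = -1 → x ≠ y →
      Generated (oddGens ρ) (graphs ρ {y, y * (y * x * y)}) ∧
      Generated (oddGens ρ) (graphs ρ Finset.univ) := by
    intro x y hx hy hxy
    obtain ⟨e1, e2, e3, e4⟩ := quadruple_eq x y hx hy hxy
    have hs : Perm.sign (1 : Perm (Fin 3)) ≠ Perm.sign x := by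
      rw [hx, Perm.sign_one]
      decide
    have h2 := hpair hy hs (by rwa [one_mul]) (h1 x hx)
    rw [e3] at h2
    have h3 := graphs_quadruple_tensor_refl h (c := y) e1 hs e2
    have h4 := h2.tensor_refl e1
    have h5 := Generated.of_shift (.summand _ _ _ h4 h3)
    rw [e4] at h5
    exact ⟨.of_shift (.summand _ _ _ h4 (h3.trans (IsIso.sum_comm _ _))), h5⟩
  have htwo : ∀ T : Finset (Perm (Fin 3)), IsBalanced T → T.card = 2 →
      Generated (oddGens ρ) (graphs ρ T) := by
    intro T hT hT2
    rcases IsBalanced.eq_pair T hT hT2 with ⟨x, hx, rfl⟩ | ⟨x, y, hx, hy, hxy, rfl⟩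
    · exact h1 x hx
    · exact (hquad x y hx hy hxy).1
  rcases IsBalanced.card S hS with h2 | h2 | rfl
  · exact htwo S hS h2
  · obtain ⟨a, b, x, hx, hab, hb, rfl⟩ := IsBalanced.eq_union S hS h2
    exact hpair hx hab hb (htwo _ (isBalanced_of_sign_ne a b hab)
      (Finset.card_pair fun hab' => hab (hab' ▸ rfl)))
  · obtain ⟨x, y, hx, hy, hxy⟩ := exists_distinct_transpositions
    exact (hquad x y hx hy hxy).2

theorem generated_twisted (w : Perm (Fin 3)) :
    Generated (oddGens ρ ∪ Set.range (twisted ρ)) (twisted ρ w) :=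
  .of _ (.inr ⟨w, rfl⟩)

theorem generated_shapeBimod (h : IsStandard ρ g) (S : Shape) :
    Generated (oddGens ρ ∪ Set.range (twisted ρ)) (shapeBimod ρ S) := by
  obtain ⟨S, hS | hS⟩ := S
  · obtain ⟨w, rfl⟩ := Finset.card_eq_one.1 hS
    exact .iso _ _ (generated_twisted w) (isIso_twisted_graphs ρ w)
  · exact (generated_graphs_of_isBalanced h hS).mono Set.subset_union_left

/-- As an indecomposable object of C, a shift of R_w would be a shift of some Q_S with S = {1} or S
balanced. But Q determines its set, and {w} is neither. -/
theorem not_generated_twisted (h : IsStandard ρ g) {w : Perm (Fin 3)} (hw : w ≠ 1) (n : ℤ) :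
    ¬ Generated (oddGens ρ) ((twisted ρ w).shift n) := by
  intro hM
  have hiso := (isIso_twisted_graphs ρ w).shift n
  have hind : ((twisted ρ w).shift n).Indecomposable :=
    hiso.indecomposable (indecomposable_graphs ρ (Finset.singleton_nonempty w) n)
  obtain ⟨S, m, hS, hSm⟩ := (isSumOf_of_generated_oddGens h hM).exists_isIso
    (fun a => (indecomposable_shapeBimod a).1) hind
  have h1 := (eq_of_isIso_graphs ρ h.injective (Finset.singleton_nonempty w) S.nonempty
    (hiso.symm.trans hSm)).1
  rw [← h1, Finset.singleton_inj] at hS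
  refine hS.elim hw fun h2 => ?_
  rcases IsBalanced.card _ h2 with h3 | h3 | h3
  · simp at h3
  · simp at h3
  · have := congrArg Finset.card h3
    revert this
    rw [Finset.card_singleton]
    decide

/-- The classification of the indecomposable objects of `C^ext`. -/
theorem indecomposable_iff (h : IsStandard ρ g) (M : GrBimod V) :
    Generated (oddGens ρ ∪ Set.range (twisted ρ)) M ∧ M.Indecomposable ↔
      (Generated (oddGens ρ) M ∧ M.Indecomposable) ∨
        ∃ w : Perm (Fin 3), w ≠ 1 ∧ ∃ n : ℤ, M.IsIso ((twisted ρ w).shift n) := by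
  constructor
  · rintro ⟨hM, hind⟩
    obtain ⟨S, n, -, hSn⟩ := (isSumOf_of_generated h hM).exists_isIso
      (fun a => (indecomposable_shapeBimod a).1) hind
    obtain ⟨S, hS | hS⟩ := S
    · obtain ⟨w, rfl⟩ := Finset.card_eq_one.1 hS
      by_cases hw : w = 1
      · subst hw
        exact .inl ⟨.iso _ _ (.shift _ n generated_graphs_one) hSn.symm, hind⟩
      · exact .inr ⟨w, hw, n, hSn.trans ((isIso_twisted_graphs ρ w).shift n).symm⟩
    · exact .inl ⟨.iso _ _ (.shift _ n (generated_graphs_of_isBalanced h hS)) hSn.symm, hind⟩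
  · rintro (⟨hM, hind⟩ | ⟨w, -, n, hiso⟩)
    · exact ⟨hM.mono Set.subset_union_left, hind⟩
    · exact ⟨.iso _ _ (.shift _ n (generated_twisted w)) hiso.symm,
        (hiso.trans ((isIso_twisted_graphs ρ w).shift n)).indecomposable
          (indecomposable_graphs ρ (Finset.singleton_nonempty w) n)⟩

theorem eq_of_isIso_twisted (h : IsStandard ρ g) {w w' : Perm (Fin 3)} {n : ℤ}
    (hiso : IsIso (twisted ρ w) ((twisted ρ w').shift n)) : w = w' := by
  have h1 := ((isIso_twisted_graphs ρ w).trans (IsIso.shift_zero _).symm).symm.trans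
    (hiso.trans ((isIso_twisted_graphs ρ w').shift n))
  exact Finset.singleton_injective (eq_of_isIso_graphs ρ h.injective
    (Finset.singleton_nonempty w) (Finset.singleton_nonempty w') h1).1

theorem exists_basis_shape (h : IsStandard ρ g) : Nonempty (Module.Basis Shape ℤ[T;T⁻¹]
    (SplitGrothendieckRing (oddGens ρ ∪ Set.range (twisted ρ)))) :=
  exists_basis isBrick_shapeBimod indecomposable_shapeBimod (eq_of_isIso_shapeBimod h)
    (fun _ hM => isSumOf_of_generated h hM) (generated_shapeBimod h)

end Standard

/-! ### Coxeter systems of type `A₂` -/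

section Coxeter

open Equiv

variable {W : Type*} [Group W] (cs : CoxeterSystem (CoxeterMatrix.A 2) W)

theorem isLiftable_swaps :
    (CoxeterMatrix.A 2).IsLiftable (![swap 0 1, swap 1 2] : Fin 2 → Perm (Fin 3)) := by
  unfold CoxeterMatrix.IsLiftable
  decide +kernel

/-- The homomorphism to the symmetric group on three letters. -/
def toPerm : W →* Perm (Fin 3) := cs.lift ⟨_, isLiftable_swaps⟩

theorem toPerm_simple (i : Fin 2) :
    toPerm cs (cs.simple i) = (![swap 0 1, swap 1 2] : Fin 2 → Perm (Fin 3)) i :=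
  cs.lift_apply_simple isLiftable_swaps i

/-- The six words are closed under left multiplication by s and t, by the braid relation. This
bounds the size of W from above. -/
theorem eq_product_of_simples (w : W) :
    let s := cs.simple 0
    let t := cs.simple 1
    w = 1 ∨ w = s ∨ w = t ∨ w = s * t ∨ w = t * s ∨ w = s * t * s := by
  intro s t
  have hs : s * s = 1 := cs.simple_mul_simple_self 0
  have ht : t * t = 1 := cs.simple_mul_simple_self 1
  -- The braid relation: sts is inverse both to tst, by (st)³ = 1, and to itself.
  have hst : t * (s * t) = s * (t * s) := by
    have h : (s * t) ^ 3 = 1 := cs.simple_mul_simple_pow 0 1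
    have h1 : (s * (t * s)) * (t * (s * t)) = 1 := by
      rw [← h, pow_succ, pow_two]
      simp only [mul_assoc]
    have h2 : (s * (t * s)) * (s * (t * s)) = 1 := by
      rw [mul_assoc s, mul_assoc t, ← mul_assoc s s, hs, one_mul, ← mul_assoc t t, ht, one_mul, hs]
    exact mul_left_cancel (h1.trans h2.symm)
  induction w using cs.simple_induction_left with
  | one => simp
  | mul_simple_left w i ih =>
    fin_cases i
    · change s * w = 1 ∨ s * w = s ∨ s * w = t ∨ s * w = s * t ∨ s * w = t * s ∨
        s * w = s * t * s
      rcases ih with rfl | rfl | rfl | rfl | rfl | rfl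
      · simp
      · simp [hs]
      · simp
      · rw [← mul_assoc s s, hs]; simp
      · simp [mul_assoc]
      · rw [mul_assoc s t, ← mul_assoc s s, hs]; simp
    · change t * w = 1 ∨ t * w = s ∨ t * w = t ∨ t * w = s * t ∨ t * w = t * s ∨
        t * w = s * t * s
      rcases ih with rfl | rfl | rfl | rfl | rfl | rfl
      · simp
      · simp
      · simp [ht]
      · rw [hst]; simp [mul_assoc]
      · rw [← mul_assoc t t, ht]; simp
      · rw [mul_assoc s t, ← hst, ← mul_assoc t t, ht]; simp

/-- The six words exhausting W go to the six distinct permutations. -/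
theorem toPerm_bijective : Function.Bijective (toPerm cs) := by
  have h0 : toPerm cs (cs.simple 0) = swap 0 1 := toPerm_simple cs 0
  have h1 : toPerm cs (cs.simple 1) = swap 1 2 := toPerm_simple cs 1
  constructor
  · rw [injective_iff_map_eq_one]
    intro w hw
    rcases eq_product_of_simples cs w with rfl | rfl | rfl | rfl | rfl | rfl
    · rfl
    all_goals
      simp only [map_mul, h0, h1] at hw
      exact absurd hw (by decide)
  · have key : ∀ p : Perm (Fin 3), p = 1 ∨ p = swap 0 1 ∨ p = swap 1 2 ∨
        p = swap 0 1 * swap 1 2 ∨ p = swap 1 2 * swap 0 1 ∨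
        p = swap 0 1 * swap 1 2 * swap 0 1 := by decide
    intro p
    rcases key p with rfl | rfl | rfl | rfl | rfl | rfl
    · exact ⟨1, map_one _⟩
    · exact ⟨_, h0⟩
    · exact ⟨_, h1⟩
    · exact ⟨cs.simple 0 * cs.simple 1, by rw [map_mul, h0, h1]⟩
    · exact ⟨cs.simple 1 * cs.simple 0, by rw [map_mul, h0, h1]⟩
    · exact ⟨cs.simple 0 * cs.simple 1 * cs.simple 0, by rw [map_mul, map_mul, h0, h1]⟩

/-- A Coxeter group of type `A₂` is the symmetric group on three letters. -/
def permEquiv : W ≃* Perm (Fin 3) := MulEquiv.ofBijective (toPerm cs) (toPerm_bijective cs)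

/-- In the symmetric group on three letters every odd permutation is a transposition, so the odd
elements form one conjugacy class. -/
theorem isReflection_iff_sign (w : W) :
    cs.IsReflection w ↔ Perm.sign (permEquiv cs w) = -1 := by
  have h0 : permEquiv cs (cs.simple 0) = swap 0 1 := toPerm_simple cs 0
  constructor
  · rintro ⟨u, i, rfl⟩
    have hi : permEquiv cs (cs.simple i) =
        (![swap 0 1, swap 1 2] : Fin 2 → Perm (Fin 3)) i := toPerm_simple cs i
    have h : ∀ i, Perm.sign ((![swap 0 1, swap 1 2] : Fin 2 → Perm (Fin 3)) i) = -1 := by decide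
    simp only [map_mul, map_inv, hi, h]
    rw [mul_right_comm, mul_inv_cancel, one_mul]
  · intro hw
    have key : ∀ p : Perm (Fin 3), Perm.sign p = -1 → ∃ q, p = q * swap 0 1 * q⁻¹ := by
      decide +kernel
    obtain ⟨q, hq⟩ := key _ hw
    refine ⟨(permEquiv cs).symm q, 0, (permEquiv cs).injective ?_⟩
    rw [hq, map_mul, map_mul, map_inv, h0, MulEquiv.apply_symm_apply]

end Coxeter

/-! ### Reflection faithful representations -/

section Forms

open Equiv

variable {V : Type u} [AddCommGroup V] [Module ℝ V]

/-- Evaluation at a vector extends to an algebra map on R, so a linear form is recovered from its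
image. -/
theorem ι_injective : Function.Injective (SymmetricAlgebra.ι ℝ (Module.Dual ℝ V)) := by
  rw [injective_iff_map_eq_zero]
  intro f hf
  ext v
  have h := congrArg (SymmetricAlgebra.lift (Module.Dual.eval ℝ V v)) hf
  rwa [SymmetricAlgebra.lift_ι_apply, map_zero] at h

theorem dual_injective {G : Type*} [Group G] {ρ : Representation ℝ G V}
    (hρ : Function.Injective ρ) : Function.Injective ρ.dual := by
  intro w w' h
  have h1 : ρ w⁻¹ = ρ w'⁻¹ := by
    ext v
    rw [← sub_eq_zero, ← Module.forall_dual_apply_eq_zero_iff ℝ]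
    intro f
    rw [map_sub, sub_eq_zero]
    exact LinearMap.congr_fun (LinearMap.congr_fun h f) v
  exact inv_injective (hρ h1)

theorem polAct_injective_of_injective {G : Type*} [Group G] {ρ : Representation ℝ G V}
    (hρ : Function.Injective ρ) : Function.Injective (polAct ρ) := by
  intro w w' h
  refine dual_injective hρ (LinearMap.ext fun f => ι_injective ?_)
  rw [← polAct_ι, h, polAct_ι]

/-- If every form fixed by the transposition x were fixed by the rotation r, then averaging over x
and over rx would give (r − 1)² = 0 on V*. Together with r³ = 1 this forces r = 1, against
faithfulness. -/
theorem exists_fixed_form {ρ : Representation ℝ (Perm (Fin 3)) V} (hρ : Function.Injective ρ) :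
    ∃ ω : Module.Dual ℝ V, ρ.dual (swap 1 2) ω = ω ∧ ρ.dual (finRotate 3) ω ≠ ω := by
  by_contra! hcon
  set x : Perm (Fin 3) := swap 1 2
  set r : Perm (Fin 3) := finRotate 3
  have hmul : ∀ a b f, ρ.dual a (ρ.dual b f) = ρ.dual (a * b) f := by
    intro a b f
    rw [map_mul, Module.End.mul_apply]
  have hone : ∀ f, ρ.dual 1 f = f := by
    intro f
    rw [map_one, Module.End.one_apply]
  have hxx : x * x = 1 := by decide
  have hrx : (r * x) * (r * x) = 1 := by decide
  have hr3 : r * (r * r) = 1 := by decide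
  have hconj' : x * r = (r * r) * x := by decide
  -- The assumption passes to the transposition rx, because r carries forms fixed by rx to forms
  -- fixed by x.
  have hcon' : ∀ η, ρ.dual (r * x) η = η → ρ.dual r η = η := by
    intro η hη
    have h1 := hcon (ρ.dual r η) (by
      rw [hmul, hconj', mul_assoc, ← hmul, hη])
    rw [hmul] at h1
    have h2 := congrArg (ρ.dual (r * r)) h1
    rw [hmul, hmul, mul_assoc, hr3, mul_one, mul_assoc, hr3, hone] at h2
    exact h2
  have h1 : ∀ f, ρ.dual r f + ρ.dual (r * x) f = f + ρ.dual x f := by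
    intro f
    rw [← hmul, ← map_add]
    refine hcon _ ?_
    rw [map_add, hmul, hxx, hone, add_comm]
  have h2 : ∀ f, ρ.dual r f + ρ.dual (r * (r * x)) f = f + ρ.dual (r * x) f := by
    intro f
    rw [← hmul r (r * x), ← map_add]
    refine hcon' _ ?_
    rw [map_add, hmul, hrx, hone, add_comm]
  have h3 : ∀ f, ρ.dual (r * r) f + ρ.dual (r * (r * x)) f = ρ.dual r f + ρ.dual (r * x) f := by
    intro f
    have := congrArg (ρ.dual r) (h1 f)
    rwa [map_add, map_add, hmul, hmul, hmul] at this
  -- This is (r − 1)² = 0: the terms in x cancel between `h2` and `h3`.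
  have h4 : ∀ f, ρ.dual (r * r) f = (2 : ℝ) • ρ.dual r f - f := by
    intro f
    have e1 := h1 f
    have e2 := h2 f
    have e3 := h3 f
    rw [two_smul]
    linear_combination (norm := module) e3 - e2
  have h5 : ∀ f, ρ.dual r f = f := by
    intro f
    have e1 := h4 (ρ.dual r f)
    have e2 := h4 f
    rw [hmul, hmul, mul_assoc, hr3, hone, e2] at e1
    have e3 : (3 : ℝ) • (ρ.dual r f - f) = 0 := by
      linear_combination (norm := module) -e1
    exact sub_eq_zero.1 ((smul_eq_zero.1 e3).resolve_left three_ne_zero)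
  have h6 : r = 1 := dual_injective hρ (LinearMap.ext fun f => (h5 f).trans (hone f).symm)
  exact absurd h6 (by decide)

/-- The rotations, indexed by the image of the first letter. -/
def rotations : Fin 3 → Perm (Fin 3) := ![1, finRotate 3, finRotate 3 * finRotate 3]

/-- The rotations represent the cosets of the stabilizer {1, (1 2)} of the letter 0. Hence the
translates of a form fixed by that stabilizer are permuted like the letters. -/
theorem mul_rotations : ∀ (w : Perm (Fin 3)) (i : Fin 3),
    w * rotations i = rotations (w i) ∨ w * rotations i = rotations (w i) * swap 1 2 := by
  decide +kernel

theorem inv_rotations_mul : ∀ i j : Fin 3, i ≠ j → (rotations i)⁻¹ * rotations j = finRotate 3 ∨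
    (rotations i)⁻¹ * rotations j = (finRotate 3)⁻¹ := by
  decide +kernel

/-- The form f − xf vanishes on V^x. The annihilator of V^x is dual to V / V^x, hence a line, and it
contains γ because 2γ = γ − xγ. -/
theorem sub_dual_mem_span {G : Type*} [Group G] {ρ : Representation ℝ G V} {x : G}
    (hxx : x * x = 1) (hx : Module.finrank ℝ (V ⧸ LinearMap.eqLocus (ρ x) LinearMap.id) = 1)
    {γ : Module.Dual ℝ V} (hγ : γ ≠ 0) (hγx : ρ.dual x γ = -γ) (f : Module.Dual ℝ V) :
    ∃ c : ℝ, f - ρ.dual x f = c • γ := by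
  set K := LinearMap.eqLocus (ρ x) LinearMap.id with hK
  have hmem : ∀ f : Module.Dual ℝ V, f - ρ.dual x f ∈ K.dualAnnihilator := by
    intro f
    rw [Submodule.mem_dualAnnihilator]
    intro v hv
    have h1 : ρ x v = v := hv
    have h2 : ρ.dual x f v = f (ρ x⁻¹ v) := rfl
    rw [LinearMap.sub_apply, h2, inv_eq_of_mul_eq_one_left hxx, h1, sub_self]
  have hγK : γ ∈ K.dualAnnihilator := by
    have h1 := hmem γ
    rw [hγx, sub_neg_eq_add, ← two_smul ℝ γ] at h1
    exact (Submodule.smul_mem_iff _ two_ne_zero).1 h1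
  have hfin : Module.finrank ℝ K.dualAnnihilator = 1 := by
    rw [← K.dualQuotEquivDualAnnihilator.finrank_eq, Subspace.dual_finrank_eq, hx]
  obtain ⟨c, hc⟩ := (finrank_eq_one_iff_of_nonzero' (⟨γ, hγK⟩ : K.dualAnnihilator)
    (fun h => hγ (congrArg Subtype.val h))).1 hfin ⟨_, hmem f⟩
  exact ⟨c, (congrArg Subtype.val hc).symm⟩

/-- For a linear form, f = (f + xf)/2 + (f − xf)/2, and the second term is a multiple of γ. The
decomposition passes to products because the square of the root is invariant. -/
theorem isRoot_of_finrank {G : Type*} [Group G] {ρ : Representation ℝ G V} {x : G}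
    (hxx : x * x = 1) (hx : Module.finrank ℝ (V ⧸ LinearMap.eqLocus (ρ x) LinearMap.id) = 1)
    {γ : Module.Dual ℝ V} (hγ : γ ≠ 0) (hγx : ρ.dual x γ = -γ) :
    IsRoot ρ x (SymmetricAlgebra.ι ℝ _ γ) := by
  have hα : polAct ρ x (SymmetricAlgebra.ι ℝ _ γ) = -SymmetricAlgebra.ι ℝ _ γ := by
    rw [polAct_ι, hγx, map_neg]
  refine ⟨hxx, fun h => hγ (ι_injective (h.trans (map_zero _).symm)), ι_mem_polGr γ, hα,
    fun r => ?_⟩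
  set α := SymmetricAlgebra.ι ℝ _ γ with hαdef
  have hαα : α * α ∈ invariants ρ x := by
    change polAct ρ x (α * α) = α * α
    rw [map_mul, hα, neg_mul_neg]
  induction r using SymmetricAlgebra.induction with
  | algebraMap c => exact ⟨_, Subalgebra.algebraMap_mem _ c, 0, zero_mem _, by simp⟩
  | ι f =>
    obtain ⟨c, hc⟩ := sub_dual_mem_span hxx hx hγ hγx f
    refine ⟨SymmetricAlgebra.ι ℝ _ ((2⁻¹ : ℝ) • (f + ρ.dual x f)), ?_,
      algebraMap ℝ _ (2⁻¹ * c), Subalgebra.algebraMap_mem _ _, ?_⟩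
    · change polAct ρ x _ = SymmetricAlgebra.ι ℝ _ _
      rw [polAct_ι, map_smul, map_add, ← Module.End.mul_apply, ← map_mul, hxx, map_one,
        Module.End.one_apply, add_comm]
    · rw [← Algebra.smul_def, hαdef, ← map_smul, ← map_add, mul_smul, ← hc]
      congr 1
      module
  | add a b ha hb =>
    obtain ⟨a₀, ha₀, a₁, ha₁, rfl⟩ := ha
    obtain ⟨b₀, hb₀, b₁, hb₁, rfl⟩ := hb
    exact ⟨a₀ + b₀, add_mem ha₀ hb₀, a₁ + b₁, add_mem ha₁ hb₁, by ring⟩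
  | mul a b ha hb =>
    obtain ⟨a₀, ha₀, a₁, ha₁, rfl⟩ := ha
    obtain ⟨b₀, hb₀, b₁, hb₁, rfl⟩ := hb
    exact ⟨a₀ * b₀ + a₁ * b₁ * (α * α), add_mem (mul_mem ha₀ hb₀) (mul_mem (mul_mem ha₁ hb₁) hαα),
      a₀ * b₁ + a₁ * b₀, add_mem (mul_mem ha₀ hb₁) (mul_mem ha₁ hb₀), by ring⟩

/-- The forms are the translates by the rotations of a form ω fixed by (1 2). They are distinct
because ω is not fixed by the rotations, and x negates the difference of two forms that it
exchanges. -/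
theorem exists_isStandard {ρ : Representation ℝ (Perm (Fin 3)) V} (hρ : Function.Injective ρ)
    (hx : ∀ x, Perm.sign x = -1 →
      Module.finrank ℝ (V ⧸ LinearMap.eqLocus (ρ x) LinearMap.id) = 1) :
    ∃ g, IsStandard ρ g := by
  obtain ⟨ω, hω, hω'⟩ := exists_fixed_form hρ
  have hmul : ∀ a b f, ρ.dual a (ρ.dual b f) = ρ.dual (a * b) f := by
    intro a b f
    rw [map_mul, Module.End.mul_apply]
  have hone : ∀ f, ρ.dual 1 f = f := by
    intro f
    rw [map_one, Module.End.one_apply]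
  let γ : Fin 3 → Module.Dual ℝ V := fun i => ρ.dual (rotations i) ω
  have hγ : ∀ w i, ρ.dual w (γ i) = γ (w i) := by
    intro w i
    change ρ.dual w (ρ.dual (rotations i) ω) = ρ.dual (rotations (w i)) ω
    rw [hmul]
    rcases mul_rotations w i with h | h
    · rw [h]
    · rw [h, ← hmul, hω]
  have hne : ∀ i j, i ≠ j → γ i ≠ γ j := by
    intro i j hij h
    have h1 : ρ.dual ((rotations i)⁻¹ * rotations j) ω = ω := by
      rw [← hmul]
      change ρ.dual _ (γ j) = ω
      rw [← h, hmul, inv_mul_cancel, hone]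
    -- Equality of two of the forms would make ω fixed by a nontrivial rotation.
    rcases inv_rotations_mul i j hij with h2 | h2
    · rw [h2] at h1
      exact hω' h1
    · rw [h2] at h1
      refine hω' ?_
      have h3 := congrArg (ρ.dual (finRotate 3)) h1
      rw [hmul, mul_inv_cancel, hone] at h3
      exact h3.symm
  refine ⟨fun i => SymmetricAlgebra.ι ℝ _ (γ i), polAct_injective_of_injective hρ,
    fun i => ι_mem_polGr _, fun w i => by rw [polAct_ι, hγ], fun x i hsx hi => ?_⟩
  have hxx : x * x = 1 := by
    have : ∀ x : Perm (Fin 3), Perm.sign x = -1 → x * x = 1 := by decide +kernel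
    exact this x hsx
  rw [← map_sub]
  refine isRoot_of_finrank hxx (hx x hsx) (sub_ne_zero.2 (hne i (x i) (Ne.symm hi))) ?_
  rw [map_sub, hγ, hγ, ← Perm.mul_apply, hxx, Perm.one_apply, neg_sub]

end Forms

/-! ### Change of group along a homomorphism -/

section Transport

variable {V : Type u} [AddCommGroup V] [Module ℝ V] {G H : Type*} [Group G] [Group H]
  (ρ : Representation ℝ G V) (φ : H →* G)

theorem polAct_comp (w : H) : polAct (ρ.comp φ) w = polAct ρ (φ w) := by
  refine SymmetricAlgebra.algHom_ext (LinearMap.ext fun f => ?_)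
  change polAct (ρ.comp φ) w (SymmetricAlgebra.ι ℝ _ f) = polAct ρ (φ w) (SymmetricAlgebra.ι ℝ _ f)
  rw [polAct_ι, polAct_ι]
  congr 1
  ext v
  change f (ρ (φ w⁻¹) v) = f (ρ (φ w)⁻¹ v)
  rw [map_inv]

theorem twisted_comp (w : H) : twisted (ρ.comp φ) w = twisted ρ (φ w) := by
  simp only [twisted, polAct_comp]

theorem reflBimod_comp (w : H) : reflBimod (ρ.comp φ) w = reflBimod ρ (φ w) := by
  have h : invariants (ρ.comp φ) w = invariants ρ (φ w) := by
    simp only [invariants, polAct_comp]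
  simp only [reflBimod, h]

end Transport

end SoergelExt
end

/-! ### The theorem for an arbitrary Coxeter system of type A₂ -/

open SoergelExt SoergelExt.GrBimod

theorem mainTheorem3 {W : Type*} [Group W] (cs : CoxeterSystem (CoxeterMatrix.A 2) W)
    {V : Type*} [AddCommGroup V] [Module ℝ V] (ρ : Representation ℝ W V)
    (hρ : SoergelExt.IsReflectionFaithful cs ρ) :
    (∀ M : SoergelExt.GrBimod V, SoergelExt.InCext cs ρ M ∧ M.Indecomposable ↔
      (SoergelExt.InC cs ρ M ∧ M.Indecomposable) ∨
        ∃ w : W, w ≠ 1 ∧ ∃ n : ℤ, M.IsIso ((SoergelExt.twisted ρ w).shift n)) ∧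
    (∀ w : W, w ≠ 1 → ∀ n : ℤ, ¬ SoergelExt.InC cs ρ ((SoergelExt.twisted ρ w).shift n)) ∧
    (∀ w w' : W, ∀ n : ℤ,
      (SoergelExt.twisted ρ w).IsIso ((SoergelExt.twisted ρ w').shift n) → w = w') ∧
    Module.Free ℤ[T;T⁻¹] (SoergelExt.GrothendieckCext cs ρ) ∧
    Module.finrank ℤ[T;T⁻¹] (SoergelExt.GrothendieckCext cs ρ) = 25 := by
  let e := permEquiv cs
  let ρ' : Representation ℝ (Equiv.Perm (Fin 3)) V := ρ.comp e.symm.toMonoidHom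
  -- Transport gives equalities of bimodules and not just isomorphisms, so the two sets of
  -- generators coincide and the categories can be rewritten literally.
  have htw : ∀ w, twisted ρ' (e w) = twisted ρ w := fun w =>
    (twisted_comp ρ e.symm.toMonoidHom (e w)).trans (congrArg _ (e.symm_apply_apply w))
  have hB : ∀ w, reflBimod ρ' (e w) = reflBimod ρ w := fun w =>
    (reflBimod_comp ρ e.symm.toMonoidHom (e w)).trans (congrArg _ (e.symm_apply_apply w))
  have hC : gensC cs ρ = oddGens ρ' := by
    ext M
    constructor
    · rintro ⟨t, ht, rfl⟩
      exact ⟨e t, (isReflection_iff_sign cs t).1 ht, (hB t).symm⟩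
    · rintro ⟨x, hx, rfl⟩
      obtain ⟨t, rfl⟩ := e.surjective x
      exact ⟨t, (isReflection_iff_sign cs t).2 hx, hB t⟩
  have hCext : gensCext cs ρ = oddGens ρ' ∪ Set.range (twisted ρ') := by
    rw [gensCext, hC]
    congr 1
    ext M
    constructor
    · rintro ⟨w, rfl⟩
      exact ⟨e w, htw w⟩
    · rintro ⟨x, rfl⟩
      obtain ⟨w, rfl⟩ := e.surjective x
      exact ⟨w, (htw w).symm⟩
  obtain ⟨g, hg⟩ : ∃ g, IsStandard ρ' g := by
    refine exists_isStandard (hρ.injective.comp e.symm.injective) fun x hx => ?_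
    obtain ⟨t, rfl⟩ := e.surjective x
    have h1 := (hρ.isReflection_iff t).1 ((isReflection_iff_sign cs t).2 hx)
    have h2 : ρ' (e t) = ρ t := congrArg ρ (e.symm_apply_apply t)
    rwa [h2]
  have he1 : ∀ {w : W}, w ≠ 1 → e w ≠ 1 := fun hw h => hw (e.map_eq_one_iff.1 h)
  refine ⟨fun M => ?_, fun w hw n => ?_, fun w w' n h => ?_, ?_⟩
  · rw [InCext, InC, hCext, hC, indecomposable_iff hg]
    refine or_congr Iff.rfl ⟨?_, ?_⟩
    · rintro ⟨x, hx, n, h⟩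
      obtain ⟨w, rfl⟩ := e.surjective x
      rw [htw] at h
      exact ⟨w, fun hw => hx (by rw [hw, map_one]), n, h⟩
    · rintro ⟨w, hw, n, h⟩
      rw [← htw] at h
      exact ⟨e w, he1 hw, n, h⟩
  · rw [InC, hC, ← htw]
    exact not_generated_twisted hg (he1 hw) n
  · rw [← htw, ← htw] at h
    exact e.injective (eq_of_isIso_twisted hg h)
  · change Module.Free ℤ[T;T⁻¹] (SplitGrothendieckRing (gensCext cs ρ)) ∧
      Module.finrank ℤ[T;T⁻¹] (SplitGrothendieckRing (gensCext cs ρ)) = 25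
    rw [hCext]
    obtain ⟨b⟩ := exists_basis_shape hg
    exact ⟨.of_basis b, (Module.finrank_eq_card_basis b).trans card_shape⟩
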